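/- **Setting.** Let $G$ be a finite group acting linearly on a real vector space $V=\mathbb R^{2k}\oplus\mathbb R^{2l}$ of dimension $2n=2k+2l$, preserving a symplectic form $\omega=\omega_1\oplus\omega_2$, and acting linearly on $\mathbb C^r$. Let $g\in G$ act as the identity on $\mathbb R^{2k}$ and preserve $\mathbb R^{2l}$ without nonzero fixed vectors there. Let $y^1,\dots,y^{2k},z^1,\dots,z^{2l}$ be the linear coordinates (written $x^i$ collectively), and let $\omega^{ij}$ be the inverse matrix of $\omega$, with blocks $\Pi_1$ (directions $y$) and $\Pi_2$ (directions $z$), regarded as bivectors $\omega^{ij}\partial_i\otimes\partial_j$. $G$ acts on functions by $(hf)(v)=f(h^{-1}v)$; $g_\perp$ denotes the matrix of $g$ on the linear functions $z^j$, and $(1\otimes X)\Pi_2$ is the bivector with matrix $\Pi_2X^{T}$. Let $C(g)$ be the centralizer of $g$. **Algebra and chains.** $\mathcal W_{2n}=\mathbb C[[y,z]]((\hbar))$ carries the Moyal–Weyl product $f\star h=\mathrm{mult}\big(e^{\frac{\hbar}{2}\omega^{ij}\partial_i\otimes\partial_j}(f\otimes h)\big)$. On $A=\mathfrak{gl}_r(\mathcal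 W_{2n})$ the group $G$ acts on entries and by conjugation. Put $C_{-m}(A)=A\otimes(A/\mathbb C1)^{\otimes m}$ for $m\ge 0$, with the diagonal action of $G$. The twisted Hochschild differential $b_g:C_{-m}(A)\to C_{-m+1}(A)$ and the twisted Connes operator $B_g:C_{-m}(A)\to C_{-m-1}(A)$ are $$b_g(a_0\otimes\cdots\otimes a_m)=a_0g(a_1)\otimes a_2\otimes\cdots\otimes a_m+\sum_{i=1}^{m-1}(-1)^ia_0\otimes\cdots\otimes a_ia_{i+1}\otimes\cdots\otimes a_m+(-1)^ma_ma_0\otimes a_1\otimes\cdots\otimes a_{m-1}$$ ($b_g=0$ for $m=0$), and $$B_g(a_0\otimes\cdots\otimes a_m)=\sum_{i=0}^m(-1)^{mi}\,1\otimes a_{m-i+1}\otimes\cdots\otimes a_m\otimes a_0\otimes g(a_1)\otimes\cdots\otimes g(a_{m-i}).$$ **Forms.** $\hat\Omega^{-\bullet}_{2k}=\mathbb C[[y^i,dy^i]]((\hbar))$ are the formal forms on the fixed locus ($m$-forms have degree $-m$), $d=dy^i\partial_{y^i}$, and $\Delta=\omega^{ij}\mathcal L_{\partial_{y^i}}\iota_{\partial_{y^j}}$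 with the sum over the directions $y$. **Correlation map.** Let $S^1_{cyc}[m+1]$ be the compactified space of $m+1$ anti-clockwise cyclically ordered points on $S^1=\mathbb R/\mathbb Z$. Cut the circle at the $g$-twist, which sits between the points $0$ and $1$: lift the points so that $\theta_1\le\theta_2\le\cdots\le\theta_m\le\theta_0\le\theta_1+1$. For two lifted points with $0<x-y<1$ set $$P_1(x,y)=\big(x-y-\tfrac12\big)\Pi_1-\Big(1\otimes\frac1{1-g_\perp^{-1}}\Big)\Pi_2,\qquad P_1(y,x)=P_1(x,y)^{T},\qquad P_2=-\Big(1\otimes\frac{g_\perp^{-1}}{1-g_\perp^{-1}}\Big)\Pi_2-\tfrac12\Pi_2 ,$$ and, on $m+1$ tensor factors ($\partial_i^{(\alpha)}$ acts on the factor $\alpha$), $$\partial_{P_1}=\tfrac12\sum_{\alpha\ne\beta}P_1(\theta_\alpha,\theta_\beta)^{ij}\,\partial_i^{(\alpha)}\partial_j^{(\beta)},\qquad \partial_{P_2}=\tfrac12\sum_{\alpha}P_2^{ij}\,\partial_i^{(\alpha)}\partial_j^{(\alpha)} .$$ Let $\mathrm{tr}_g(N_0\otimes\cdots\otimes N_m)=\mathrm{tr}(N_0\,g\,N_1\cdots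 N_m)$ on $\mathfrak{gl}_r(\mathbb C)^{\otimes(m+1)}$, with $g$ acting on $\mathbb C^r$, and let $\sigma_z$ multiply the factors together and set $z=0$. The $g$-twisted free correlation map is $$\langle O_0\otimes\cdots\otimes O_m\rangle^g_{free}=\det(1-g_\perp^{-1})^{-1}\,\sigma_z\Big(\mathrm{tr}_g\int_{S^1_{cyc}[m+1]}d\theta_0\cdots d\theta_m\;e^{\hbar\partial_{P_1}}e^{\hbar\partial_{P_2}}\,(O_0\otimes dO_1\otimes\cdots\otimes dO_m)\Big).$$ **Statement.** For every $m\ge0$ and every $C(g)$-invariant chain $O\in C_{-m}(\mathfrak{gl}_r(\mathcal W_{2n}))$, the element $\langle O\rangle^g_{free}$ is a $C(g)$-invariant form in $\hat\Omega^{-m}_{2k}$, and $$\hbar\,\Delta\langle O\rangle^g_{free}=\langle b_g(O)\rangle^g_{free},\qquad d\,\langle O\rangle^g_{free}=\langle B_g(O)\rangle^g_{free}.$$ -/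

import Mathlib

open scoped TensorProduct Matrix

noncomputable section

namespace OrbifoldHKR

/-! ## Formal power series, Laurent series in `ħ`, and `ħ`-expansions of operators -/

/-- `ℂ[[x_s : s ∈ σ]]`. -/
abbrev PS (σ : Type) : Type := MvPowerSeries σ ℂ

/-- `ℂ[[x_s : s ∈ σ]]((ħ))`. -/
abbrev Laur (σ : Type) : Type := LaurentSeries (PS σ)

instance laurAlgebra (σ : Type) : Algebra ℂ (Laur σ) := HahnSeries.instAlgebra

/-- The partial derivative `∂/∂x_s`. -/
def pd {σ : Type} (s : σ) : PS σ →ₗ[ℂ] PS σ :=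
  (MvPowerSeries.pderiv ℂ s : Derivation ℂ (PS σ) (PS σ)).toLinearMap

theorem coeff_pd {σ : Type} (s : σ) (f : PS σ) (d : σ →₀ ℕ) :
    MvPowerSeries.coeff d (pd s f) = MvPowerSeries.coeff (d + Finsupp.single s 1) f * (d s + 1) :=
  MvPowerSeries.coeff_pderiv f d

/-- A linear map of power series applied to every coefficient of a Laurent series in `ħ`. -/
def mapCoeff {σ τ : Type} (L : PS σ →ₗ[ℂ] PS τ) : Laur σ →ₗ[ℂ] Laur τ where
  toFun F := HahnSeries.map F L
  map_add' F G := by ext1; funext n; simp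
  map_smul' c F := by ext1; funext n; simp

theorem coeff_mapCoeff {σ τ : Type} (L : PS σ →ₗ[ℂ] PS τ) (F : Laur σ) (n : ℤ) :
    (mapCoeff L F).coeff n = L (F.coeff n) := rfl

theorem finite_shift {σ τ : Type} (T : ℕ → PS σ →ₗ[ℂ] PS τ) (F : Laur σ) (N : ℤ) :
    (Function.support fun n : ℕ => T n (F.coeff (N - n))).Finite := by
  refine (Set.finite_Iic (N - F.order).toNat).subset fun n hn => ?_
  rw [Set.mem_Iic]
  by_contra hlt
  apply hn
  have hz : F.coeff (N - n) = 0 := HahnSeries.coeff_eq_zero_of_lt_order (by omega)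
  simp [hz]

theorem bddBelow_hbarSeries {σ τ : Type} (T : ℕ → PS σ →ₗ[ℂ] PS τ) (F : Laur σ) :
    BddBelow (Function.support fun N : ℤ => ∑ᶠ n : ℕ, T n (F.coeff (N - n))) := by
  refine ⟨F.order, fun N hN => ?_⟩
  by_contra hlt
  apply hN
  apply finsum_eq_zero_of_forall_eq_zero
  intro n
  rw [HahnSeries.coeff_eq_zero_of_lt_order (by omega), map_zero]

/-- The operator `∑_{n ≥ 0} ħⁿ Tₙ` on Laurent series in `ħ`. Every coefficient of the result is a
finite sum. -/
def hbarSeries {σ τ : Type} (T : ℕ → PS σ →ₗ[ℂ] PS τ) : Laur σ →ₗ[ℂ] Laur τ where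
  toFun F := HahnSeries.ofSuppBddBelow (fun N : ℤ => ∑ᶠ n : ℕ, T n (F.coeff (N - n)))
    (bddBelow_hbarSeries T F)
  map_add' F G := by
    ext1; funext N
    simp only [HahnSeries.coeff_ofSuppBddBelow, HahnSeries.coeff_add, map_add]
    exact finsum_add_distrib (finite_shift T F N) (finite_shift T G N)
  map_smul' c F := by
    ext1; funext N
    simp only [HahnSeries.coeff_ofSuppBddBelow, HahnSeries.coeff_smul, map_smul, RingHom.id_apply]
    exact (smul_finsum' c (finite_shift T F N)).symm

theorem coeff_hbarSeries {σ τ : Type} (T : ℕ → PS σ →ₗ[ℂ] PS τ) (F : Laur σ) (N : ℤ) :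
    (hbarSeries T F).coeff N = ∑ᶠ n : ℕ, T n (F.coeff (N - n)) := rfl

/-- `e^{ħD} = ∑ₙ ħⁿ Dⁿ / n!`. -/
def hbarExp {σ : Type} (D : PS σ →ₗ[ℂ] PS σ) : Laur σ →ₗ[ℂ] Laur σ :=
  hbarSeries fun n => ((n.factorial : ℂ)⁻¹) • D ^ n

/-- The element `ħ`. -/
def hbar (σ : Type) : Laur σ := HahnSeries.single (1 : ℤ) 1

/-- The linear substitution `x_s ↦ ∑_t A s t x_t`. -/
def linSubst {σ : Type} [Fintype σ] (A : Matrix σ σ ℂ) : PS σ →ₐ[ℂ] PS σ :=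
  MvPowerSeries.substAlgHom
    (a := fun s => ∑ t, A s t • (MvPowerSeries.X t : PS σ))
    (MvPowerSeries.hasSubst_of_constantCoeff_zero fun s => by simp)

/-! ## External products: `N` factors in `ℂ[[x]]((ħ))` as one series in `N` copies of `x` -/

/-- The power series `f(x)` placed in the copy of the variables with label `α`. -/
def copyAt {N : ℕ} {σ : Type} [Finite σ] (α : Fin N) : PS σ →ₐ[ℂ] PS (Fin N × σ) :=
  MvPowerSeries.rename (Function.Embedding.sectR α σ)

/-- The external product `a₀ ⊗ ⋯ ⊗ a_{N-1}`, i.e. `∏ a_α(x^{(α)})`. -/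
def extProd (N : ℕ) (σ : Type) [Finite σ] :
    MultilinearMap ℂ (fun _ : Fin N => Laur σ) (Laur (Fin N × σ)) :=
  (MultilinearMap.mkPiAlgebra ℂ (Fin N) (Laur (Fin N × σ))).compLinearMap
    fun α => mapCoeff (copyAt α).toLinearMap

/-- The multiplication map: all copies of the variables are identified. -/
def multMap (N : ℕ) (σ : Type) [Finite σ] : PS (Fin N × σ) →ₐ[ℂ] PS σ :=
  MvPowerSeries.rename (Prod.snd : Fin N × σ → σ)

/-! ## The Weyl algebra -/

/-- `ℂ[[x_s : s ∈ σ]]((ħ))` with the Moyal-Weyl product of the bivector `P^{ij} ∂_i ⊗ ∂_j`. -/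
def Weyl {σ : Type} (_P : Matrix σ σ ℂ) : Type := Laur σ

section Weyl

variable {σ : Type} [Fintype σ] (P : Matrix σ σ ℂ)

instance : AddCommGroup (Weyl P) := inferInstanceAs (AddCommGroup (Laur σ))

instance : Module ℂ (Weyl P) := inferInstanceAs (Module ℂ (Laur σ))

/-- The operator `½ ∑ P^{ij} ∂_i ⊗ ∂_j` on two factors. -/
def halfPoisson : PS (Fin 2 × σ) →ₗ[ℂ] PS (Fin 2 × σ) :=
  (1 / 2 : ℂ) • ∑ i, ∑ j, P i j • (pd ((0 : Fin 2), i) ∘ₗ pd ((1 : Fin 2), j))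

/-- The Moyal-Weyl product `f ⋆ h = mult (e^{(ħ/2) P^{ij} ∂_i ⊗ ∂_j} (f ⊗ h))`. -/
def moyal (f h : Laur σ) : Laur σ :=
  mapCoeff (multMap 2 σ).toLinearMap (hbarExp (halfPoisson P) (extProd 2 σ ![f, h]))

theorem moyal_add_left (f f' h : Laur σ) : moyal P (f + f') h = moyal P f h + moyal P f' h := by
  have e := (extProd 2 σ).map_update_add ![f, h] 0 f f'
  have u : ∀ x, Function.update ![f, h] (0 : Fin 2) x = ![x, h] := by
    intro x; ext1 i; fin_cases i <;> rfl
  rw [u, u, u] at e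
  simp only [moyal, ← map_add, e]

theorem moyal_add_right (f h h' : Laur σ) : moyal P f (h + h') = moyal P f h + moyal P f h' := by
  have e := (extProd 2 σ).map_update_add ![f, h] 1 h h'
  have u : ∀ x, Function.update ![f, h] (1 : Fin 2) x = ![f, x] := by
    intro x; ext1 i; fin_cases i <;> rfl
  rw [u, u, u] at e
  simp only [moyal, ← map_add, e]

theorem moyal_smul_left (c : ℂ) (f h : Laur σ) : moyal P (c • f) h = c • moyal P f h := by
  have e := (extProd 2 σ).map_update_smul ![f, h] 0 c f
  have u : ∀ x, Function.update ![f, h] (0 : Fin 2) x = ![x, h] := by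
    intro x; ext1 i; fin_cases i <;> rfl
  rw [u, u] at e
  simp only [moyal, ← map_smul, e]

theorem moyal_smul_right (c : ℂ) (f h : Laur σ) : moyal P f (c • h) = c • moyal P f h := by
  have e := (extProd 2 σ).map_update_smul ![f, h] 1 c h
  have u : ∀ x, Function.update ![f, h] (1 : Fin 2) x = ![f, x] := by
    intro x; ext1 i; fin_cases i <;> rfl
  rw [u, u] at e
  simp only [moyal, ← map_smul, e]

theorem moyal_zero_left (h : Laur σ) : moyal P 0 h = 0 := by
  simpa using moyal_add_left P 0 0 h

theorem moyal_zero_right (f : Laur σ) : moyal P f 0 = 0 := by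
  simpa using moyal_add_right P f 0 0

theorem coeff_copyAt {N : ℕ} (α β : Fin N) (h : α ≠ β) (i : σ) (f : PS σ) (x : Fin N × σ →₀ ℕ)
    (hx : x (α, i) ≠ 0) : MvPowerSeries.coeff x (copyAt β f) = 0 := by
  apply MvPowerSeries.coeff_rename_eq_zero
  rintro ⟨y, rfl⟩
  apply hx
  apply Finsupp.mapDomain_of_notMem_range
  rintro ⟨j, hj⟩
  exact h (congrArg Prod.fst hj).symm

theorem multMap_copyAt {N : ℕ} (α : Fin N) (f : PS σ) : multMap N σ (copyAt α f) = f := by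
  unfold multMap copyAt
  rw [MvPowerSeries.rename_rename]
  exact MvPowerSeries.rename_id_apply f

theorem hbarExp_of_zero {τ : Type} (D : PS τ →ₗ[ℂ] PS τ) (F : Laur τ)
    (h : ∀ N, D (F.coeff N) = 0) : hbarExp D F = F := by
  ext1; funext N
  rw [hbarExp, coeff_hbarSeries]
  rw [finsum_eq_single _ 0]
  · simp
  · intro n hn
    obtain ⟨n, rfl⟩ := Nat.exists_eq_succ_of_ne_zero hn
    simp [pow_succ, h]

theorem moyal_one_left (h : Laur σ) : moyal P 1 h = h := by
  have e : extProd 2 σ ![1, h] = mapCoeff (copyAt 1).toLinearMap h := by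
    simp only [extProd, MultilinearMap.compLinearMap_apply, MultilinearMap.mkPiAlgebra_apply,
      Fin.prod_univ_two]
    have : mapCoeff (copyAt (σ := σ) (0 : Fin 2)).toLinearMap (1 : Laur σ) = 1 := by
      ext1; funext n
      simp only [mapCoeff, LinearMap.coe_mk, AddHom.coe_mk, HahnSeries.map_coeff,
        HahnSeries.coeff_one]
      split_ifs <;> simp
    simp [this]
  rw [moyal, e, hbarExp_of_zero]
  · ext1; funext n
    exact multMap_copyAt 1 _
  · intro N
    simp only [halfPoisson, LinearMap.smul_apply, LinearMap.sum_apply, LinearMap.comp_apply]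
    rw [Finset.sum_eq_zero, smul_zero]
    intro i _
    apply Finset.sum_eq_zero
    intro j _
    rw [smul_eq_zero]; right
    ext d
    rw [coeff_pd, coeff_pd, coeff_mapCoeff, AlgHom.toLinearMap_apply,
      coeff_copyAt 0 1 (by decide) i _ _ (by simp)]
    simp

theorem moyal_one_right (f : Laur σ) : moyal P f 1 = f := by
  have e : extProd 2 σ ![f, 1] = mapCoeff (copyAt 0).toLinearMap f := by
    simp only [extProd, MultilinearMap.compLinearMap_apply, MultilinearMap.mkPiAlgebra_apply,
      Fin.prod_univ_two]
    have : mapCoeff (copyAt (σ := σ) (1 : Fin 2)).toLinearMap (1 : Laur σ) = 1 := by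
      ext1; funext n
      simp only [mapCoeff, LinearMap.coe_mk, AddHom.coe_mk, HahnSeries.map_coeff,
        HahnSeries.coeff_one]
      split_ifs <;> simp
    simp [this]
  rw [moyal, e, hbarExp_of_zero]
  · ext1; funext n
    exact multMap_copyAt 0 _
  · intro N
    simp only [halfPoisson, LinearMap.smul_apply, LinearMap.sum_apply, LinearMap.comp_apply]
    rw [Finset.sum_eq_zero, smul_zero]
    intro i _
    apply Finset.sum_eq_zero
    intro j _
    rw [smul_eq_zero]; right
    ext d
    rw [coeff_pd, coeff_pd, coeff_mapCoeff, AlgHom.toLinearMap_apply,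
      coeff_copyAt 1 0 (by decide) j _ _ (by simp)]
    simp

/-- The Moyal-Weyl algebra: multiplication is the Moyal-Weyl product. (It is associative, but
associativity is not needed to write down the operators below.) -/
instance : NonAssocRing (Weyl P) where
  mul f h := moyal P f h
  one := (1 : Laur σ)
  left_distrib := moyal_add_right P
  right_distrib := moyal_add_left P
  zero_mul := moyal_zero_left P
  mul_zero := moyal_zero_right P
  one_mul := moyal_one_left P
  mul_one := moyal_one_right P

instance : IsScalarTower ℂ (Weyl P) (Weyl P) := ⟨fun c f h => moyal_smul_left P c f h⟩

instance : SMulCommClass ℂ (Weyl P) (Weyl P) := ⟨fun c f h => (moyal_smul_right P c f h).symm⟩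

end Weyl

/-! ## Twisted Hochschild chains -/

section Hochschild

variable (A : Type) [NonAssocRing A] [Module ℂ A]

/-- The chains `a₀ ⊗ a₁ ⊗ ⋯ ⊗ a_m ∈ A^{⊗(m+1)}`. -/
abbrev TensorChain (m : ℕ) : Type := ⨂[ℂ] _ : Fin (m + 1), A

/-- The degenerate chains, spanned by the `a₀ ⊗ ⋯ ⊗ a_m` with `a_i = 1` for some `i ≥ 1`. -/
def degenerate (m : ℕ) : Submodule ℂ (TensorChain A m) :=
  Submodule.span ℂ {t | ∃ a : Fin (m + 1) → A, (∃ i, i ≠ 0 ∧ a i = 1) ∧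
    t = PiTensorProduct.tprod ℂ a}

/-- The space `C_{-m}(A) = A ⊗ (A / ℂ1)^{⊗m}`, as the quotient of `A^{⊗(m+1)}` by the degenerate
chains. -/
abbrev Chain (m : ℕ) : Type := TensorChain A m ⧸ degenerate A m

variable {A}

/-- The class of `a₀ ⊗ ⋯ ⊗ a_m`. -/
def Chain.mk {m : ℕ} (a : Fin (m + 1) → A) : Chain A m :=
  (degenerate A m).mkQ (PiTensorProduct.tprod ℂ a)

theorem Chain.mk_eq_zero {m : ℕ} (a : Fin (m + 1) → A) {i : Fin (m + 1)} (hi : i ≠ 0)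
    (ha : a i = 1) : Chain.mk a = 0 :=
  (Submodule.Quotient.mk_eq_zero _).2 (Submodule.subset_span ⟨a, ⟨i, hi, ha⟩, rfl⟩)

/-- A map of tuples that turns a change of one entry into a linear change of one entry. -/
def Slotwise {m n : ℕ} (F : (Fin m → A) → Fin n → A) : Prop :=
  ∀ a p, ∃ q, ∃ L : A →ₗ[ℂ] A, ∀ x, F (Function.update a p x) = Function.update (F a) q (L x)

/-- The multilinear map `a ↦ [F a]` for a slotwise linear `F`. -/
def Slotwise.multilinear {m n : ℕ} {F : (Fin (m + 1) → A) → Fin (n + 1) → A} (hF : Slotwise F) :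
    MultilinearMap ℂ (fun _ : Fin (m + 1) => A) (Chain A n) where
  toFun a := Chain.mk (F a)
  map_update_add' {inst} a p x y := by
    have : inst = instDecidableEqFin (m + 1) := Subsingleton.elim _ _
    subst this
    obtain ⟨q, L, h⟩ := hF a p
    simp only [h, map_add, Chain.mk, MultilinearMap.map_update_add]
  map_update_smul' {inst} a p c x := by
    have : inst = instDecidableEqFin (m + 1) := Subsingleton.elim _ _
    subst this
    obtain ⟨q, L, h⟩ := hF a p
    simp only [h, map_smul, Chain.mk, MultilinearMap.map_update_smul]

/-- A multilinear map that vanishes on degenerate tuples, as a linear map on chains. -/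
def Chain.lift {m : ℕ} {N : Type} [AddCommGroup N] [Module ℂ N]
    (f : MultilinearMap ℂ (fun _ : Fin (m + 1) => A) N)
    (hf : ∀ (a : Fin (m + 1) → A) (i : Fin (m + 1)), i ≠ 0 → a i = 1 → f a = 0) :
    Chain A m →ₗ[ℂ] N :=
  (degenerate A m).liftQ (PiTensorProduct.lift f) (by
    rw [degenerate, Submodule.span_le]
    rintro _ ⟨a, ⟨i, hi, ha⟩, rfl⟩
    simp [hf a i hi ha])

theorem Chain.lift_mk {m : ℕ} {N : Type} [AddCommGroup N] [Module ℂ N]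
    (f : MultilinearMap ℂ (fun _ : Fin (m + 1) => A) N)
    (hf : ∀ (a : Fin (m + 1) → A) (i : Fin (m + 1)), i ≠ 0 → a i = 1 → f a = 0)
    (a : Fin (m + 1) → A) : Chain.lift f hf (Chain.mk a) = f a := by
  simp [Chain.lift, Chain.mk]

/-- The diagonal action of `h` on chains, `a₀ ⊗ ⋯ ⊗ a_m ↦ h(a₀) ⊗ ⋯ ⊗ h(a_m)`. -/
def Chain.act (h : A →ₗ[ℂ] A) (h1 : h 1 = 1) (m : ℕ) : Chain A m →ₗ[ℂ] Chain A m :=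
  Chain.lift (((degenerate A m).mkQ.compMultilinearMap (PiTensorProduct.tprod ℂ)).compLinearMap
    fun _ => h) fun a i hi ha => Chain.mk_eq_zero (fun j => h (a j)) hi (by simp [ha, h1])

variable (g : A →ₗ[ℂ] A)

/-- The tuple `(a₀, …, a_i a_{i+1}, …, a_{m+1})` for `i ≥ 1`, and `(a₀ g(a₁), a₂, …, a_{m+1})` for
`i = 0`. -/
def face {m : ℕ} (i : Fin (m + 1)) (a : Fin (m + 2) → A) : Fin (m + 1) → A := fun j =>
  if j < i then a j.castSucc
  else if j = i then (if i = 0 then a j.castSucc * g (a j.succ) else a j.castSucc * a j.succ)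
  else a j.succ

/-- The tuple `(a_{m+1} a₀, a₁, …, a_m)`. -/
def lastFace {m : ℕ} (a : Fin (m + 2) → A) : Fin (m + 1) → A := fun j =>
  if j = 0 then a (Fin.last (m + 1)) * a 0 else a j.castSucc

/-- The tuple `(1, a_{m-i+1}, …, a_m, a₀, g(a₁), …, g(a_{m-i}))`; indices `s - i` are taken modulo
`m + 1`. -/
def cyclicTerm {m : ℕ} (i : Fin (m + 1)) (a : Fin (m + 1) → A) : Fin (m + 2) → A :=
  Fin.cons 1 fun s => if i < s then g (a (s - i)) else a (s - i)

theorem slotwise_cyclicTerm {m : ℕ} (i : Fin (m + 1)) : Slotwise (cyclicTerm g (m := m) i) := by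
  intro a p
  refine ⟨(p + i).succ, if i < p + i then g else LinearMap.id, fun x => ?_⟩
  funext j
  refine Fin.cases ?_ (fun s => ?_) j
  · have h1 : (0 : Fin (m + 2)) ≠ (p + i).succ := (Fin.succ_ne_zero _).symm
    simp [cyclicTerm, Function.update_apply, h1]
  · by_cases hs : s = p + i
    · subst hs
      by_cases hi : i < p + i <;> simp [cyclicTerm, hi]
    · have h1 : s - i ≠ p := fun e => hs (by simp [← e])
      simp [cyclicTerm, h1, hs]

/-- `a ↦ [cyclicTerm g i a]` as a multilinear map. -/
def cyclicMulti {m : ℕ} (i : Fin (m + 1)) :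
    MultilinearMap ℂ (fun _ : Fin (m + 1) => A) (Chain A (m + 1)) :=
  (slotwise_cyclicTerm g i).multilinear

/-- The twisted Connes operator as a multilinear map: `B_g(a₀ ⊗ ⋯ ⊗ a_m) =
∑_{i=0}^{m} (-1)^{mi} 1 ⊗ a_{m-i+1} ⊗ ⋯ ⊗ a_m ⊗ a₀ ⊗ g(a₁) ⊗ ⋯ ⊗ g(a_{m-i})`. -/
def connesMulti (m : ℕ) : MultilinearMap ℂ (fun _ : Fin (m + 1) => A) (Chain A (m + 1)) :=
  ∑ i : Fin (m + 1), ((-1 : ℂ) ^ (m * i)) • cyclicMulti g i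

theorem connesMulti_degenerate (g1 : g 1 = 1) (m : ℕ) (a : Fin (m + 1) → A) (p : Fin (m + 1)) (_hp : p ≠ 0)
    (ha : a p = 1) : connesMulti g m a = 0 := by
  simp only [connesMulti, _root_.sum_apply, _root_.smul_apply]
  apply Finset.sum_eq_zero
  intro i _
  have : cyclicMulti g i a = 0 := by
    refine Chain.mk_eq_zero _ (i := (p + i).succ) (Fin.succ_ne_zero _) ?_
    simp [cyclicTerm, ha, g1]
  rw [this, smul_zero]

/-- The twisted Connes operator `B_g : C_{-m}(A) → C_{-m-1}(A)`. -/
def connesB (g1 : g 1 = 1) (m : ℕ) : Chain A m →ₗ[ℂ] Chain A (m + 1) :=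
  Chain.lift (connesMulti g m) (connesMulti_degenerate g g1 m)

variable [IsScalarTower ℂ A A] [SMulCommClass ℂ A A]

theorem slotwise_face {m : ℕ} (i : Fin (m + 1)) : Slotwise (face g (m := m) i) := by
  intro a p
  rcases lt_trichotomy p.val i.val with h | h | h
  · refine ⟨⟨p.val, by omega⟩, LinearMap.id, fun x => ?_⟩
    funext j
    simp only [face, Function.update_apply, Fin.ext_iff, Fin.lt_def, Fin.val_castSucc, Fin.val_succ,
      LinearMap.id_apply]
    split_ifs <;> first | rfl | omega
  · refine ⟨i, LinearMap.mulRight ℂ (if i = 0 then g (a i.succ) else a i.succ), fun x => ?_⟩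
    funext j
    by_cases hj : j = i
    · subst hj
      have e : p = j.castSucc := Fin.ext h
      subst e
      by_cases h0 : j = 0 <;> simp [face, h0, Fin.ext_iff]
    · have h1 : j.val ≠ i.val := fun e => hj (Fin.ext e)
      simp only [face, Function.update_apply, Fin.ext_iff, Fin.lt_def, Fin.val_castSucc,
        Fin.val_succ]
      split_ifs <;> first | rfl | omega
  · rcases eq_or_ne p.val (i.val + 1) with h2 | h2
    · refine ⟨i, (LinearMap.mulLeft ℂ (a i.castSucc)).comp (if i = 0 then g else LinearMap.id),
        fun x => ?_⟩
      funext j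
      by_cases hj : j = i
      · subst hj
        have e : p = j.succ := Fin.ext h2
        subst e
        by_cases h0 : j = 0 <;> simp [face, h0, Fin.ext_iff]
      · have h1 : j.val ≠ i.val := fun e => hj (Fin.ext e)
        simp only [face, Function.update_apply, Fin.ext_iff, Fin.lt_def, Fin.val_castSucc,
          Fin.val_succ]
        split_ifs <;> first | rfl | omega
    · refine ⟨⟨p.val - 1, by omega⟩, LinearMap.id, fun x => ?_⟩
      funext j
      simp only [face, Function.update_apply, Fin.ext_iff, Fin.lt_def, Fin.val_castSucc,
        Fin.val_succ, LinearMap.id_apply]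
      split_ifs <;> first | rfl | omega

theorem slotwise_lastFace {m : ℕ} : Slotwise (lastFace (A := A) (m := m)) := by
  intro a p
  by_cases h : p = Fin.last (m + 1)
  · subst h
    refine ⟨0, LinearMap.mulRight ℂ (a 0), fun x => ?_⟩
    funext j
    by_cases hj : j = 0
    · subst hj
      simp [lastFace, Fin.ext_iff]
    · have h1 : j.castSucc ≠ Fin.last (m + 1) := (Fin.castSucc_lt_last j).ne
      simp [lastFace, hj, h1]
  · by_cases h0 : p = 0
    · subst h0
      refine ⟨0, LinearMap.mulLeft ℂ (a (Fin.last (m + 1))), fun x => ?_⟩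
      funext j
      by_cases hj : j = 0
      · subst hj
        simp [lastFace, Fin.ext_iff]
      · have h1 : j.castSucc ≠ 0 := by simpa using hj
        simp [lastFace, hj, h1]
    · refine ⟨p.castPred h, LinearMap.id, fun x => ?_⟩
      funext j
      by_cases hj : j = 0
      · subst hj
        have h1 : (0 : Fin (m + 1)) ≠ p.castPred h := by
          intro e
          apply h0
          rw [← Fin.castSucc_castPred p h, ← e]; rfl
        simp [lastFace, Ne.symm h, Ne.symm h0, h1]
      · by_cases hp : j = p.castPred h
        · subst hp
          simp [lastFace, hj]
        · have h1 : j.castSucc ≠ p := fun e => hp (by simp [← e])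
          simp [lastFace, hj, hp, h1]

/-- `a ↦ [face g i a]` as a multilinear map. -/
def faceMulti {m : ℕ} (i : Fin (m + 1)) :
    MultilinearMap ℂ (fun _ : Fin (m + 2) => A) (Chain A m) :=
  (slotwise_face g i).multilinear

/-- `a ↦ [lastFace a]` as a multilinear map. -/
def lastFaceMulti (m : ℕ) : MultilinearMap ℂ (fun _ : Fin (m + 2) => A) (Chain A m) :=
  (slotwise_lastFace (A := A)).multilinear

/-- The twisted Hochschild differential as a multilinear map:
`b_g(a₀ ⊗ ⋯ ⊗ a_{m+1}) = a₀ g(a₁) ⊗ a₂ ⊗ ⋯ + ∑_{i=1}^{m} (-1)^i a₀ ⊗ ⋯ ⊗ a_i a_{i+1} ⊗ ⋯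
+ (-1)^{m+1} a_{m+1} a₀ ⊗ a₁ ⊗ ⋯ ⊗ a_m`. -/
def bMulti (m : ℕ) : MultilinearMap ℂ (fun _ : Fin (m + 2) => A) (Chain A m) :=
  ∑ i : Fin (m + 1), ((-1 : ℂ) ^ (i : ℕ)) • faceMulti g i
    + ((-1 : ℂ) ^ (m + 1)) • lastFaceMulti m

theorem bMulti_degenerate (g1 : g 1 = 1) (m : ℕ) (a : Fin (m + 2) → A) (p : Fin (m + 2)) (hp : p ≠ 0)
    (ha : a p = 1) : bMulti g m a = 0 := by
  obtain ⟨p, rfl⟩ := Fin.exists_succ_eq.2 hp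
  have key : ∀ i : Fin (m + 1), i ≠ p → i.val ≠ p.val + 1 →
      faceMulti g i a = 0 := by
    intro i h1 h2
    have h1' : i.val ≠ p.val := fun e => h1 (Fin.ext e)
    rcases lt_or_gt_of_ne h1' with h | h
    · refine Chain.mk_eq_zero _ (i := p) (by rintro rfl; simp at h) ?_
      have : ¬ p < i := by simpa using h.le
      simp [face, this, h1.symm, ha]
    · refine Chain.mk_eq_zero _ (i := ⟨p.val + 1, by omega⟩) (Fin.ne_of_gt (Nat.succ_pos _)) ?_
      have h3 : (⟨p.val + 1, by omega⟩ : Fin (m + 1)) < i := by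
        rw [Fin.lt_def]; simp only; omega
      simp only [face, h3, if_true]
      exact ha
  have hface : face g p a = fun j => if j ≤ p then a j.castSucc else a j.succ := by
    funext j
    rcases lt_trichotomy j p with h | h | h
    · simp [face, h, h.le]
    · subst h; by_cases h0 : j = 0
      · subst h0
        have ha' : a 1 = 1 := ha
        simp [face, ha', g1]
      · simp [face, ha, h0]
    · simp [face, h.not_gt, h.not_ge, h.ne']
  simp only [bMulti, _root_.add_apply, _root_.sum_apply, _root_.smul_apply]
  by_cases hl : p = Fin.last m
  · rw [Finset.sum_eq_single p]
    · have e : faceMulti g p a = lastFaceMulti (A := A) m a := by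
        change Chain.mk _ = Chain.mk _
        rw [hface]
        congr 1
        funext j
        have : j ≤ p := hl ▸ Fin.le_last j
        have ha' : a (Fin.last (m + 1)) = 1 := by rw [← ha, hl]; rfl
        by_cases hj : j = 0
        · subst hj; simp [lastFace, ha']
        · simp [lastFace, hj, this]
      rw [e, hl, Fin.val_last, ← add_smul, pow_succ]
      simp
    · intro i _ hi
      rw [key i hi (by rw [hl, Fin.val_last]; omega), smul_zero]
    · simp
  · have hlt : p.val < m := by
      have := p.isLt
      have : p.val ≠ m := fun e => hl (Fin.ext e)
      omega
    have hlast : lastFaceMulti (A := A) m a = 0 := by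
      refine Chain.mk_eq_zero _ (i := ⟨p.val + 1, by omega⟩) (Fin.ne_of_gt (Nat.succ_pos _)) ?_
      simp only [lastFace, Fin.ext_iff, Fin.val_zero, Nat.add_eq_zero_iff, one_ne_zero, and_false,
        if_false]
      exact ha
    obtain ⟨q, hq⟩ : ∃ q : Fin (m + 1), q.val = p.val + 1 := ⟨⟨p.val + 1, by omega⟩, rfl⟩
    have hpq : p ≠ q := fun e => by rw [← e] at hq; omega
    have hq0 : q ≠ 0 := fun e => by rw [e, Fin.val_zero] at hq; omega
    have haq : a q.castSucc = 1 := by rw [← ha]; congr 1; exact Fin.ext hq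
    rw [hlast, smul_zero, add_zero, Finset.sum_eq_add p q hpq]
    · have e : faceMulti g p a = faceMulti g q a := by
        change Chain.mk _ = Chain.mk _
        rw [hface]
        congr 1
        funext j
        simp only [face, hq0, if_false]
        rcases lt_trichotomy j q with h | h | h
        · have h1 : j ≤ p := by rw [Fin.le_def]; rw [Fin.lt_def] at h; omega
          simp [h1, h]
        · subst h
          have h1 : ¬ j ≤ p := by rw [Fin.le_def]; omega
          simp [h1, haq]
        · have h1 : ¬ j ≤ p := by rw [Fin.le_def]; rw [Fin.lt_def] at h; omega
          simp [h1, h.not_gt, h.ne']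
      rw [e, ← add_smul, hq, pow_succ]
      simp
    · intro i _ hi
      rw [key i hi.1 (fun e => hi.2 (Fin.ext (e.trans hq.symm))), smul_zero]
    · simp
    · simp

/-- The twisted Hochschild differential `b_g : C_{-m}(A) → C_{-m+1}(A)`; it vanishes for `m = 0`. -/
def hochschildB (g1 : g 1 = 1) : (m : ℕ) → Chain A m →ₗ[ℂ] Chain A (m - 1)
  | 0 => 0
  | m + 1 => Chain.lift (bMulti g m) (bMulti_degenerate g g1 m)

end Hochschild

/-! ## The local model of a twisted sector -/

/-- The labels of the linear coordinates `y¹, …, y^{2k}` (left) and `z¹, …, z^{2l}` (right). -/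
abbrev Idx (k l : ℕ) : Type := Fin (2 * k) ⊕ Fin (2 * l)

/-- A linear symplectic orbifold `V / G` of dimension `2n = 2k + 2l` with a rank `r` bundle, together
with `g ∈ G`, in linear coordinates `(y, z)` adapted to `g`: `ω₁` and `ω₂` are the matrices of the
symplectic form on `ℝ^{2k}` and `ℝ^{2l}`, `ρ` is the action of `G` on `V = ℝ^{2k} ⊕ ℝ^{2l}`, `E` is
the action of `G` on the fibre `ℂ^r`, and `V^g = ℝ^{2k}`. -/
structure TwistedSector (k l r : ℕ) (G : Type*) [Group G] where
  ω₁ : Matrix (Fin (2 * k)) (Fin (2 * k)) ℝ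
  ω₂ : Matrix (Fin (2 * l)) (Fin (2 * l)) ℝ
  ω₁_skew : ω₁ᵀ = -ω₁
  ω₂_skew : ω₂ᵀ = -ω₂
  ω₁_nondegenerate : IsUnit ω₁.det
  ω₂_nondegenerate : IsUnit ω₂.det
  ρ : G →* Matrix (Idx k l) (Idx k l) ℝ
  ρ_symplectic : ∀ h, (ρ h)ᵀ * Matrix.fromBlocks ω₁ 0 0 ω₂ * ρ h = Matrix.fromBlocks ω₁ 0 0 ω₂
  E : G →* Matrix (Fin r) (Fin r) ℂ
  g : G
  gPerp : Matrix (Fin (2 * l)) (Fin (2 * l)) ℝ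
  ρ_g : ρ g = Matrix.fromBlocks 1 0 0 gPerp
  gPerp_fixed : ∀ v, gPerp *ᵥ v = v → v = 0

namespace TwistedSector

variable {k l r : ℕ} {G : Type*} [Group G] (M : TwistedSector k l r G)

/-- The matrix `ω^{ij}` inverse to `ω`, `y`-block. -/
def P₁ : Matrix (Fin (2 * k)) (Fin (2 * k)) ℂ := (M.ω₁⁻¹).map (algebraMap ℝ ℂ)

/-- The matrix `ω^{ij}` inverse to `ω`, `z`-block. -/
def P₂ : Matrix (Fin (2 * l)) (Fin (2 * l)) ℂ := (M.ω₂⁻¹).map (algebraMap ℝ ℂ)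

/-- The Poisson tensor `ω^{ij}` on `ℝ^{2k} ⊕ ℝ^{2l}`. -/
def P : Matrix (Idx k l) (Idx k l) ℂ := Matrix.fromBlocks M.P₁ 0 0 M.P₂

/-- The matrix of `h` on linear coordinates: `G` acts on functions by `(h f)(v) = f(h⁻¹ v)`, so
`h xⁱ = ∑_j (coordMat h)_{ij} x^j`. -/
def coordMat (h : G) : Matrix (Idx k l) (Idx k l) ℂ := (M.ρ h⁻¹).map (algebraMap ℝ ℂ)

/-- The matrix of `g` on the coordinates `z`. -/
def gz : Matrix (Fin (2 * l)) (Fin (2 * l)) ℂ := (M.coordMat M.g).toBlocks₂₂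

/-! ### The algebra `gl_r(𝒲_{2n})` and its twisted chains -/

/-- `gl_r(𝒲_{2n})`. -/
abbrev gl : Type := Matrix (Fin r) (Fin r) (Weyl M.P)

/-- The action of `h` on `𝒲_{2n}`. -/
def actWeyl (h : G) : Weyl M.P →ₗ[ℂ] Weyl M.P :=
  (mapCoeff (linSubst (M.coordMat h)).toLinearMap : Laur (Idx k l) →ₗ[ℂ] Laur (Idx k l))

/-- The action of `h` on `gl_r(𝒲_{2n})`, `N ↦ E(h) h(N) E(h)⁻¹`. -/
def actGl (h : G) : M.gl →ₗ[ℂ] M.gl where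
  toFun N := Matrix.of fun i j =>
    ∑ a, ∑ b, (M.E h i a * M.E h⁻¹ b j) • M.actWeyl h (N a b)
  map_add' N N' := by
    ext1 i j
    simp [Finset.sum_add_distrib]
  map_smul' c N := by
    ext1 i j
    simp only [Matrix.smul_apply, map_smul, Matrix.of_apply, RingHom.id_apply, Finset.smul_sum]
    simp only [smul_comm c]

theorem actWeyl_one (h : G) : M.actWeyl h 1 = 1 := by
  change mapCoeff (linSubst (M.coordMat h)).toLinearMap (1 : Laur (Idx k l)) = (1 : Laur (Idx k l))
  ext1; funext n
  rw [coeff_mapCoeff, HahnSeries.coeff_one]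
  split_ifs <;> simp

theorem actGl_one (h : G) : M.actGl h 1 = 1 := by
  ext1 i j
  have e : ∑ a, M.E h i a * M.E h⁻¹ a j = (1 : Matrix (Fin r) (Fin r) ℂ) i j := by
    rw [← Matrix.mul_apply, ← map_mul, mul_inv_cancel, map_one]
  have e2 : ∀ a b : Fin r, (M.E h i a * M.E h⁻¹ b j) • M.actWeyl h ((1 : M.gl) a b) =
      if a = b then (M.E h i a * M.E h⁻¹ b j) • (1 : Weyl M.P) else 0 := by
    intro a b
    rw [Matrix.one_apply]
    split_ifs
    · rw [actWeyl_one]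
    · rw [map_zero, smul_zero]
  simp only [actGl, LinearMap.coe_mk, AddHom.coe_mk, Matrix.of_apply, e2, Finset.sum_ite_eq,
    Finset.mem_univ, if_true]
  rw [← Finset.sum_smul, e, Matrix.one_apply, Matrix.one_apply]
  split_ifs <;> simp

/-- The twisted Hochschild differential `b_g` on `C_{-m}(gl_r(𝒲_{2n}))`. -/
def b (m : ℕ) : Chain M.gl m →ₗ[ℂ] Chain M.gl (m - 1) :=
  hochschildB (M.actGl M.g) (M.actGl_one M.g) m

/-- The twisted Connes operator `B_g` on `C_{-m}(gl_r(𝒲_{2n}))`. -/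
def B (m : ℕ) : Chain M.gl m →ₗ[ℂ] Chain M.gl (m + 1) :=
  connesB (M.actGl M.g) (M.actGl_one M.g) m

/-- The chains invariant under the centralizer `C(g)`. -/
def invariantChains (m : ℕ) : Set (Chain M.gl m) :=
  {O | ∀ h ∈ Subgroup.centralizer {M.g}, Chain.act (M.actGl h) (M.actGl_one h) m O = O}

/-! ### Formal differential forms on the fixed locus -/

/-- `ℂ[[yⁱ, dyⁱ]]((ħ))`; the basis vector `eᵢ` of `ℂ^{2k}` stands for `dyⁱ`. -/
abbrev Forms (k : ℕ) : Type :=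
  Laur (Fin (2 * k)) ⊗[ℂ] ExteriorAlgebra ℂ (Fin (2 * k) → ℂ)

/-- The `1`-form `dyⁱ`. -/
def dy (i : Fin (2 * k)) : ExteriorAlgebra ℂ (Fin (2 * k) → ℂ) :=
  ExteriorAlgebra.ι ℂ (Pi.single i 1)

/-- The forms of degree `m`. -/
def formsOfDegree (k m : ℕ) : Submodule ℂ (Forms k) :=
  LinearMap.range (TensorProduct.map (LinearMap.id : Laur (Fin (2 * k)) →ₗ[ℂ] Laur (Fin (2 * k)))
    (⋀[ℂ]^m (Fin (2 * k) → ℂ)).subtype)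

/-- Multiplication by `ħ` on `ℂ[[y]]((ħ))`. -/
def hbarMulLaur (k : ℕ) : Laur (Fin (2 * k)) →ₗ[ℂ] Laur (Fin (2 * k)) where
  toFun F := hbar (Fin (2 * k)) * F
  map_add' F F' := mul_add _ F F'
  map_smul' c F := by
    ext1; funext n
    obtain ⟨n, rfl⟩ : ∃ n', n = n' + 1 := ⟨n - 1, by ring⟩
    simp [hbar, HahnSeries.coeff_single_mul_add]

/-- Multiplication by `ħ` on forms. -/
def hbarMul (k : ℕ) : Forms k →ₗ[ℂ] Forms k :=
  TensorProduct.map (hbarMulLaur k) LinearMap.id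

/-- The de Rham differential `d = dyⁱ ∂_{yⁱ}`. -/
def deRham (k : ℕ) : Forms k →ₗ[ℂ] Forms k :=
  ∑ i, TensorProduct.map (mapCoeff (pd i)) (LinearMap.mulLeft ℂ (dy i))

/-- The BV operator `Δ = ω^{ij} ℒ_{∂_{yⁱ}} ι_{∂_{y^j}}`. -/
def bvLaplacian : Forms k →ₗ[ℂ] Forms k :=
  ∑ i, ∑ j, M.P₁ i j • TensorProduct.map (mapCoeff (pd i))
    (CliffordAlgebra.contractLeft (Q := (0 : QuadraticForm ℂ (Fin (2 * k) → ℂ)))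
      (LinearMap.proj j : (Fin (2 * k) → ℂ) →ₗ[ℂ] ℂ))

/-- The action of `h ∈ C(g)` on forms on the fixed locus: `yⁱ ↦ h yⁱ` and `dyⁱ ↦ d(h yⁱ)`. -/
def actForms (h : G) : Forms k →ₗ[ℂ] Forms k :=
  TensorProduct.map (mapCoeff (linSubst (M.coordMat h).toBlocks₁₁).toLinearMap)
    (ExteriorAlgebra.map (Matrix.toLin' ((M.coordMat h).toBlocks₁₁)ᵀ)).toLinearMap

/-- The forms invariant under the centralizer `C(g)`. -/
def invariantForms : Set (Forms k) :=
  {a | ∀ h ∈ Subgroup.centralizer {M.g}, M.actForms h a = a}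

/-! ### Propagators -/

/-- The constant propagator `-(1 ⊗ (1 - g⁻¹)⁻¹) Π₂` in the directions `z`. -/
def P₁₂ : Matrix (Fin (2 * l)) (Fin (2 * l)) ℂ := -(M.P₂ * ((1 - M.gz⁻¹)⁻¹)ᵀ)

/-- The propagator `(s - ½) Π₁ - (1 ⊗ (1 - g⁻¹)⁻¹) Π₂` of a line from `x` to `y`,
where `0 < s = x - y < 1`. -/
def lineProp (s : ℝ) : Matrix (Idx k l) (Idx k l) ℂ :=
  Matrix.fromBlocks (((s : ℂ) - 1 / 2) • M.P₁) 0 0 M.P₁₂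

/-- The propagator `-(1 ⊗ g⁻¹ (1 - g⁻¹)⁻¹) Π₂ - ½ Π₂` of a self loop. -/
def loopProp : Matrix (Idx k l) (Idx k l) ℂ :=
  Matrix.fromBlocks 0 0 0 (-(M.P₂ * (M.gz⁻¹ * (1 - M.gz⁻¹)⁻¹)ᵀ) - (1 / 2 : ℂ) • M.P₂)

/-- On the circle cut at the `g`-twist, which sits between the points `0` and `1`, the points occur
in the order `1, 2, …, m, 0`; `isAfter α β` says that `α` comes after `β`. -/
def isAfter {m : ℕ} (α β : Fin (m + 1)) : Prop := β ≠ 0 ∧ (α = 0 ∨ β < α)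

/-- The compactified configuration space `S¹_cyc[m+1]` of `m + 1` cyclically ordered points
`θ₀, …, θ_m`, in real coordinates with `0 ≤ θ₀ ≤ 1` and
`θ₀ - 1 ≤ θ₁ ≤ θ₂ ≤ ⋯ ≤ θ_m ≤ θ₀`. -/
def cyc (m : ℕ) : Set (Fin (m + 1) → ℝ) :=
  {θ | θ 0 ∈ Set.Icc 0 1 ∧ (∀ α : Fin m, θ α.succ ∈ Set.Icc (θ 0 - 1) (θ 0)) ∧
    Monotone fun α : Fin m => θ α.succ}

open Classical in
/-- The propagator of the line from the point `α` to the point `β`; it is symmetric under the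
simultaneous exchange of the points and of the tensor factors. -/
def prop₁ {m : ℕ} (θ : Fin (m + 1) → ℝ) (α β : Fin (m + 1)) : Matrix (Idx k l) (Idx k l) ℂ :=
  if isAfter α β then M.lineProp (θ α - θ β) else (M.lineProp (θ β - θ α))ᵀ

/-- The operator `∂_{P₁} = ½ ∑_{α ≠ β} P₁(θ_α, θ_β)^{ij} ∂_i^{(α)} ∂_j^{(β)}`. -/
def lineOp {m : ℕ} (θ : Fin (m + 1) → ℝ) :
    PS (Fin (m + 1) × Idx k l) →ₗ[ℂ] PS (Fin (m + 1) × Idx k l) :=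
  (1 / 2 : ℂ) • ∑ α, ∑ β, if α = β then 0 else
    ∑ i, ∑ j, M.prop₁ θ α β i j • (pd (α, i) ∘ₗ pd (β, j))

/-- The operator `∂_{P₂} = ½ ∑_α P₂^{ij} ∂_i^{(α)} ∂_j^{(α)}`. -/
def loopOp (m : ℕ) : PS (Fin (m + 1) × Idx k l) →ₗ[ℂ] PS (Fin (m + 1) × Idx k l) :=
  (1 / 2 : ℂ) • ∑ α, ∑ i, ∑ j, M.loopProp i j • (pd (α, i) ∘ₗ pd (α, j))

theorem continuous_prop₁ {m : ℕ} (α β : Fin (m + 1)) (i j : Idx k l) :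
    Continuous fun θ : Fin (m + 1) → ℝ => M.prop₁ θ α β i j := by
  have h : ∀ (i j : Idx k l) (α β : Fin (m + 1)),
      Continuous fun θ : Fin (m + 1) → ℝ => M.lineProp (θ α - θ β) i j := by
    intro i j α β
    rcases i with i | i <;> rcases j with j | j <;>
      simp only [lineProp, Matrix.fromBlocks_apply₁₁, Matrix.fromBlocks_apply₁₂,
        Matrix.fromBlocks_apply₂₁, Matrix.fromBlocks_apply₂₂, Matrix.smul_apply] <;> fun_prop
  unfold prop₁
  split_ifs
  · exact h i j α β
  · exact h j i β α

theorem continuous_coeff_lineOp_pow {m : ℕ} (n : ℕ) (F : PS (Fin (m + 1) × Idx k l))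
    (μ : Fin (m + 1) × Idx k l →₀ ℕ) :
    Continuous fun θ : Fin (m + 1) → ℝ => MvPowerSeries.coeff μ ((M.lineOp θ ^ n) F) := by
  induction n generalizing μ with
  | zero => exact continuous_const
  | succ n ih =>
    have e : ∀ θ : Fin (m + 1) → ℝ, MvPowerSeries.coeff μ ((M.lineOp θ ^ (n + 1)) F) =
        (1 / 2 : ℂ) * ∑ α, ∑ β, if α = β then 0 else ∑ i, ∑ j, M.prop₁ θ α β i j *
          MvPowerSeries.coeff μ (pd (α, i) (pd (β, j) ((M.lineOp θ ^ n) F))) := by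
      intro θ
      rw [pow_succ', Module.End.mul_apply]
      generalize (M.lineOp θ ^ n) F = H
      rw [lineOp, LinearMap.smul_apply, map_smul, smul_eq_mul]
      congr 1
      rw [LinearMap.sum_apply, map_sum]
      refine Finset.sum_congr rfl fun α _ => ?_
      rw [LinearMap.sum_apply, map_sum]
      refine Finset.sum_congr rfl fun β _ => ?_
      split_ifs
      · simp
      · simp
    simp only [e, coeff_pd]
    refine continuous_const.mul (continuous_finsetSum _ fun α _ =>
      continuous_finsetSum _ fun β _ => ?_)
    split_ifs
    · exact continuous_const
    · exact continuous_finsetSum _ fun i _ => continuous_finsetSum _ fun j _ =>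
        (M.continuous_prop₁ α β i j).mul (((ih _).mul continuous_const).mul continuous_const)

theorem isCompact_cyc (m : ℕ) : IsCompact (cyc m) := by
  have hc : IsClosed (cyc m) := by
    have e : cyc m = {θ | 0 ≤ θ 0} ∩ {θ | θ 0 ≤ 1} ∩
        (⋂ α : Fin m, {θ | θ 0 - 1 ≤ θ α.succ} ∩ {θ | θ α.succ ≤ θ 0}) ∩
        ⋂ α : Fin m, ⋂ β : Fin m, ⋂ _ : α ≤ β, {θ | θ α.succ ≤ θ β.succ} := by
      ext θ
      simp [cyc, Monotone, and_assoc]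
    rw [e]
    refine ((((isClosed_le ?_ ?_).inter (isClosed_le ?_ ?_)).inter (isClosed_iInter fun α =>
      (isClosed_le ?_ ?_).inter (isClosed_le ?_ ?_))).inter (isClosed_iInter fun α =>
      isClosed_iInter fun β => isClosed_iInter fun _ => isClosed_le ?_ ?_)) <;> fun_prop
  refine (isCompact_Icc (a := fun _ : Fin (m + 1) => (-1 : ℝ)) (b := fun _ => 1)).of_isClosed_subset
    hc fun θ hθ => ?_
  obtain ⟨h0, h1, -⟩ := hθ
  constructor <;> intro α <;> refine Fin.cases ?_ (fun β => ?_) α <;>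
    simp only [Set.mem_Icc] at h0 h1
  · linarith
  · linarith [h1 β]
  · linarith
  · linarith [h1 β]

/-- The operator `∫_{S¹_cyc[m+1]} dθ₀ ⋯ dθ_m ∂_{P₁}ⁿ / n!`, coefficient by coefficient. -/
def intLineOp (m n : ℕ) : PS (Fin (m + 1) × Idx k l) →ₗ[ℂ] PS (Fin (m + 1) × Idx k l) where
  toFun F := fun μ => ∫ θ in cyc m,
    (n.factorial : ℂ)⁻¹ * MvPowerSeries.coeff μ ((M.lineOp θ ^ n) F)
  map_add' F F' := by
    funext μ
    have hi : ∀ F, MeasureTheory.IntegrableOn (fun θ : Fin (m + 1) → ℝ =>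
        (n.factorial : ℂ)⁻¹ * MvPowerSeries.coeff μ ((M.lineOp θ ^ n) F)) (cyc m) := fun F =>
      (continuous_const.mul (M.continuous_coeff_lineOp_pow n F μ)).continuousOn.integrableOn_compact
        (isCompact_cyc m)
    simp only [map_add, mul_add]
    exact MeasureTheory.integral_add (hi F) (hi F')
  map_smul' c F := by
    funext μ
    simp only [map_smul, smul_eq_mul, mul_left_comm _ c]
    exact MeasureTheory.integral_const_mul c _

/-! ### The free correlation map -/

/-- The twisted trace `tr_g(N₀ ⊗ N₁ ⊗ ⋯ ⊗ N_m) = tr(N₀ g N₁ ⋯ N_m)` of complex matrices. -/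
def trg {m : ℕ} (N : Fin (m + 1) → Matrix (Fin r) (Fin r) ℂ) : ℂ :=
  (N 0 * M.E M.g * (List.ofFn fun α : Fin m => N α.succ).prod).trace

/-- The symbol map `σ_z`, which sets `z` to `0`. -/
def symbolZ : PS (Idx k l) →ₐ[ℂ] PS (Fin (2 * k)) :=
  MvPowerSeries.killCompl Function.Embedding.inl

/-- The scalar part of the correlation map: `a₀ ⊗ ⋯ ⊗ a_m ↦ det(1 - g⁻¹)⁻¹
σ_z (mult (∫_{S¹_cyc[m+1]} dθ₀ ⋯ dθ_m e^{ħ∂_{P₁}} e^{ħ∂_{P₂}} (a₀ ⊗ ⋯ ⊗ a_m)))`. -/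
def kernel (m : ℕ) :
    MultilinearMap ℂ (fun _ : Fin (m + 1) => Laur (Idx k l)) (Laur (Fin (2 * k))) :=
  ((1 - M.gz⁻¹).det)⁻¹ •
    (mapCoeff symbolZ.toLinearMap ∘ₗ mapCoeff (multMap (m + 1) (Idx k l)).toLinearMap ∘ₗ
      hbarSeries (M.intLineOp m) ∘ₗ hbarExp (M.loopOp m)).compMultilinearMap
        (extProd (m + 1) (Idx k l))

/-- The matrix entry `N ↦ N p q`. -/
def entry (p q : Fin r) : M.gl →ₗ[ℂ] Laur (Idx k l) where
  toFun N := N p q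
  map_add' _ _ := rfl
  map_smul' _ _ := rfl

/-- The component along `dy^{I₁} ∧ ⋯ ∧ dy^{I_m}` and along the elementary matrices `E_{p_α q_α}` of
`O₀ ⊗ dO₁ ⊗ ⋯ ⊗ dO_m`: its factors are `(O₀)_{p₀ q₀}` and `∂_{y^{I_α}} (O_α)_{p_α q_α}`. -/
def slot {m : ℕ} (p q : Fin (m + 1) → Fin r) (I : Fin m → Fin (2 * k)) :
    Fin (m + 1) → M.gl →ₗ[ℂ] Laur (Idx k l) :=
  Fin.cons (M.entry (p 0) (q 0)) fun α : Fin m =>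
    mapCoeff (pd (Sum.inl (I α))) ∘ₗ M.entry (p α.succ) (q α.succ)

/-- The free correlation map `⟨O₀ ⊗ ⋯ ⊗ O_m⟩ = det(1 - g⁻¹)⁻¹ σ_z (tr_g ∫_{S¹_cyc[m+1]}
dθ₀ ⋯ dθ_m e^{ħ∂_{P₁}} e^{ħ∂_{P₂}} (O₀ ⊗ dO₁ ⊗ ⋯ ⊗ dO_m))`, as a multilinear map. -/
def corrMulti (m : ℕ) : MultilinearMap ℂ (fun _ : Fin (m + 1) => M.gl) (Forms k) :=
  ∑ p : Fin (m + 1) → Fin r, ∑ q : Fin (m + 1) → Fin r, ∑ I : Fin m → Fin (2 * k),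
    M.trg (fun α => Matrix.single (p α) (q α) 1) •
      ((TensorProduct.mk ℂ _ _).flip (List.ofFn fun α => dy (I α)).prod).compMultilinearMap
        ((M.kernel m).compLinearMap (M.slot p q I))

theorem pd_entry_one (i : Idx k l) (p q : Fin r) : mapCoeff (pd i) (M.entry p q 1) = 0 := by
  have e : M.entry p q 1 = if p = q then (1 : Laur (Idx k l)) else 0 := by
    change (1 : M.gl) p q = _
    rw [Matrix.one_apply]
    rfl
  rw [e]
  split_ifs
  · ext1; funext n
    rw [coeff_mapCoeff, HahnSeries.coeff_one]
    split_ifs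
    · exact MvPowerSeries.pderiv_one
    · exact map_zero _
  · exact map_zero _

theorem corrMulti_degenerate (m : ℕ) (O : Fin (m + 1) → M.gl) (i : Fin (m + 1)) (hi : i ≠ 0)
    (hO : O i = 1) : M.corrMulti m O = 0 := by
  obtain ⟨α, rfl⟩ := Fin.exists_succ_eq.2 hi
  simp only [corrMulti, _root_.sum_apply, _root_.smul_apply]
  refine Finset.sum_eq_zero fun p _ => Finset.sum_eq_zero fun q _ => Finset.sum_eq_zero fun I _ => ?_
  have e : ((M.kernel m).compLinearMap (M.slot p q I)) O = 0 := by
    rw [MultilinearMap.compLinearMap_apply]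
    refine MultilinearMap.map_coord_zero _ α.succ ?_
    rw [hO]
    exact M.pd_entry_one _ _ _
  rw [LinearMap.compMultilinearMap_apply, e, map_zero, smul_zero]

/-- The `g`-twisted free correlation map on `C_{-m}(gl_r(𝒲_{2n}))`. -/
def corr (m : ℕ) : Chain M.gl m →ₗ[ℂ] Forms k :=
  Chain.lift (N := Forms k) (M.corrMulti m) (M.corrMulti_degenerate m)

end TwistedSector

end OrbifoldHKR

/-! A power series is determined by the values at 0 of its images under all constant coefficient
differential operators. Hence each operator in the correlation map can be replaced by its transpose
on symbols: a partial derivative becomes multiplication by a variable, a linear substitution becomes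
an algebra map of polynomials, and `e^{ħD}` becomes multiplication by `e^{ħQ}`. After this
transposition (`lpair_kernel`, `lpair_coeffForm`) a coefficient of the correlation map is the
constant `det(1 - g⁻¹)⁻¹` times the integral over configurations θ of the pairing of `O₀ ⊗ ⋯ ⊗ O_m`
with `e^{ħQ_θ}` times a fixed polynomial. Exponents add, so statements about propagators become
identities between quadratic polynomials.

Write `X_α` for the vector of symbols of the factor α and `X` for the sum of all of them. The lines
and self loops together give (`lineSym_add_loopSym`) `Q_θ = ∑ θ_α Π₁(X_α, X) + ½ S(X, X) - ¼ ∑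
ε_{αβ} Π(X_α, X_β)`, where `S` is the symmetric self-loop bivector and ε is the sign of the order of
the points on the circle cut at the twist. Two facts about this form carry the proof. (1)
Identifying two neighbouring labels erases the sign between them, and the Moyal exponent `½ Π(X_u,
X_v)` restores exactly this sign (`quad_fiber`, `quad_add_single`, `lpair_extProd_merge`). (2)
Letting g act on some factors amounts to moving their points back by a full turn across the cut
(`quad_wrap`, `lpair_extProd_twistOn`); this rests on the matrix identity `gS = S + ½ gΠ + ½ Π - Π₁`
of `coordMat_g_loopProp`.

For the first identity, `∂Q_θ/∂θ_a = Π₁(X_a, X)` is, up to sign, the contraction of the form index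
of the slot a with a derivative of the whole product. So ħΔ integrates a θ-derivative, and only
boundary terms remain, where two cyclically consecutive points collide (`setIntegral_cyc_deriv`,
`lpair_contract`). By (1) a collision produces a Moyal product; at the collision of 0 and 1, (2)
produces the g in `a₀ g(a₁)`. The Leibniz rule splits an inner face of `b_g` into two boundary
terms, and the alternating sums agree (`sum_faces`).

For the second identity, d differentiates each factor in turn. Differentiating a factor that already
carries a form index gives a symmetric second derivative, which dies against the wedge product; what
survives has every factor differentiated once. In `B_g(O)` the inserted unit takes part in no
propagator and its point integrates to 1. By (2) each cyclic term has the same integrand over one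
piece of the configuration space, and the pieces tile it (`sum_setIntegral_unrotate`,
`sum_coeffForm_cyclicTerm`).

Matrix coefficients separate from the Weyl algebra on elementary tensors (`corr_mk_elem`), where the
twisted trace is insensitive to all faces and cyclic terms. Equivariance holds because an element of
the centralizer preserves the splitting into y and z and all three bivectors in `Q_θ`. -/

namespace OrbifoldHKR

/-! ## The pairing of power series with constant coefficient differential operators -/

section Pairing

variable {σ τ : Type}

/-- The product of the factorials of the exponents. -/
def multiFactorial [Fintype σ] (ν : σ →₀ ℕ) : ℂ := ∏ s, ((ν s).factorial : ℂ)

theorem multiFactorial_ne_zero [Fintype σ] (ν : σ →₀ ℕ) : multiFactorial ν ≠ 0 :=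
  Finset.prod_ne_zero_iff.2 fun _ _ => Nat.cast_ne_zero.2 (Nat.factorial_ne_zero _)

theorem multiFactorial_add_single [Fintype σ] (ν : σ →₀ ℕ) (s : σ) :
    multiFactorial (ν + Finsupp.single s 1) = (ν s + 1) * multiFactorial ν := by
  classical
  unfold multiFactorial
  rw [Fintype.prod_eq_mul_prod_compl s, Fintype.prod_eq_mul_prod_compl s, ← mul_assoc]
  congr 1
  · simp [Nat.factorial_succ]
  · refine Finset.prod_congr rfl fun t ht => ?_
    have h : s ≠ t := fun e => by simp [e] at ht
    simp [h]

/-- The value at `0` of `P(∂) F`, as a linear functional of the symbol `P`. -/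
def pair [Fintype σ] (F : PS σ) : MvPolynomial σ ℂ →ₗ[ℂ] ℂ :=
  (MvPolynomial.basisMonomials σ ℂ).constr ℂ fun ν => multiFactorial ν * MvPowerSeries.coeff ν F

theorem pair_monomial [Fintype σ] (F : PS σ) (ν : σ →₀ ℕ) :
    pair F (MvPolynomial.monomial ν 1) = multiFactorial ν * MvPowerSeries.coeff ν F := by
  have e : MvPolynomial.monomial ν (1 : ℂ) = MvPolynomial.basisMonomials σ ℂ ν := by
    rw [MvPolynomial.coe_basisMonomials]
  rw [pair, e, Module.Basis.constr_basis]

theorem pair_ext_monomial [Fintype σ] {φ ψ : MvPolynomial σ ℂ →ₗ[ℂ] ℂ}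
    (h : ∀ ν, φ (MvPolynomial.monomial ν 1) = ψ (MvPolynomial.monomial ν 1)) : φ = ψ :=
  (MvPolynomial.basisMonomials σ ℂ).ext fun ν => by simpa using h ν

theorem pair_add [Fintype σ] (F G : PS σ) : pair (F + G) = pair F + pair G :=
  pair_ext_monomial fun ν => by simp [pair_monomial, mul_add]

theorem pair_smul [Fintype σ] (c : ℂ) (F : PS σ) : pair (c • F) = c • pair F :=
  pair_ext_monomial fun ν => by simp [pair_monomial, mul_left_comm]

theorem pair_zero [Fintype σ] : pair (0 : PS σ) = 0 :=
  pair_ext_monomial fun ν => by simp [pair_monomial]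

/-- `pair` as a bilinear map. -/
def pairHom [Fintype σ] : PS σ →ₗ[ℂ] MvPolynomial σ ℂ →ₗ[ℂ] ℂ where
  toFun := pair
  map_add' := pair_add
  map_smul' := pair_smul

theorem pairHom_apply [Fintype σ] (F : PS σ) : pairHom F = pair F := rfl

/-- Monomials recover the coefficients up to nonzero factorials. This is what allows identities of
series to be checked on symbols. -/
theorem pair_injective [Fintype σ] {F G : PS σ} (h : ∀ P, pair F P = pair G P) : F = G := by
  ext ν
  have := h (MvPolynomial.monomial ν 1)
  rw [pair_monomial, pair_monomial] at this
  exact mul_left_cancel₀ (multiFactorial_ne_zero ν) this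

theorem pair_one [Fintype σ] (F : PS σ) : pair F 1 = MvPowerSeries.constantCoeff F := by
  have := pair_monomial F 0
  simpa [multiFactorial] using this

/-- The factor produced by differentiating a monomial is the ratio of the two products of
factorials; the factorials in `pair` are there for this reason. -/
theorem pair_pd [Fintype σ] (s : σ) (F : PS σ) (P : MvPolynomial σ ℂ) :
    pair (pd s F) P = pair F (MvPolynomial.X s * P) := by
  suffices h : pair (pd s F) = pair F ∘ₗ LinearMap.mulLeft ℂ (MvPolynomial.X s) by
    rw [h]; rfl
  refine pair_ext_monomial fun ν => ?_
  rw [pair_monomial, coeff_pd, LinearMap.comp_apply, LinearMap.mulLeft_apply, MvPolynomial.X,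
    MvPolynomial.monomial_mul, add_comm _ ν, one_mul, pair_monomial, multiFactorial_add_single]
  ring

/-- `Q` is the symbol of the operator `D`. -/
def HasSymbol [Fintype σ] (D : PS σ →ₗ[ℂ] PS σ) (Q : MvPolynomial σ ℂ) : Prop :=
  ∀ F P, pair (D F) P = pair F (Q * P)

theorem hasSymbol_pd [Fintype σ] (s : σ) : HasSymbol (pd s) (MvPolynomial.X s) := pair_pd s

theorem HasSymbol.comp [Fintype σ] {D D' : PS σ →ₗ[ℂ] PS σ} {Q Q' : MvPolynomial σ ℂ}
    (h : HasSymbol D Q) (h' : HasSymbol D' Q') : HasSymbol (D ∘ₗ D') (Q * Q') := fun F P => by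
  rw [LinearMap.comp_apply, h, h', ← mul_assoc, mul_comm Q']

theorem HasSymbol.smul [Fintype σ] (c : ℂ) {D : PS σ →ₗ[ℂ] PS σ} {Q : MvPolynomial σ ℂ}
    (h : HasSymbol D Q) : HasSymbol (c • D) (c • Q) := fun F P => by
  rw [LinearMap.smul_apply, pair_smul, LinearMap.smul_apply, h, smul_mul_assoc, map_smul]

theorem HasSymbol.zero [Fintype σ] : HasSymbol (0 : PS σ →ₗ[ℂ] PS σ) 0 := fun F P => by
  simp [pair_zero]

theorem HasSymbol.sum [Fintype σ] {ι : Type*} (s : Finset ι) {D : ι → PS σ →ₗ[ℂ] PS σ}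
    {Q : ι → MvPolynomial σ ℂ} (h : ∀ i ∈ s, HasSymbol (D i) (Q i)) :
    HasSymbol (∑ i ∈ s, D i) (∑ i ∈ s, Q i) := fun F P => by
  rw [LinearMap.sum_apply, ← pairHom_apply, map_sum, LinearMap.sum_apply, Finset.sum_mul, map_sum]
  exact Finset.sum_congr rfl fun i hi => h i hi F P

theorem HasSymbol.pow [Fintype σ] {D : PS σ →ₗ[ℂ] PS σ} {Q : MvPolynomial σ ℂ}
    (h : HasSymbol D Q) (n : ℕ) : HasSymbol (D ^ n) (Q ^ n) := by
  induction n with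
  | zero => intro F P; simp
  | succ n ih =>
    rw [pow_succ', pow_succ']
    exact h.comp ih

/-- The algebra map `A` is the transpose of `L` under the pairing. -/
def HasTranspose [Fintype σ] [Fintype τ] (L : PS σ →ₗ[ℂ] PS τ)
    (A : MvPolynomial τ ℂ →ₐ[ℂ] MvPolynomial σ ℂ) : Prop :=
  ∀ F P, pair (L F) P = pair F (A P)

/-- Induction on the symbol: constants test only the constant term, and each further variable moves
one derivative through `L` by the chain rule. -/
theorem hasTranspose_of_chainRule [Fintype σ] [Fintype τ] (L : PS σ →ₗ[ℂ] PS τ)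
    (A : MvPolynomial τ ℂ →ₐ[ℂ] MvPolynomial σ ℂ)
    (h0 : ∀ F, MvPowerSeries.constantCoeff (L F) = MvPowerSeries.constantCoeff F)
    (h : ∀ t F P, ∃ D, HasSymbol D (A (MvPolynomial.X t)) ∧ pair (pd t (L F)) P = pair (L (D F)) P) :
    HasTranspose L A := by
  intro F P
  induction P using MvPolynomial.induction_on generalizing F with
  | C c =>
    have e : (MvPolynomial.C c : MvPolynomial τ ℂ) = c • 1 := by simp [MvPolynomial.smul_eq_C_mul]
    rw [e, map_smul, map_smul, map_smul, map_one A, pair_one, pair_one, h0]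
  | add P Q hP hQ => rw [map_add, map_add, map_add, hP, hQ]
  | mul_X P t hP =>
    obtain ⟨D, hD, e⟩ := h t F P
    rw [mul_comm, ← pair_pd, e, hP, hD, map_mul A]

/-- An operator with a transpose is determined by it, and an algebra map of polynomials is
determined on variables. Equality of two substitutions of power series thus becomes a check on
generators. -/
theorem HasTranspose.eq_of [Fintype σ] [Fintype τ] {L L' : PS σ →ₗ[ℂ] PS τ}
    {A A' : MvPolynomial τ ℂ →ₐ[ℂ] MvPolynomial σ ℂ} (h : HasTranspose L A)
    (h' : HasTranspose L' A') (e : ∀ t, A (MvPolynomial.X t) = A' (MvPolynomial.X t)) : L = L' := by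
  have : A = A' := MvPolynomial.algHom_ext e
  subst this
  exact LinearMap.ext fun F => pair_injective fun P => (h F P).trans (h' F P).symm

theorem HasTranspose.comp {υ : Type} [Fintype σ] [Fintype τ] [Fintype υ] {L : PS σ →ₗ[ℂ] PS τ}
    {L' : PS τ →ₗ[ℂ] PS υ} {A : MvPolynomial τ ℂ →ₐ[ℂ] MvPolynomial σ ℂ}
    {A' : MvPolynomial υ ℂ →ₐ[ℂ] MvPolynomial τ ℂ} (h' : HasTranspose L' A')
    (h : HasTranspose L A) : HasTranspose (L' ∘ₗ L) (A.comp A') := fun F P => by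
  rw [LinearMap.comp_apply, h', h, AlgHom.comp_apply]

/-! ### Linear substitutions -/

section LinearSubstitution

variable [Fintype σ] [Fintype τ] (A : Matrix σ τ ℂ)

/-- The linear forms `∑_t A s t x_t`. -/
def linForms (s : σ) : PS τ := ∑ t, A s t • (MvPowerSeries.X t : PS τ)

theorem hasSubst_linForms : MvPowerSeries.HasSubst (linForms A) :=
  MvPowerSeries.hasSubst_of_constantCoeff_zero fun s => by simp [linForms]

theorem pd_linForms (s : σ) (t : τ) : pd t (linForms A s) = MvPowerSeries.C (A s t) := by
  classical
  simp only [linForms, map_sum, map_smul]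
  rw [Finset.sum_eq_single t]
  · simp [pd, MvPowerSeries.smul_eq_C_mul]
  · intro t' _ h
    simp [pd, MvPowerSeries.pderiv_X_of_ne h]
  · simp

theorem pd_subst_linForms_coe (t : τ) (P : MvPolynomial σ ℂ) :
    pd t (MvPowerSeries.substAlgHom (hasSubst_linForms A) (P : PS σ)) =
      ∑ s, A s t • MvPowerSeries.substAlgHom (hasSubst_linForms A) (pd s (P : PS σ)) := by
  classical
  induction P using MvPolynomial.induction_on with
  | C c =>
    have h0 : ∀ s, pd s (MvPowerSeries.C c : PS σ) = 0 := fun s => MvPowerSeries.pderiv_C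
    have h1 : pd t (MvPowerSeries.C c : PS τ) = 0 := MvPowerSeries.pderiv_C
    simp only [MvPolynomial.coe_C, h0, map_zero, smul_zero, Finset.sum_const_zero,
      MvPowerSeries.substAlgHom_apply, MvPowerSeries.subst_C, h1]
  | add P Q hP hQ =>
    simp only [MvPolynomial.coe_add, map_add, hP, hQ, smul_add, Finset.sum_add_distrib]
  | mul_X P s hP =>
    have e : ∀ s' : σ, pd s' ((P : PS σ) * MvPowerSeries.X s) =
        (P : PS σ) * pd s' (MvPowerSeries.X s) + MvPowerSeries.X s * pd s' (P : PS σ) := fun s' =>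
      Derivation.leibniz _ _ _
    have e2 : ∀ f g : PS τ, pd t (f * g) = f * pd t g + g * pd t f := fun f g =>
      Derivation.leibniz _ _ _
    have e3 : ∀ s' : σ, pd s' (MvPowerSeries.X s) = if s' = s then (1 : PS σ) else 0 := fun s' =>
      by
        change MvPowerSeries.pderiv ℂ s' (MvPowerSeries.X s) = _
        rw [MvPowerSeries.pderiv_X, Pi.single_apply]
        simp only [eq_comm]
    simp only [MvPolynomial.coe_mul, MvPolynomial.coe_X, e, map_mul, e2, map_add, hP, smul_add,
      Finset.sum_add_distrib, MvPowerSeries.substAlgHom_X, pd_linForms, e3]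
    congr 1
    · rw [Finset.sum_eq_single s]
      · rw [if_pos rfl, map_one, mul_one, MvPowerSeries.smul_eq_C_mul, mul_comm]
      · intro s' _ h
        rw [if_neg h, map_zero, mul_zero, smul_zero]
      · simp
    · rw [Finset.mul_sum]
      exact Finset.sum_congr rfl fun s' _ => (mul_smul_comm _ _ _)

open scoped MvPowerSeries.WithPiTopology in
theorem continuous_pd [TopologicalSpace ℂ] [DiscreteTopology ℂ] (s : σ) :
    Continuous (pd s : PS σ → PS σ) := by
  refine continuous_pi fun d => ?_
  have : (fun f : PS σ => (pd s f : PS σ) d) =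
      fun f => MvPowerSeries.coeff (d + Finsupp.single s 1) f * ((d s : ℂ) + 1) := by
    funext f
    exact coeff_pd s f d
  rw [this]
  exact (continuous_of_discreteTopology (f := fun c : ℂ => c * ((d s : ℂ) + 1))).comp
    (MvPowerSeries.WithPiTopology.continuous_coeff ℂ _)

-- The chain rule is known on polynomials, which are dense in the power series, and both sides are
-- continuous.
open scoped MvPowerSeries.WithPiTopology in
theorem pd_subst_linForms (t : τ) (F : PS σ) :
    pd t (MvPowerSeries.substAlgHom (hasSubst_linForms A) F) =
      ∑ s, A s t • MvPowerSeries.substAlgHom (hasSubst_linForms A) (pd s F) := by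
  -- The coefficients get the discrete topology, so convergence means that each coefficient is
  -- eventually constant, and formal substitution is continuous.
  let : UniformSpace ℂ := ⊥
  have : DiscreteUniformity ℂ := ⟨rfl⟩
  have hc : Continuous (MvPowerSeries.substAlgHom (R := ℂ) (hasSubst_linForms A)) := by
    rw [MvPowerSeries.coe_substAlgHom]
    exact MvPowerSeries.continuous_subst (hasSubst_linForms A)
  have hsm : ∀ c : ℂ, Continuous fun f : PS τ => c • f := fun c =>
    continuous_pi fun d => (continuous_of_discreteTopology (f := fun x : ℂ => c * x)).comp
      (MvPowerSeries.WithPiTopology.continuous_coeff ℂ d)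
  have key := MvPowerSeries.WithPiTopology.denseRange_toMvPowerSeries (σ := σ) (R := ℂ)
  refine congrFun (DenseRange.equalizer key (g := fun F : PS σ =>
    pd t (MvPowerSeries.substAlgHom (hasSubst_linForms A) F)) (h := fun F : PS σ => ∑ s, A s t •
      MvPowerSeries.substAlgHom (hasSubst_linForms A) (pd s F)) ?_ ?_ ?_) F
  · exact (continuous_pd t).comp hc
  · exact continuous_finsetSum _ fun s _ => (hsm _).comp (hc.comp (continuous_pd s))
  · funext P
    exact pd_subst_linForms_coe A t P

theorem hasTranspose_subst_linForms :
    HasTranspose (MvPowerSeries.substAlgHom (R := ℂ) (hasSubst_linForms A)).toLinearMap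
      (MvPolynomial.aeval fun t => ∑ s, A s t • MvPolynomial.X s) := by
  refine hasTranspose_of_chainRule _ _ (fun F => ?_) fun t F P => ?_
  · have h := MvPowerSeries.constantCoeff_subst (hasSubst_linForms A) F
    rw [AlgHom.toLinearMap_apply, MvPowerSeries.substAlgHom_apply, h, finsum_eq_single _ 0]
    · simp
    -- A nonzero exponent contributes a positive power of some linear form, whose constant term is
    -- 0.
    · intro d hd
      obtain ⟨s, hs⟩ := Finsupp.ne_iff.1 hd
      rw [map_finsuppProd, Finsupp.prod, Finset.prod_eq_zero (i := s), smul_zero]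
      · simpa using hs
      · simp [linForms, zero_pow hs]
  · refine ⟨∑ s, A s t • pd s, ?_, ?_⟩
    · rw [MvPolynomial.aeval_X]
      exact HasSymbol.sum _ fun s _ => (hasSymbol_pd s).smul _
    · rw [AlgHom.toLinearMap_apply, pd_subst_linForms]
      simp [LinearMap.sum_apply, map_sum]

theorem hasTranspose_linSubst (B : Matrix σ σ ℂ) :
    HasTranspose (linSubst B).toLinearMap
      (MvPolynomial.aeval fun t => ∑ s, B s t • MvPolynomial.X s) :=
  hasTranspose_subst_linForms B

end LinearSubstitution

/-- The dual of the substitution `x_s ↦ x_{φ s}`. -/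
def dualRename [Fintype σ] (φ : σ → τ) : MvPolynomial τ ℂ →ₐ[ℂ] MvPolynomial σ ℂ :=
  open Classical in MvPolynomial.aeval fun t => ∑ s, if φ s = t then MvPolynomial.X s else 0

theorem hasTranspose_rename [Fintype σ] [Fintype τ] (φ : σ → τ)
    [Filter.TendstoCofinite φ] :
    HasTranspose (MvPowerSeries.rename (R := ℂ) φ).toLinearMap (dualRename φ) := by
  classical
  have h := hasTranspose_subst_linForms (σ := σ) (τ := τ)
    (Matrix.of fun s t => if φ s = t then 1 else 0)
  have e : (MvPowerSeries.substAlgHom (R := ℂ) (hasSubst_linForms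
      (Matrix.of fun (s : σ) (t : τ) => if φ s = t then (1 : ℂ) else 0))).toLinearMap =
      (MvPowerSeries.rename (R := ℂ) φ).toLinearMap := by
    ext1 F
    rw [AlgHom.toLinearMap_apply, AlgHom.toLinearMap_apply, MvPowerSeries.rename_eq_subst,
      MvPowerSeries.substAlgHom_apply]
    congr 1
    funext s
    simp [linForms]
  rw [e] at h
  have e2 : dualRename φ = (MvPolynomial.aeval fun t => ∑ s,
      (Matrix.of fun (s : σ) (t : τ) => if φ s = t then (1 : ℂ) else 0) s t •
        (MvPolynomial.X s : MvPolynomial σ ℂ)) := by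
    unfold dualRename
    congr 1
    funext t
    exact Finset.sum_congr rfl fun s _ => by simp
  rw [e2]
  exact h

/-- Setting variables to 0 commutes with the derivatives in the remaining ones, so its transpose is
the inclusion of polynomial rings. -/
theorem hasTranspose_killCompl [Fintype σ] [Fintype τ] (e : σ ↪ τ) :
    HasTranspose (MvPowerSeries.killCompl (R := ℂ) e).toLinearMap (MvPolynomial.rename e) := by
  refine hasTranspose_of_chainRule _ _ (fun F => ?_) fun t F P => ⟨pd (e t), ?_, ?_⟩
  · rw [AlgHom.toLinearMap_apply, ← MvPowerSeries.coeff_zero_eq_constantCoeff_apply,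
      MvPowerSeries.coeff_killCompl]
    simp
  · rw [MvPolynomial.rename_X]
    exact hasSymbol_pd _
  · congr 2
    ext d
    rw [coeff_pd, AlgHom.toLinearMap_apply, AlgHom.toLinearMap_apply,
      MvPowerSeries.coeff_killCompl, MvPowerSeries.coeff_killCompl, coeff_pd]
    simp [Finsupp.embDomain_add]

end Pairing

/-! ## The pairing of Laurent series in `ħ` with power series of symbols -/

section LaurentPairing

variable {σ τ : Type}

theorem exists_coeff_bound (F : Laur σ) (N : ℤ) :
    ∃ K : ℕ, ∀ n : ℕ, K ≤ n → F.coeff (N - n) = 0 :=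
  ⟨(N - F.order).toNat + 1, fun n hn => HahnSeries.coeff_eq_zero_of_lt_order (by omega)⟩

/-- The coefficient of `ħᴺ` of the value at `0` of `P(∂) F`. -/
def lpair [Fintype σ] (F : Laur σ) (N : ℤ) (P : PowerSeries (MvPolynomial σ ℂ)) : ℂ :=
  ∑ᶠ n : ℕ, pair (F.coeff (N - n)) (PowerSeries.coeff n P)

theorem lpair_eq_sum [Fintype σ] (F : Laur σ) (N : ℤ) (P : PowerSeries (MvPolynomial σ ℂ)) {K : ℕ}
    (hK : ∀ n : ℕ, K ≤ n → F.coeff (N - n) = 0) :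
    lpair F N P = ∑ n ∈ Finset.range K, pair (F.coeff (N - n)) (PowerSeries.coeff n P) := by
  refine finsum_eq_sum_of_support_subset _ fun n hn => ?_
  rw [Finset.coe_range, Set.mem_Iio]
  by_contra h
  exact hn (by simp only [hK n (not_lt.1 h), pair_zero, LinearMap.zero_apply])

theorem lpair_add_right [Fintype σ] (F : Laur σ) (N : ℤ) (P Q : PowerSeries (MvPolynomial σ ℂ)) :
    lpair F N (P + Q) = lpair F N P + lpair F N Q := by
  obtain ⟨K, hK⟩ := exists_coeff_bound F N
  simp only [lpair_eq_sum F N _ hK, map_add, Finset.sum_add_distrib]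

theorem lpair_smul_right [Fintype σ] (c : ℂ) (F : Laur σ) (N : ℤ)
    (P : PowerSeries (MvPolynomial σ ℂ)) : lpair F N (c • P) = c * lpair F N P := by
  obtain ⟨K, hK⟩ := exists_coeff_bound F N
  simp only [lpair_eq_sum F N _ hK, Finset.mul_sum]
  refine Finset.sum_congr rfl fun n _ => ?_
  have : PowerSeries.coeff n (c • P) = c • PowerSeries.coeff n P := rfl
  rw [this, map_smul, smul_eq_mul]

/-- `lpair` as a linear functional of the symbol. -/
def lpairHom [Fintype σ] (F : Laur σ) (N : ℤ) : PowerSeries (MvPolynomial σ ℂ) →ₗ[ℂ] ℂ where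
  toFun := lpair F N
  map_add' := lpair_add_right F N
  map_smul' c P := lpair_smul_right c F N P

theorem lpairHom_apply [Fintype σ] (F : Laur σ) (N : ℤ) (P : PowerSeries (MvPolynomial σ ℂ)) :
    lpairHom F N P = lpair F N P := rfl

theorem lpair_add_left [Fintype σ] (F G : Laur σ) (N : ℤ) (P : PowerSeries (MvPolynomial σ ℂ)) :
    lpair (F + G) N P = lpair F N P + lpair G N P := by
  obtain ⟨K, hK⟩ := exists_coeff_bound F N
  obtain ⟨K', hK'⟩ := exists_coeff_bound G N
  rw [lpair_eq_sum F N _ (K := max K K') fun n hn => hK n (le_of_max_le_left hn),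
    lpair_eq_sum G N _ (K := max K K') fun n hn => hK' n (le_of_max_le_right hn),
    lpair_eq_sum (F + G) N _ (K := max K K') fun n hn => by
      rw [HahnSeries.coeff_add, hK n (le_of_max_le_left hn), hK' n (le_of_max_le_right hn),
        add_zero], ← Finset.sum_add_distrib]
  exact Finset.sum_congr rfl fun n _ => by rw [HahnSeries.coeff_add, pair_add, LinearMap.add_apply]

theorem coeff_laur_smul (c : ℂ) (F : Laur σ) (n : ℤ) : (c • F).coeff n = c • F.coeff n := rfl

theorem lpair_smul_left [Fintype σ] (c : ℂ) (F : Laur σ) (N : ℤ)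
    (P : PowerSeries (MvPolynomial σ ℂ)) : lpair (c • F) N P = c * lpair F N P := by
  obtain ⟨K, hK⟩ := exists_coeff_bound F N
  rw [lpair_eq_sum F N _ hK, lpair_eq_sum (c • F) N _ fun n hn => by
    rw [coeff_laur_smul, hK n hn, smul_zero], Finset.mul_sum]
  exact Finset.sum_congr rfl fun n _ => by
    rw [coeff_laur_smul, pair_smul, LinearMap.smul_apply, smul_eq_mul]

/-- `lpair` as a linear functional of the Laurent series. -/
def lpairLeft [Fintype σ] (N : ℤ) (P : PowerSeries (MvPolynomial σ ℂ)) : Laur σ →ₗ[ℂ] ℂ where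
  toFun F := lpair F N P
  map_add' F G := lpair_add_left F G N P
  map_smul' c F := lpair_smul_left c F N P

theorem lpairLeft_apply [Fintype σ] (N : ℤ) (P : PowerSeries (MvPolynomial σ ℂ)) (F : Laur σ) :
    lpairLeft N P F = lpair F N P := rfl

theorem lpair_C [Fintype σ] (F : Laur σ) (N : ℤ) (p : MvPolynomial σ ℂ) :
    lpair F N (PowerSeries.C p) = pair (F.coeff N) p := by
  rw [lpair, finsum_eq_single _ 0]
  · simp
  · intro n hn
    rw [PowerSeries.coeff_C, if_neg hn, map_zero]

theorem lpair_injective [Fintype σ] {F G : Laur σ}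
    (h : ∀ N p, lpair F N (PowerSeries.C p) = lpair G N (PowerSeries.C p)) : F = G := by
  ext1
  funext N
  refine pair_injective fun p => ?_
  rw [← lpair_C, h, lpair_C]

theorem lpair_hbar_mul [Fintype σ] (F : Laur σ) (N : ℤ) (P : PowerSeries (MvPolynomial σ ℂ)) :
    lpair (hbar σ * F) N P = lpair F N (PowerSeries.X * P) := by
  have e : ∀ N, (hbar σ * F).coeff N = F.coeff (N - 1) := fun N => by
    have := HahnSeries.coeff_single_mul_add (r := (1 : PS σ)) (x := F) (a := N - 1) (b := (1 : ℤ))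
    rw [sub_add_cancel, one_mul] at this
    exact this
  obtain ⟨K, hK⟩ := exists_coeff_bound F N
  rw [lpair_eq_sum F N _ (K := K + 1) fun n hn => hK n (by omega), Finset.sum_range_succ',
    lpair_eq_sum (hbar σ * F) N _ (K := K) fun n hn => by
      rw [e, show N - n - 1 = N - (n + 1 : ℕ) by push_cast; ring]; exact hK _ (by omega)]
  simp only [PowerSeries.coeff_succ_X_mul, PowerSeries.coeff_zero_X_mul, map_zero, add_zero]
  refine Finset.sum_congr rfl fun n _ => ?_
  rw [e, show N - n - 1 = N - (n + 1 : ℕ) by push_cast; ring]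

theorem lpair_mapCoeff [Fintype σ] [Fintype τ] {L : PS σ →ₗ[ℂ] PS τ}
    {A : MvPolynomial τ ℂ →ₐ[ℂ] MvPolynomial σ ℂ} (h : HasTranspose L A) (F : Laur σ) (N : ℤ)
    (P : PowerSeries (MvPolynomial τ ℂ)) :
    lpair (mapCoeff L F) N P = lpair F N (PowerSeries.map (A : _ →+* _) P) := by
  unfold lpair
  refine finsum_congr fun n => ?_
  rw [coeff_mapCoeff, h, PowerSeries.coeff_map]
  rfl

theorem lpair_mapCoeff_symbol [Fintype σ] {D : PS σ →ₗ[ℂ] PS σ} {Q : MvPolynomial σ ℂ}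
    (h : HasSymbol D Q) (F : Laur σ) (N : ℤ) (P : PowerSeries (MvPolynomial σ ℂ)) :
    lpair (mapCoeff D F) N P = lpair F N (PowerSeries.C Q * P) := by
  unfold lpair
  refine finsum_congr fun n => ?_
  rw [coeff_mapCoeff, h, PowerSeries.coeff_C_mul]

theorem coeff_hbarSeries_eq_sum (T : ℕ → PS σ →ₗ[ℂ] PS τ) (F : Laur σ) (N : ℤ) {K : ℕ}
    (hK : ∀ n : ℕ, K ≤ n → F.coeff (N - n) = 0) :
    (hbarSeries T F).coeff N = ∑ n ∈ Finset.range K, T n (F.coeff (N - n)) := by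
  rw [coeff_hbarSeries]
  refine finsum_eq_sum_of_support_subset _ fun n hn => ?_
  rw [Finset.coe_range, Set.mem_Iio]
  by_contra h
  exact hn (by simp [hK n (not_lt.1 h)])

/-- The power of ħ from the operator and the power of ħ from the symbol are collected by their sum
`M`. One bound `K` then truncates both expansions, and the triangular double sum can be summed in
the other order. -/
theorem lpair_hbarSeries_eq_sum [Fintype σ] [Fintype τ] (T : ℕ → PS σ →ₗ[ℂ] PS τ) (F : Laur σ)
    (N : ℤ) (P : PowerSeries (MvPolynomial τ ℂ)) {K : ℕ}
    (hK : ∀ n : ℕ, K ≤ n → F.coeff (N - n) = 0) :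
    lpair (hbarSeries T F) N P = ∑ M ∈ Finset.range K, ∑ x ∈ Finset.HasAntidiagonal.antidiagonal M,
      pair (T x.1 (F.coeff (N - M))) (PowerSeries.coeff x.2 P) := by
  have hc : ∀ n : ℕ, (hbarSeries T F).coeff (N - n) =
      ∑ k ∈ Finset.range (K - n), T k (F.coeff (N - (n + k : ℕ))) := fun n => by
    rw [coeff_hbarSeries_eq_sum T F (N - n) (K := K - n) fun k hk => by
      rw [show N - n - k = N - (n + k : ℕ) by push_cast; ring]; exact hK _ (by omega)]
    exact Finset.sum_congr rfl fun k _ => by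
      rw [show N - n - k = N - (n + k : ℕ) by push_cast; ring]
  rw [lpair_eq_sum _ N P (K := K) fun n hn => by
    rw [hc, Nat.sub_eq_zero_of_le hn, Finset.range_zero, Finset.sum_empty]]
  have hd := Finset.sum_range_diag_flip K fun n k =>
    pair (T k (F.coeff (N - (n + k : ℕ)))) (PowerSeries.coeff n P)
  have : ∀ M ∈ Finset.range K, ∑ x ∈ Finset.HasAntidiagonal.antidiagonal M,
      pair (T x.1 (F.coeff (N - M))) (PowerSeries.coeff x.2 P) = ∑ n ∈ Finset.range (M + 1),
      pair (T (M - n) (F.coeff (N - (n + (M - n) : ℕ)))) (PowerSeries.coeff n P) := fun M _ => by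
    rw [← Finset.Nat.sum_antidiagonal_swap, Finset.Nat.sum_antidiagonal_eq_sum_range_succ_mk]
    refine Finset.sum_congr rfl fun n hn => ?_
    rw [Nat.add_sub_cancel' (Nat.lt_succ_iff.1 (Finset.mem_range.1 hn))]
    rfl
  rw [Finset.sum_congr rfl this, hd]
  refine Finset.sum_congr rfl fun n _ => ?_
  rw [hc, ← pairHom_apply, map_sum, LinearMap.sum_apply]
  rfl

/-- The symbol `e^{ħQ}`. -/
def symbolExp (Q : MvPolynomial σ ℂ) : PowerSeries (MvPolynomial σ ℂ) :=
  PowerSeries.rescale Q (PowerSeries.exp (MvPolynomial σ ℂ))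

theorem coeff_symbolExp (Q : MvPolynomial σ ℂ) (n : ℕ) :
    PowerSeries.coeff n (symbolExp Q) = (n.factorial : ℂ)⁻¹ • Q ^ n := by
  rw [symbolExp, PowerSeries.coeff_rescale, PowerSeries.coeff_exp, mul_comm, ← Algebra.smul_def]
  rw [← algebraMap_smul ℂ]
  simp

theorem symbolExp_add (Q Q' : MvPolynomial σ ℂ) :
    symbolExp (Q + Q') = symbolExp Q * symbolExp Q' :=
  (PowerSeries.exp_mul_exp_eq_exp_add Q Q').symm

theorem map_symbolExp (A : MvPolynomial τ ℂ →ₐ[ℂ] MvPolynomial σ ℂ) (Q : MvPolynomial τ ℂ) :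
    PowerSeries.map (A : _ →+* _) (symbolExp Q) = symbolExp (A Q) := by
  ext1 n
  rw [PowerSeries.coeff_map, coeff_symbolExp, coeff_symbolExp]
  simp

theorem hbarExp_eq (D : PS σ →ₗ[ℂ] PS σ) :
    hbarExp D = hbarSeries fun n => ((n.factorial : ℂ)⁻¹) • D ^ n := rfl

/-- This turns compositions of exponentials into sums of exponents: Moyal products, lines and self
loops can be compared as polynomials. -/
theorem lpair_hbarExp [Fintype σ] {D : PS σ →ₗ[ℂ] PS σ} {Q : MvPolynomial σ ℂ}
    (h : HasSymbol D Q) (F : Laur σ) (N : ℤ) (P : PowerSeries (MvPolynomial σ ℂ)) :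
    lpair (hbarExp D F) N P = lpair F N (symbolExp Q * P) := by
  obtain ⟨K, hK⟩ := exists_coeff_bound F N
  rw [hbarExp_eq, lpair_hbarSeries_eq_sum _ F N P hK, lpair_eq_sum F N _ hK]
  refine Finset.sum_congr rfl fun M _ => ?_
  rw [PowerSeries.coeff_mul, map_sum]
  refine Finset.sum_congr rfl fun x _ => ?_
  rw [((h.pow x.1).smul _) _ _, coeff_symbolExp]

end LaurentPairing

/-! ## Products of Laurent series and operators acting on coefficients -/

section Products

variable {σ τ : Type}

theorem exists_lower_bound (F : Laur σ) : ∃ a : ℤ, ∀ n < a, F.coeff n = 0 :=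
  ⟨F.order, fun _ h => HahnSeries.coeff_eq_zero_of_lt_order h⟩

/-- The interval of summation depends only on lower bounds for the orders and not on the supports,
so sums for different series can be matched term by term. -/
theorem coeff_mul_eq_sum (G H : Laur σ) {a b : ℤ} (hG : ∀ n < a, G.coeff n = 0)
    (hH : ∀ n < b, H.coeff n = 0) (N : ℤ) :
    (G * H).coeff N = ∑ i ∈ Finset.Icc a (N - b), G.coeff i * H.coeff (N - i) := by
  rw [HahnSeries.coeff_mul]
  refine Finset.sum_bij_ne_zero (fun x _ _ => x.1) (fun x hx h => ?_) (fun x hx _ y hy _ e => ?_)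
    (fun i hi h => ?_) fun x hx _ => ?_
  · obtain ⟨-, -, hs⟩ := Finset.mem_antidiagonal.1 hx
    rw [Finset.mem_Icc]
    constructor
    · by_contra hlt
      exact h (by rw [hG _ (not_le.1 hlt), zero_mul])
    · by_contra hlt
      exact h (by rw [hH x.2 (by omega), mul_zero])
  · obtain ⟨-, -, hs⟩ := Finset.mem_antidiagonal.1 hx
    obtain ⟨-, -, ht⟩ := Finset.mem_antidiagonal.1 hy
    exact Prod.ext e (by omega)
  · refine ⟨(i, N - i), Finset.mem_antidiagonal.2 ⟨left_ne_zero_of_mul h,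
      right_ne_zero_of_mul h, by ring⟩, h, rfl⟩
  · obtain ⟨-, -, hs⟩ := Finset.mem_antidiagonal.1 hx
    rw [show x.2 = N - x.1 by omega]

theorem hbarSeries_mul_left (T : ℕ → PS σ →ₗ[ℂ] PS σ) (G H : Laur σ)
    (h : ∀ n i (f : PS σ), T n (G.coeff i * f) = G.coeff i * T n f) :
    hbarSeries T (G * H) = G * hbarSeries T H := by
  obtain ⟨a, ha⟩ := exists_lower_bound G
  obtain ⟨b, hb⟩ := exists_lower_bound H
  have hGH : ∀ N : ℤ, ∀ n : ℕ, (N - a - b).toNat + 1 ≤ n → (G * H).coeff (N - n) = 0 := by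
    intro N n hn
    rw [coeff_mul_eq_sum G H ha hb, Finset.Icc_eq_empty (by omega), Finset.sum_empty]
  have hT : ∀ n < b, (hbarSeries T H).coeff n = 0 := fun n hn => by
    rw [coeff_hbarSeries_eq_sum T H n (K := 0) fun k _ => hb _ (by omega)]
    simp
  ext1
  funext N
  rw [coeff_mul_eq_sum G _ ha hT, coeff_hbarSeries_eq_sum T (G * H) N (hGH N)]
  have e1 : ∀ k : ℕ, T k ((G * H).coeff (N - k)) =
      ∑ i ∈ Finset.Icc a (N - b), G.coeff i * T k (H.coeff (N - i - k)) := fun k => by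
    rw [coeff_mul_eq_sum G H ha hb, map_sum]
    simp only [h]
    -- The range is enlarged to one independent of `k`, so that the two sums can be exchanged; the
    -- added terms lie below the order bound of `H`.
    rw [← Finset.sum_subset (Finset.Icc_subset_Icc_right (show N - k - b ≤ N - b by omega))]
    · exact Finset.sum_congr rfl fun i _ => by rw [sub_right_comm]
    · intro i hi hi'
      rw [Finset.mem_Icc] at hi hi'
      rw [hb _ (by omega), map_zero, mul_zero]
  simp only [e1]
  rw [Finset.sum_comm]
  refine Finset.sum_congr rfl fun i hi => ?_
  rw [Finset.mem_Icc] at hi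
  rw [← Finset.mul_sum, coeff_hbarSeries_eq_sum T H (N - i) (K := (N - a - b).toNat + 1)
    fun n hn => hb _ (by omega)]

/-- To be used with `G` the product of the factors that a bidifferential operator does not touch;
they behave like constants. -/
theorem hbarExp_mul_left (D : PS σ →ₗ[ℂ] PS σ) (G H : Laur σ)
    (h : ∀ i (f : PS σ), D (G.coeff i * f) = G.coeff i * D f) :
    hbarExp D (G * H) = G * hbarExp D H := by
  rw [hbarExp_eq]
  refine hbarSeries_mul_left _ G H fun n i f => ?_
  rw [LinearMap.smul_apply, LinearMap.smul_apply, mul_smul_comm]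
  congr 1
  induction n generalizing f with
  | zero => rfl
  | succ n ih => rw [pow_succ, Module.End.mul_apply, h, ih, Module.End.mul_apply]

theorem hbarExp_mapCoeff {L : PS σ →ₗ[ℂ] PS τ} {D : PS σ →ₗ[ℂ] PS σ} {D' : PS τ →ₗ[ℂ] PS τ}
    (h : ∀ f, D' (L f) = L (D f)) (F : Laur σ) :
    hbarExp D' (mapCoeff L F) = mapCoeff L (hbarExp D F) := by
  ext1
  funext N
  obtain ⟨K, hK⟩ := exists_coeff_bound F N
  rw [hbarExp_eq, hbarExp_eq, coeff_mapCoeff, coeff_hbarSeries_eq_sum _ F N hK,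
    coeff_hbarSeries_eq_sum _ _ N (K := K) fun n hn => by rw [coeff_mapCoeff, hK n hn, map_zero],
    map_sum]
  refine Finset.sum_congr rfl fun n hn => ?_
  rw [coeff_mapCoeff, LinearMap.smul_apply, LinearMap.smul_apply, map_smul]
  congr 1
  generalize F.coeff (N - n) = f
  clear hn
  induction n generalizing f with
  | zero => rfl
  | succ n ih => rw [pow_succ, Module.End.mul_apply, h, ih, pow_succ, Module.End.mul_apply]

/-- An algebra map of power series applied to every coefficient. -/
def mapLaur (L : PS σ →ₐ[ℂ] PS τ) : Laur σ →+* Laur τ where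
  toFun := mapCoeff L.toLinearMap
  map_one' := by
    ext1
    funext n
    rw [coeff_mapCoeff, HahnSeries.coeff_one, HahnSeries.coeff_one]
    split_ifs <;> simp
  map_zero' := map_zero _
  map_add' := map_add _
  map_mul' F G := HahnSeries.map_mul (L : PS σ →ₙ+* PS τ) (x := F) (y := G)

theorem mapLaur_apply (L : PS σ →ₐ[ℂ] PS τ) (F : Laur σ) :
    mapLaur L F = mapCoeff L.toLinearMap F := rfl

theorem mapLaur_mapLaur {υ : Type} (L : PS σ →ₐ[ℂ] PS τ) (L' : PS τ →ₐ[ℂ] PS υ) (F : Laur σ) :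
    mapLaur L' (mapLaur L F) = mapLaur (L'.comp L) F := rfl

theorem mapCoeff_pd_mul (s : σ) (F G : Laur σ) :
    mapCoeff (pd s) (F * G) = F * mapCoeff (pd s) G + mapCoeff (pd s) F * G := by
  obtain ⟨a, ha⟩ := exists_lower_bound F
  obtain ⟨b, hb⟩ := exists_lower_bound G
  have hF : ∀ n < a, (mapCoeff (pd s) F).coeff n = 0 := fun n hn => by
    rw [coeff_mapCoeff, ha n hn, map_zero]
  have hG : ∀ n < b, (mapCoeff (pd s) G).coeff n = 0 := fun n hn => by
    rw [coeff_mapCoeff, hb n hn, map_zero]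
  ext1
  funext N
  rw [coeff_mapCoeff, HahnSeries.coeff_add, coeff_mul_eq_sum F G ha hb,
    coeff_mul_eq_sum _ _ ha hG, coeff_mul_eq_sum _ _ hF hb, map_sum, ← Finset.sum_add_distrib]
  refine Finset.sum_congr rfl fun i _ => ?_
  rw [coeff_mapCoeff, coeff_mapCoeff, mul_comm (pd s _)]
  exact Derivation.leibniz _ _ _

theorem mapCoeff_pd_prod_eq_zero {ι : Type*} (s : σ) (t : Finset ι) (F : ι → Laur σ)
    (h : ∀ i ∈ t, mapCoeff (pd s) (F i) = 0) : mapCoeff (pd s) (∏ i ∈ t, F i) = 0 := by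
  classical
  induction t using Finset.induction_on with
  | empty =>
    ext1
    funext n
    rw [Finset.prod_empty, coeff_mapCoeff, HahnSeries.coeff_one]
    split_ifs
    · exact MvPowerSeries.pderiv_one
    · exact map_zero _
  | insert i t hi ih =>
    rw [Finset.prod_insert hi, mapCoeff_pd_mul, ih fun j hj => h j (Finset.mem_insert_of_mem hj),
      h i (Finset.mem_insert_self i t), mul_zero, zero_mul, add_zero]

end Products

/-! ## External products under relabelling, block substitutions and Moyal-Weyl products -/

section ExternalProducts

variable {σ : Type} [Fintype σ] {N N' : ℕ}

theorem extProd_apply (f : Fin N → Laur σ) :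
    extProd N σ f = ∏ α, mapLaur (copyAt α) (f α) := rfl

theorem hasTranspose_copyAt (α : Fin N) :
    HasTranspose (copyAt (σ := σ) α).toLinearMap (dualRename (Function.Embedding.sectR α σ)) :=
  hasTranspose_rename _

theorem dualRename_copyAt_X (α β : Fin N) (s : σ) :
    dualRename (Function.Embedding.sectR α σ) (MvPolynomial.X (β, s)) =
      if α = β then MvPolynomial.X s else 0 := by
  classical
  rw [dualRename, MvPolynomial.aeval_X]
  by_cases h : α = β
  · subst h
    rw [Finset.sum_eq_single s] <;> simp +contextual
  · simp [h]

theorem pd_copyAt (α : Fin N) (s : σ) (f : PS σ) :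
    pd (α, s) (copyAt α f) = copyAt α (pd s f) := by
  refine pair_injective fun P => ?_
  have h : ∀ F P, pair (copyAt α F) P = pair F (dualRename (Function.Embedding.sectR α σ) P) :=
    hasTranspose_copyAt (σ := σ) α
  rw [pair_pd, h, h, pair_pd, map_mul, dualRename_copyAt_X, if_pos rfl]

theorem pd_copyAt_of_ne {α β : Fin N} (h : α ≠ β) (s : σ) (f : PS σ) :
    pd (α, s) (copyAt β f) = 0 := by
  ext d
  rw [coeff_pd, coeff_copyAt α β h s _ _ (by simp)]
  simp

theorem mapCoeff_pd_copyAt (α : Fin N) (s : σ) (f : Laur σ) :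
    mapCoeff (pd (α, s)) (mapLaur (copyAt α) f) = mapLaur (copyAt α) (mapCoeff (pd s) f) := by
  ext1
  funext n
  exact pd_copyAt α s _

theorem mapCoeff_pd_copyAt_of_ne {α β : Fin N} (h : α ≠ β) (s : σ) (f : Laur σ) :
    mapCoeff (pd (α, s)) (mapLaur (copyAt β) f) = 0 := by
  ext1
  funext n
  exact pd_copyAt_of_ne h s _

theorem mapCoeff_pd_extProd (α : Fin N) (s : σ) (f : Fin N → Laur σ) :
    mapCoeff (pd (α, s)) (extProd N σ f) =
      extProd N σ (Function.update f α (mapCoeff (pd s) (f α))) := by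
  classical
  rw [extProd_apply, extProd_apply, ← Finset.mul_prod_erase _ _ (Finset.mem_univ α),
    mapCoeff_pd_mul, mapCoeff_pd_prod_eq_zero, mul_zero, zero_add, mapCoeff_pd_copyAt,
    ← Finset.mul_prod_erase Finset.univ (fun β => mapLaur (copyAt β) _) (Finset.mem_univ α),
    Function.update_self]
  · congr 1
    refine Finset.prod_congr rfl fun β hβ => ?_
    rw [Function.update_of_ne (Finset.ne_of_mem_erase hβ)]
  · intro β hβ
    exact mapCoeff_pd_copyAt_of_ne (Finset.ne_of_mem_erase hβ).symm s _

/-- The identification of copies of the variables along a map of labels. -/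
def relabel (σ : Type) [Fintype σ] (φ : Fin N → Fin N') : PS (Fin N × σ) →ₐ[ℂ] PS (Fin N' × σ) :=
  MvPowerSeries.rename (Prod.map φ id)

/-- The transpose of `relabel`. -/
def dualRelabel (σ : Type) [Fintype σ] (φ : Fin N → Fin N') :
    MvPolynomial (Fin N' × σ) ℂ →ₐ[ℂ] MvPolynomial (Fin N × σ) ℂ :=
  dualRename (Prod.map φ id)

theorem hasTranspose_relabel (φ : Fin N → Fin N') :
    HasTranspose (relabel σ φ).toLinearMap (dualRelabel σ φ) :=
  hasTranspose_rename _

theorem dualRelabel_X (φ : Fin N → Fin N') (β : Fin N') (s : σ) :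
    dualRelabel σ φ (MvPolynomial.X (β, s)) =
      ∑ α, if φ α = β then MvPolynomial.X (α, s) else 0 := by
  classical
  rw [dualRelabel, dualRename, MvPolynomial.aeval_X, Fintype.sum_prod_type]
  refine Finset.sum_congr rfl fun α _ => ?_
  rw [Finset.sum_eq_single s]
  · simp
  · intro t _ ht
    simp [ht]
  · simp

theorem relabel_comp_copyAt (φ : Fin N → Fin N') (α : Fin N) :
    (relabel σ φ).comp (copyAt α) = copyAt (φ α) := by
  ext1 f
  rw [AlgHom.comp_apply, relabel, copyAt, copyAt, MvPowerSeries.rename_rename]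
  rfl

theorem mapLaur_relabel_extProd (φ : Fin N → Fin N') (f : Fin N → Laur σ) :
    mapLaur (relabel σ φ) (extProd N σ f) = ∏ α, mapLaur (copyAt (φ α)) (f α) := by
  rw [extProd_apply, map_prod]
  refine Finset.prod_congr rfl fun α _ => ?_
  rw [mapLaur_mapLaur, relabel_comp_copyAt]

/-- The substitution of `A α` in the copy `α` of the variables. -/
def blockMatrix (A : Fin N → Matrix σ σ ℂ) : Matrix (Fin N × σ) (Fin N × σ) ℂ :=
  Matrix.of fun x y => if x.1 = y.1 then A x.1 x.2 y.2 else 0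

/-- The transpose of the substitution of `A α` in the copy `α` of the variables. -/
def dualBlock (A : Fin N → Matrix σ σ ℂ) :
    MvPolynomial (Fin N × σ) ℂ →ₐ[ℂ] MvPolynomial (Fin N × σ) ℂ :=
  MvPolynomial.aeval fun y => ∑ x, blockMatrix A x y • MvPolynomial.X x

theorem hasTranspose_blockMatrix (A : Fin N → Matrix σ σ ℂ) :
    HasTranspose (linSubst (blockMatrix A)).toLinearMap (dualBlock A) :=
  hasTranspose_linSubst _

theorem dualBlock_X (A : Fin N → Matrix σ σ ℂ) (α : Fin N) (t : σ) :
    dualBlock A (MvPolynomial.X (α, t)) = ∑ s, A α s t • MvPolynomial.X (α, s) := by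
  rw [dualBlock, MvPolynomial.aeval_X, Fintype.sum_prod_type, Finset.sum_eq_single α]
  · simp [blockMatrix]
  · intro β _ h
    simp [blockMatrix, h]
  · simp

theorem linSubst_comp_copyAt (A : Fin N → Matrix σ σ ℂ) (α : Fin N) :
    (linSubst (blockMatrix A)).comp (copyAt α) = (copyAt α).comp (linSubst (A α)) := by
  have h1 := (hasTranspose_blockMatrix A).comp (hasTranspose_copyAt (σ := σ) α)
  have h2 := (hasTranspose_copyAt (σ := σ) α).comp (hasTranspose_linSubst (A α))
  have := h1.eq_of h2 fun y => by
    obtain ⟨β, t⟩ := y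
    rw [AlgHom.comp_apply, AlgHom.comp_apply, dualBlock_X, map_sum, dualRename_copyAt_X]
    simp only [map_smul, dualRename_copyAt_X]
    split_ifs with h
    · subst h
      rw [MvPolynomial.aeval_X]
    · simp
  ext1 f
  exact LinearMap.congr_fun this f

theorem mapLaur_linSubst_extProd (A : Fin N → Matrix σ σ ℂ) (f : Fin N → Laur σ) :
    mapLaur (linSubst (blockMatrix A)) (extProd N σ f) =
      extProd N σ fun α => mapLaur (linSubst (A α)) (f α) := by
  rw [extProd_apply, extProd_apply, map_prod]
  refine Finset.prod_congr rfl fun α _ => ?_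
  rw [mapLaur_mapLaur, linSubst_comp_copyAt, ← mapLaur_mapLaur]

theorem linSubst_one [DecidableEq σ] :
    linSubst (1 : Matrix σ σ ℂ) = AlgHom.id ℂ (PS σ) := by
  have h : HasTranspose (AlgHom.id ℂ (PS σ)).toLinearMap (AlgHom.id ℂ (MvPolynomial σ ℂ)) :=
    fun F P => rfl
  have := (hasTranspose_linSubst (1 : Matrix σ σ ℂ)).eq_of h fun t => by
    rw [MvPolynomial.aeval_X, Finset.sum_eq_single t] <;> simp +contextual
  ext1 f
  exact LinearMap.congr_fun this f

variable (P : Matrix σ σ ℂ)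

/-- The operator `½ ∑ P^{ij} ∂_i ⊗ ∂_j` on the factors `u` and `v`. -/
def poissonAt (u v : Fin N) : PS (Fin N × σ) →ₗ[ℂ] PS (Fin N × σ) :=
  (1 / 2 : ℂ) • ∑ i, ∑ j, P i j • (pd (u, i) ∘ₗ pd (v, j))

theorem hasSymbol_poissonAt (u v : Fin N) : HasSymbol (poissonAt P u v)
    ((1 / 2 : ℂ) • ∑ i, ∑ j, P i j • (MvPolynomial.X (u, i) * MvPolynomial.X (v, j))) :=
  (HasSymbol.sum _ fun i _ => HasSymbol.sum _ fun j _ =>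
    ((hasSymbol_pd (u, i)).comp (hasSymbol_pd (v, j))).smul _).smul _

/-- Injectivity is needed: it gives each differentiated variable a single preimage, where otherwise
a derivative would split into a sum over a fibre. -/
theorem poissonAt_relabel (φ : Fin N → Fin N') (hφ : Function.Injective φ) (u v : Fin N)
    (f : PS (Fin N × σ)) :
    poissonAt P (φ u) (φ v) (relabel σ φ f) = relabel σ φ (poissonAt P u v f) := by
  have hX : ∀ (w : Fin N) (s : σ), dualRelabel σ φ (MvPolynomial.X (φ w, s)) =
      MvPolynomial.X (w, s) := fun w s => by
    rw [dualRelabel_X, Finset.sum_eq_single w]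
    · simp
    · intro b _ hb
      rw [if_neg fun e => hb (hφ e)]
    · simp
  have h : ∀ F Q, pair (relabel σ φ F) Q = pair F (dualRelabel σ φ Q) :=
    hasTranspose_relabel (σ := σ) φ
  refine pair_injective fun Q => ?_
  rw [hasSymbol_poissonAt, h, h, hasSymbol_poissonAt, map_mul]
  simp only [map_smul, map_sum, map_mul, hX]

theorem poissonAt_mul_left (u v : Fin N) (x y : PS (Fin N × σ)) (hu : ∀ i, pd (u, i) x = 0)
    (hv : ∀ j, pd (v, j) x = 0) : poissonAt P u v (x * y) = x * poissonAt P u v y := by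
  have e : ∀ (a : Fin N × σ) (z : PS (Fin N × σ)), pd a x = 0 → pd a (x * z) = x * pd a z :=
    fun a z h => by
      have : pd a (x * z) = x * pd a z + z * pd a x := Derivation.leibniz _ _ _
      rw [this, h, mul_zero, add_zero]
  simp only [poissonAt, LinearMap.smul_apply, LinearMap.sum_apply, LinearMap.comp_apply,
    mul_smul_comm, Finset.mul_sum, e _ _ (hv _), e _ _ (hu _)]

theorem copyAt_comp_multMap (β : Fin N') (φ : Fin N → Fin N') (ψ : Fin 2 → Fin N)
    (h : ∀ i, φ (ψ i) = β) :
    (copyAt β).comp (multMap 2 σ) = (relabel σ φ).comp (relabel σ ψ) := by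
  ext1 f
  rw [AlgHom.comp_apply, AlgHom.comp_apply, relabel, relabel, copyAt, multMap,
    MvPowerSeries.rename_rename, MvPowerSeries.rename_rename]
  congr 2
  funext x
  exact Prod.ext (h x.1).symm rfl

/-- All factors except `u` and `v` are constants for the bidifferential operator and can be pulled
out of the exponential. What is left is a two-factor external product, embedded by `ψ`, and
identifying its two labels is the multiplication in the Moyal product. -/
theorem extProd_merge (φ : Fin N → Fin N') (u v : Fin N) (huv : u ≠ v) (f : Fin N → Laur σ)
    (f' : Fin N' → Laur σ) (hφ : φ u = φ v)
    (hinj : ∀ a b, φ a = φ b → a = b ∨ (a = u ∧ b = v) ∨ (a = v ∧ b = u))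
    (hsurj : Function.Surjective φ) (h1 : f' (φ u) = moyal P (f u) (f v))
    (h2 : ∀ w, w ≠ u → w ≠ v → f' (φ w) = f w) :
    extProd N' σ f' =
      mapLaur (relabel σ φ) (hbarExp (poissonAt P u v) (extProd N σ f)) := by
  classical
  let ψ : Fin 2 → Fin N := ![u, v]
  have hψ : Function.Injective ψ := by
    intro a b hab
    fin_cases a <;> fin_cases b <;> simp_all [ψ]
  let S : Finset (Fin N) := (Finset.univ.erase u).erase v
  have hS : ∀ w, w ∈ S ↔ w ≠ v ∧ w ≠ u := fun w => by simp [S]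
  have hG0 : ∀ a, a ∉ S → ∀ i : σ,
      mapCoeff (pd (a, i)) (∏ w ∈ S, mapLaur (copyAt w) (f w)) = 0 := fun a ha i =>
    mapCoeff_pd_prod_eq_zero _ _ _ fun w hw =>
      mapCoeff_pd_copyAt_of_ne (fun e => ha (by rwa [e])) i _
  have hG : ∀ a, a ∉ S → ∀ (i : σ) (n : ℤ),
      pd (a, i) ((∏ w ∈ S, mapLaur (copyAt w) (f w)).coeff n) = 0 := fun a ha i n => by
    rw [← coeff_mapCoeff, hG0 a ha, HahnSeries.coeff_zero]
  have eψ : mapLaur (relabel σ ψ) (extProd 2 σ ![f u, f v]) =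
      mapLaur (copyAt u) (f u) * mapLaur (copyAt v) (f v) := by
    rw [mapLaur_relabel_extProd, Fin.prod_univ_two]
    rfl
  have efull : extProd N σ f = (∏ w ∈ S, mapLaur (copyAt w) (f w)) *
      mapLaur (relabel σ ψ) (extProd 2 σ ![f u, f v]) := by
    rw [eψ, extProd_apply, ← Finset.mul_prod_erase _ _ (Finset.mem_univ u),
      ← Finset.mul_prod_erase (Finset.univ.erase u) _ (a := v) (by simp [huv.symm])]
    ring
  have emoyal : mapLaur (copyAt (φ u)) (moyal P (f u) (f v)) = mapLaur (relabel σ φ)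
      (hbarExp (poissonAt P u v) (mapLaur (relabel σ ψ) (extProd 2 σ ![f u, f v]))) := by
    have e1 : hbarExp (poissonAt P u v) (mapLaur (relabel σ ψ) (extProd 2 σ ![f u, f v])) =
        mapLaur (relabel σ ψ) (hbarExp (halfPoisson P) (extProd 2 σ ![f u, f v])) :=
      hbarExp_mapCoeff (poissonAt_relabel P ψ hψ 0 1) _
    rw [e1, mapLaur_mapLaur, ← copyAt_comp_multMap (φ u) φ ψ (Fin.forall_fin_two.2
      ⟨rfl, hφ.symm⟩)]
    rfl
  have erest : mapLaur (relabel σ φ) (∏ w ∈ S, mapLaur (copyAt w) (f w)) =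
      ∏ β ∈ Finset.univ.erase (φ u), mapLaur (copyAt β) (f' β) := by
    rw [map_prod]
    refine Finset.prod_bij (fun w _ => φ w) (fun w hw => ?_) (fun a ha b hb e => ?_)
      (fun β hβ => ?_) fun w hw => ?_
    · rw [hS] at hw
      rw [Finset.mem_erase]
      refine ⟨fun e => ?_, Finset.mem_univ _⟩
      rcases hinj _ _ e with h | h | h
      exacts [hw.2 h, huv h.2, hw.1 h.1]
    · rw [hS] at ha hb
      rcases hinj _ _ e with h | h | h
      exacts [h, absurd h.1 ha.2, absurd h.1 ha.1]
    · obtain ⟨w, rfl⟩ := hsurj β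
      refine ⟨w, (hS w).2 ⟨fun e => ?_, fun e => ?_⟩, rfl⟩
      · exact Finset.ne_of_mem_erase hβ (by rw [e, hφ])
      · exact Finset.ne_of_mem_erase hβ (by rw [e])
    · rw [hS] at hw
      rw [h2 w hw.2 hw.1, mapLaur_mapLaur, relabel_comp_copyAt]
  rw [efull, hbarExp_mul_left _ _ _ fun n y => poissonAt_mul_left P u v _ y
    (fun i => hG u (by simp [hS]) i n) (fun i => hG v (by simp [hS]) i n), map_mul, ← emoyal, ← h1,
    erest, mul_comm, Finset.mul_prod_erase _ (fun β => mapLaur (copyAt β) (f' β))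
      (Finset.mem_univ _), extProd_apply]

end ExternalProducts

/-! ## The quadratic form in the exponent of the correlation map -/

section QuadraticForm

variable {V W : Type*} [AddCommGroup V] [Module ℂ V] [AddCommGroup W] [Module ℂ W]

/-- The form `∑_α θ_α b₁(X_α, X) + ½ b_S(X, X) - ¼ ∑_{α, β} ε_{αβ} b_P(X_α, X_β)`, where
`X = ∑_α X_α`. -/
def quad (b₁ bS bP : V →ₗ[ℂ] V →ₗ[ℂ] W) {N : ℕ} (θ : Fin N → ℝ) (ε : Fin N → Fin N → ℂ)
    (X : Fin N → V) : W :=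
  ∑ α, (θ α : ℂ) • b₁ (X α) (∑ β, X β) + (1 / 2 : ℂ) • bS (∑ β, X β) (∑ β, X β)
    - (1 / 4 : ℂ) • ∑ α, ∑ β, ε α β • bP (X α) (X β)

variable {b₁ bS bP : V →ₗ[ℂ] V →ₗ[ℂ] W} {N N' : ℕ}

theorem sum_fiber {φ : Fin N → Fin N'} {U : Type*} [AddCommMonoid U] (f : Fin N → Fin N' → U) :
    ∑ β, ∑ α, (if φ α = β then f α β else 0) = ∑ α, f α (φ α) := by
  rw [Finset.sum_comm]
  refine Finset.sum_congr rfl fun α _ => ?_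
  rw [Finset.sum_ite_eq]
  simp

/-- By bilinearity a sum over labels of sums over fibres is a sum over the source. Inside a fibre
the pulled-back sign is a diagonal value of `ε`, which is 0 for `orderSign`; `quad_add_single` later
restores the sign between colliding labels. -/
theorem quad_fiber (φ : Fin N → Fin N') (θ : Fin N' → ℝ) (ε : Fin N' → Fin N' → ℂ)
    (X : Fin N → V) :
    quad b₁ bS bP θ ε (fun β => ∑ α, if φ α = β then X α else 0) =
      quad b₁ bS bP (fun α => θ (φ α)) (fun α β => ε (φ α) (φ β)) X := by
  have h0 : ∑ β, ∑ α, (if φ α = β then X α else 0) = ∑ α, X α := sum_fiber fun α _ => X α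
  have e1 : ∀ (b : V →ₗ[ℂ] V →ₗ[ℂ] W) (β : Fin N') (y : V),
      b (∑ α, if φ α = β then X α else 0) y = ∑ α, if φ α = β then b (X α) y else 0 :=
    fun b β y => by
      rw [map_sum, LinearMap.sum_apply]
      refine Finset.sum_congr rfl fun α _ => ?_
      split_ifs <;> simp
  have e2 : ∀ (b : V →ₗ[ℂ] V →ₗ[ℂ] W) (x : V) (β : Fin N'),
      b x (∑ α, if φ α = β then X α else 0) = ∑ α, if φ α = β then b x (X α) else 0 :=
    fun b x β => by
      rw [map_sum]
      refine Finset.sum_congr rfl fun α _ => ?_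
      split_ifs <;> simp
  unfold quad
  rw [h0]
  congr 1
  · congr 1
    rw [← sum_fiber (φ := φ) fun α β => (θ β : ℂ) • b₁ (X α) (∑ β, X β)]
    refine Finset.sum_congr rfl fun β _ => ?_
    rw [e1, Finset.smul_sum]
    exact Finset.sum_congr rfl fun α _ => by split_ifs <;> simp
  · congr 1
    rw [← sum_fiber (φ := φ) fun α γ => ∑ β, ε γ (φ β) • bP (X α) (X β)]
    refine Finset.sum_congr rfl fun γ _ => ?_
    have e3 : ∀ α, ∑ β, ε γ (φ β) • bP (X α) (X β) =
        ∑ δ, ∑ β, if φ β = δ then ε γ δ • bP (X α) (X β) else 0 := fun α =>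
      (sum_fiber fun β δ => ε γ δ • bP (X α) (X β)).symm
    simp only [e1, e2, e3]
    simp only [Finset.smul_sum]
    rw [Finset.sum_comm]
    refine Finset.sum_congr rfl fun α _ => ?_
    by_cases h : φ α = γ
    · simp [h, Finset.smul_sum]
    · simp [h]

/-- Skewness makes the two changes of sign contribute equally: `-¼(-bP(X_u, X_v) + bP(X_v, X_u)) = ½
bP(X_u, X_v)`. -/
theorem quad_add_single (hP : ∀ x y, bP x y = -bP y x) (θ : Fin N → ℝ) (ε : Fin N → Fin N → ℂ)
    (X : Fin N → V) (u v : Fin N) :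
    quad b₁ bS bP θ ε X + (1 / 2 : ℂ) • bP (X u) (X v) =
      quad b₁ bS bP θ (fun α β => ε α β - (if α = u ∧ β = v then 1 else 0)
        + (if α = v ∧ β = u then 1 else 0)) X := by
  have h : ∀ a b : Fin N, ∑ α, ∑ β, (if α = a ∧ β = b then (1 : ℂ) else 0) • bP (X α) (X β) =
      bP (X a) (X b) := fun a b => by
    rw [Finset.sum_eq_single a, Finset.sum_eq_single b] <;> simp +contextual
  unfold quad
  simp only [add_smul, sub_smul, Finset.sum_add_distrib, Finset.sum_sub_distrib, h]
  rw [hP (X v) (X u)]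
  module

/-- The labels in `J` jump from the end of the order to its beginning while their points are lowered
by 1. The shift costs `b₁(w, X)`, with `w` the sum of the vectors that jump. The cross terms change
sign, and the hypothesis `hgS` is exactly what lets the change in `bS` compensate for both effects.
-/
theorem quad_wrap (g : V →ₗ[ℂ] V) (hS : ∀ x y, bS x y = bS y x) (hP : ∀ x y, bP x y = -bP y x)
    (hgP : ∀ x y, bP (g x) (g y) = bP x y) (hg1 : ∀ x y, b₁ (g x) y = b₁ x y)
    (hg1' : ∀ x y, b₁ x (g y) = b₁ x y)
    (hgS : ∀ x y, bS (g x) y = bS x y + (1 / 2 : ℂ) • bP (g x) y + (1 / 2 : ℂ) • bP x y - b₁ x y)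
    (J : Fin N → Prop) [DecidablePred J] (θ : Fin N → ℝ) (ε ε' : Fin N → Fin N → ℂ)
    (h1 : ∀ α β, J α → J β → ε' α β = ε α β) (h2 : ∀ α β, ¬ J α → ¬ J β → ε' α β = ε α β)
    (h3 : ∀ α β, J α → ¬ J β → ε' α β = 1 ∧ ε α β = -1)
    (h4 : ∀ α β, ¬ J α → J β → ε' α β = -1 ∧ ε α β = 1) (X : Fin N → V) :
    quad b₁ bS bP θ ε' (fun α => if J α then g (X α) else X α) =
      quad b₁ bS bP (fun α => θ α - if J α then 1 else 0) ε X := by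
  -- `x` is the part that crosses the twist and `y` the part that stays; `bS` sees only their sums.
  set x : Fin N → V := fun α => if J α then X α else 0 with hx
  set y : Fin N → V := fun α => if J α then 0 else X α with hy
  have eX : ∀ α, X α = x α + y α := fun α => by simp only [hx, hy]; split_ifs <;> simp
  have egX : ∀ α, (if J α then g (X α) else X α) = g (x α) + y α := fun α => by
    simp only [hx, hy]; split_ifs <;> simp
  have sX : ∑ α, X α = ∑ α, x α + ∑ α, y α := by
    rw [← Finset.sum_add_distrib]; exact Finset.sum_congr rfl fun α _ => eX α
  have sgX : ∑ α, (if J α then g (X α) else X α) = g (∑ α, x α) + ∑ α, y α := by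
    rw [map_sum, ← Finset.sum_add_distrib]; exact Finset.sum_congr rfl fun α _ => egX α
  have hPP : ∀ z, bP z z = 0 := fun z => by
    have h := hP z z
    have h' : (2 : ℂ) • bP z z = 0 := by rw [two_smul]; nth_rw 1 [h]; exact neg_add_cancel _
    exact (smul_eq_zero.1 h').resolve_left two_ne_zero
  have hε : ∀ α β, ε' α β • bP (if J α then g (X α) else X α) (if J β then g (X β) else X β) =
      ε α β • bP (X α) (X β) + bP (g (x α)) (y β) + bP (x α) (y β) - bP (y α) (g (x β))
        - bP (y α) (x β) := fun α β => by
    by_cases hα : J α <;> by_cases hβ : J β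
    · simp [hx, hy, hα, hβ, h1 α β hα hβ, hgP]
    · obtain ⟨e1, e2⟩ := h3 α β hα hβ
      simp [hx, hy, hα, hβ, e1, e2]
    · obtain ⟨e1, e2⟩ := h4 α β hα hβ
      simp [hx, hy, hα, hβ, e1, e2]
    · simp [hx, hy, hα, hβ, h2 α β hα hβ]
  have hs : ∀ (b : V →ₗ[ℂ] V →ₗ[ℂ] W) (p q : Fin N → V),
      ∑ α, ∑ β, b (p α) (q β) = b (∑ α, p α) (∑ β, q β) := fun b p q => by
    rw [LinearMap.map_sum₂]
    exact Finset.sum_congr rfl fun α _ => (map_sum _ _ _).symm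
  have hθ : ∑ α, ((θ α - if J α then 1 else 0 : ℝ) : ℂ) • b₁ (X α) (∑ β, X β) =
      ∑ α, (θ α : ℂ) • b₁ (X α) (∑ β, X β) - b₁ (∑ α, x α) (∑ β, X β) := by
    rw [LinearMap.map_sum₂, ← Finset.sum_sub_distrib]
    refine Finset.sum_congr rfl fun α _ => ?_
    by_cases hα : J α <;> simp [hx, hα, sub_smul]
  have hθ' : ∀ α, b₁ (if J α then g (X α) else X α) (g (∑ α, x α) + ∑ α, y α) =
      b₁ (X α) (∑ β, X β) := fun α => by
    rw [sX, map_add, hg1', ← map_add]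
    split_ifs
    · exact hg1 _ _
    · rfl
  unfold quad
  rw [sgX, hθ]
  simp only [hε, Finset.sum_add_distrib, Finset.sum_sub_distrib, hθ']
  have e1 : ∑ α, ∑ β, bP (g (x α)) (y β) = bP (g (∑ α, x α)) (∑ β, y β) := by
    rw [map_sum g]; exact hs bP (fun α => g (x α)) y
  have e2 : ∑ α, ∑ β, bP (y α) (g (x β)) = bP (∑ α, y α) (g (∑ β, x β)) := by
    rw [map_sum g]; exact hs bP y fun α => g (x α)
  rw [e1, e2, hs, hs, sX]
  generalize ∑ α, x α = w
  generalize ∑ α, y α = r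
  simp only [map_add, LinearMap.add_apply]
  -- The term `bS (g w) (g w)` is reduced in two rounds: one `g` is removed from the left, symmetry
  -- brings the other there, and `hgS` applies again. The remaining terms cancel by skewness.
  rw [hS r (g w), hS r w, hgS w (g w), hS w (g w), hgS w w, hgS w r, hg1', hPP, hPP,
    hP r (g w), hP r w, hP w (g w)]
  module

end QuadraticForm

/-! ### Bivectors as bilinear forms on vectors of symbols -/

section BilinearForm

variable {σ : Type} [Fintype σ] {R : Type*} [CommRing R] [Algebra ℂ R]

/-- The bilinear form `∑ B_{ij} x_i y_j`. -/
def bil (R : Type*) [CommRing R] [Algebra ℂ R] (B : Matrix σ σ ℂ) :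
    (σ → R) →ₗ[ℂ] (σ → R) →ₗ[ℂ] R :=
  LinearMap.mk₂ ℂ (fun x y => ∑ i, ∑ j, B i j • (x i * y j))
    (fun x x' y => by simp [add_mul, Finset.sum_add_distrib])
    (fun c x y => by simp [Finset.smul_sum, smul_comm c])
    (fun x y y' => by simp [mul_add, Finset.sum_add_distrib])
    (fun c x y => by simp [Finset.smul_sum, smul_comm c])

theorem bil_apply (B : Matrix σ σ ℂ) (x y : σ → R) :
    bil R B x y = ∑ i, ∑ j, B i j • (x i * y j) := rfl

/-- The action `x ↦ Aᵀ x` on vectors. -/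
def dualAct (R : Type*) [CommRing R] [Algebra ℂ R] (A : Matrix σ σ ℂ) :
    (σ → R) →ₗ[ℂ] (σ → R) where
  toFun x t := ∑ s, A s t • x s
  map_add' x y := by funext t; simp [Finset.sum_add_distrib]
  map_smul' c x := by funext t; simp [Finset.smul_sum, smul_comm c]

theorem dualAct_apply (A : Matrix σ σ ℂ) (x : σ → R) (t : σ) :
    dualAct R A x t = ∑ s, A s t • x s := rfl

theorem bil_dualAct_left (A B : Matrix σ σ ℂ) (x y : σ → R) :
    bil R B (dualAct R A x) y = bil R (A * B) x y := by
  simp only [bil_apply, dualAct_apply, Finset.sum_mul, Finset.smul_sum, Matrix.mul_apply,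
    Finset.sum_smul]
  rw [Finset.sum_comm]
  conv_rhs => rw [Finset.sum_comm]
  refine Finset.sum_congr rfl fun j _ => ?_
  rw [Finset.sum_comm]
  refine Finset.sum_congr rfl fun s _ => Finset.sum_congr rfl fun i _ => ?_
  rw [smul_mul_assoc, smul_smul, mul_comm]

theorem bil_swap (B : Matrix σ σ ℂ) (x y : σ → R) : bil R B x y = bil R Bᵀ y x := by
  rw [bil_apply, bil_apply, Finset.sum_comm]
  exact Finset.sum_congr rfl fun i _ => Finset.sum_congr rfl fun j _ => by
    rw [Matrix.transpose_apply, mul_comm]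

theorem bil_dualAct_right (A B : Matrix σ σ ℂ) (x y : σ → R) :
    bil R B x (dualAct R A y) = bil R (B * Aᵀ) x y := by
  rw [bil_swap, bil_dualAct_left, bil_swap, Matrix.transpose_mul, Matrix.transpose_transpose]

theorem bil_add (B B' : Matrix σ σ ℂ) (x y : σ → R) :
    bil R (B + B') x y = bil R B x y + bil R B' x y := by
  simp only [bil_apply, Matrix.add_apply, add_smul, Finset.sum_add_distrib]

theorem bil_smul (c : ℂ) (B : Matrix σ σ ℂ) (x y : σ → R) :
    bil R (c • B) x y = c • bil R B x y := by
  simp only [bil_apply, Matrix.smul_apply, smul_assoc, Finset.smul_sum]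

theorem bil_neg (B : Matrix σ σ ℂ) (x y : σ → R) : bil R (-B) x y = -bil R B x y := by
  rw [← neg_one_smul ℂ B, bil_smul, neg_one_smul]

theorem bil_sub (B B' : Matrix σ σ ℂ) (x y : σ → R) :
    bil R (B - B') x y = bil R B x y - bil R B' x y := by
  rw [sub_eq_add_neg, bil_add, bil_neg, ← sub_eq_add_neg]

theorem algHom_bil {R' : Type*} [CommRing R'] [Algebra ℂ R'] (A : R →ₐ[ℂ] R') (B : Matrix σ σ ℂ)
    (x y : σ → R) : A (bil R B x y) = bil R' B (fun i => A (x i)) fun i => A (y i) := by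
  simp only [bil_apply, map_sum, map_smul, map_mul]

theorem algHom_quad {R' : Type*} [CommRing R'] [Algebra ℂ R'] (A : R →ₐ[ℂ] R')
    (B₁ S P : Matrix σ σ ℂ) {N : ℕ} (θ : Fin N → ℝ) (ε : Fin N → Fin N → ℂ) (X : Fin N → σ → R) :
    A (quad (bil R B₁) (bil R S) (bil R P) θ ε X) =
      quad (bil R' B₁) (bil R' S) (bil R' P) θ ε fun α i => A (X α i) := by
  have e : (fun i => A ((∑ β, X β) i)) = ∑ β, fun i => A (X β i) := by
    funext i
    rw [Finset.sum_apply, Finset.sum_apply, map_sum]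
  simp only [quad, map_sub, map_add, map_sum A, map_smul, algHom_bil, e]

end BilinearForm

/-! ## The matrices of a twisted sector -/

namespace TwistedSector

section Matrices

variable {k l r : ℕ} {G : Type*} [Group G] (M : TwistedSector k l r G)

theorem inv_skew {n : ℕ} {w : Matrix (Fin n) (Fin n) ℝ} (h : wᵀ = -w) :
    ((w⁻¹).map (algebraMap ℝ ℂ))ᵀ = -(w⁻¹).map (algebraMap ℝ ℂ) := by
  have e : (w⁻¹)ᵀ = -w⁻¹ := by
    rw [Matrix.transpose_nonsing_inv, h]
    by_cases hw : IsUnit w.det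
    · refine Matrix.inv_eq_left_inv ?_
      rw [neg_mul_neg, Matrix.nonsing_inv_mul _ hw]
    -- For a singular matrix both inverses are 0 by convention, so nondegeneracy need not be
    -- assumed.
    · have hw' : ¬ IsUnit (-w).det := by rwa [← h, Matrix.det_transpose]
      rw [Matrix.nonsing_inv_apply_not_isUnit _ hw, Matrix.nonsing_inv_apply_not_isUnit _ hw',
        neg_zero]
  rw [← Matrix.transpose_map, e]
  ext i j
  simp

theorem P₁_transpose : M.P₁ᵀ = -M.P₁ := inv_skew M.ω₁_skew

theorem P₂_transpose : M.P₂ᵀ = -M.P₂ := inv_skew M.ω₂_skew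

theorem P_transpose : M.Pᵀ = -M.P := by
  rw [P, Matrix.fromBlocks_transpose, P₁_transpose, P₂_transpose, Matrix.fromBlocks_neg]
  simp

/-- The symplectic form on `ℝ^{2k} ⊕ ℝ^{2l}` over `ℂ`. -/
def Ω : Matrix (Idx k l) (Idx k l) ℂ :=
  (Matrix.fromBlocks M.ω₁ 0 0 M.ω₂).map (algebraMap ℝ ℂ)

theorem P_mul_Ω : M.P * M.Ω = 1 := by
  have e : ∀ {n : ℕ} {w : Matrix (Fin n) (Fin n) ℝ}, IsUnit w.det →
      (w⁻¹).map (algebraMap ℝ ℂ) * w.map (algebraMap ℝ ℂ) = 1 := fun {n w} hw => by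
    rw [← Matrix.map_mul, Matrix.nonsing_inv_mul _ hw]
    simp
  rw [P, Ω, Matrix.fromBlocks_map, Matrix.fromBlocks_multiply, P₁, P₂, e M.ω₁_nondegenerate,
    e M.ω₂_nondegenerate]
  simp

theorem coordMat_transpose_mul (h : G) : (M.coordMat h)ᵀ * M.Ω * M.coordMat h = M.Ω := by
  have := congrArg (fun A => Matrix.map A (algebraMap ℝ ℂ)) (M.ρ_symplectic h⁻¹)
  simp only [Matrix.map_mul, Matrix.transpose_map] at this
  exact this

/-- Invariance of the inverse bivector is the inverse of the invariance of the symplectic form. -/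
theorem coordMat_P (h : G) : M.coordMat h * M.P * (M.coordMat h)ᵀ = M.P := by
  have e : (M.P * ((M.coordMat h)ᵀ * M.Ω)) * M.coordMat h = 1 := by
    rw [Matrix.mul_assoc, coordMat_transpose_mul, P_mul_Ω]
  -- A one-sided inverse of a square matrix is two-sided, which moves `coordMat h` from the right
  -- end of the product to the left.
  rw [mul_eq_one_comm] at e
  have e' : (M.coordMat h * M.P * (M.coordMat h)ᵀ) * M.Ω = 1 := by
    rw [← e]
    simp only [Matrix.mul_assoc]
  have e2 : M.Ω * M.P = 1 := _root_.mul_eq_one_comm.1 M.P_mul_Ω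
  calc _ = (M.coordMat h * M.P * (M.coordMat h)ᵀ) * (M.Ω * M.P) := by rw [e2, Matrix.mul_one]
    _ = _ := by rw [← Matrix.mul_assoc, e', Matrix.one_mul]

theorem coordMat_mul (h h' : G) : M.coordMat (h' * h) = M.coordMat h * M.coordMat h' := by
  rw [coordMat, mul_inv_rev, map_mul, Matrix.map_mul, coordMat, coordMat]

theorem coordMat_one : M.coordMat 1 = 1 := by
  simp [coordMat]

/-- The complexification of `gPerp`. -/
def gPerpC : Matrix (Fin (2 * l)) (Fin (2 * l)) ℂ := M.gPerp.map (algebraMap ℝ ℂ)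

theorem coordMat_g_inv : M.coordMat M.g⁻¹ = Matrix.fromBlocks 1 0 0 M.gPerpC := by
  rw [coordMat, inv_inv, ρ_g, Matrix.fromBlocks_map]
  simp [gPerpC]

/-- Functions are acted on through the inverse, so the given block form of `ρ g` describes `coordMat
g⁻¹`. The form of `coordMat g` follows by solving for the blocks of a two-sided inverse. -/
theorem coordMat_g : M.coordMat M.g = Matrix.fromBlocks 1 0 0 M.gz := by
  have h : M.coordMat M.g * M.coordMat M.g⁻¹ = 1 := by
    rw [← coordMat_mul, inv_mul_cancel, coordMat_one]
  have h' : M.coordMat M.g⁻¹ * M.coordMat M.g = 1 := _root_.mul_eq_one_comm.1 h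
  rw [coordMat_g_inv, ← Matrix.fromBlocks_toBlocks (M.coordMat M.g), Matrix.fromBlocks_multiply,
    ← Matrix.fromBlocks_one, Matrix.fromBlocks_inj] at h
  rw [coordMat_g_inv, ← Matrix.fromBlocks_toBlocks (M.coordMat M.g), Matrix.fromBlocks_multiply,
    ← Matrix.fromBlocks_one, Matrix.fromBlocks_inj] at h'
  simp only [Matrix.mul_one, Matrix.mul_zero, Matrix.zero_mul, Matrix.one_mul, add_zero,
    zero_add] at h h'
  rw [← Matrix.fromBlocks_toBlocks (M.coordMat M.g), h.1, h.2.2.1, h'.2.1]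
  rfl

theorem gz_mul_gPerpC : M.gz * M.gPerpC = 1 := by
  have h : M.coordMat M.g * M.coordMat M.g⁻¹ = 1 := by
    rw [← coordMat_mul, inv_mul_cancel, coordMat_one]
  rw [coordMat_g_inv, coordMat_g, Matrix.fromBlocks_multiply, ← Matrix.fromBlocks_one,
    Matrix.fromBlocks_inj] at h
  simpa using h.2.2.2

theorem gz_inv : M.gz⁻¹ = M.gPerpC := Matrix.inv_eq_right_inv M.gz_mul_gPerpC

/-- `gz⁻¹` is the complexification of the real matrix `gPerp`. A vanishing determinant would vanish
already over ℝ and produce a nonzero fixed vector. -/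
theorem isUnit_one_sub_gz_inv : IsUnit (1 - M.gz⁻¹).det := by
  have e : (1 : Matrix (Fin (2 * l)) (Fin (2 * l)) ℂ) - M.gz⁻¹ =
      (algebraMap ℝ ℂ).mapMatrix (1 - M.gPerp) := by
    rw [gz_inv, map_sub, map_one]
    rfl
  rw [e, ← RingHom.map_det]
  refine IsUnit.map _ (isUnit_iff_ne_zero.2 fun h => ?_)
  obtain ⟨v, hv, hv'⟩ := Matrix.exists_mulVec_eq_zero_iff.2 h
  refine hv (M.gPerp_fixed v ?_)
  rw [Matrix.sub_mulVec, Matrix.one_mulVec, sub_eq_zero] at hv'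
  exact hv'.symm

theorem gPerpC_P₂ : M.gPerpC * M.P₂ * M.gPerpCᵀ = M.P₂ := by
  have h := M.coordMat_P M.g⁻¹
  rw [coordMat_g_inv, P, Matrix.fromBlocks_transpose, Matrix.fromBlocks_multiply,
    Matrix.fromBlocks_multiply, Matrix.fromBlocks_inj] at h
  simpa using h.2.2.2

/-- The matrix `(1 - g⁻¹)⁻¹`. -/
def resolvent : Matrix (Fin (2 * l)) (Fin (2 * l)) ℂ := (1 - M.gz⁻¹)⁻¹

theorem resolvent_mul : M.resolvent * (1 - M.gPerpC) = 1 := by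
  rw [← gz_inv]
  exact Matrix.nonsing_inv_mul _ M.isUnit_one_sub_gz_inv

theorem mul_resolvent : (1 - M.gPerpC) * M.resolvent = 1 :=
  _root_.mul_eq_one_comm.1 M.resolvent_mul

theorem gPerpC_mul_resolvent : M.gPerpC * M.resolvent = M.resolvent - 1 := by
  rw [← M.mul_resolvent]
  noncomm_ring

/-- The `z`-block of the propagator of a self loop. -/
def loopZ : Matrix (Fin (2 * l)) (Fin (2 * l)) ℂ :=
  -(M.P₂ * M.resolventᵀ) + (1 / 2 : ℂ) • M.P₂

theorem loopProp_eq : M.loopProp = Matrix.fromBlocks 0 0 0 M.loopZ := by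
  have e : M.gz⁻¹ * (1 - M.gz⁻¹)⁻¹ = M.resolvent - 1 := by
    rw [← gPerpC_mul_resolvent, gz_inv, resolvent, gz_inv]
  rw [loopProp, e, loopZ]
  congr 1
  rw [Matrix.transpose_sub, Matrix.mul_sub, Matrix.transpose_one, Matrix.mul_one]
  module

/-- Line and loop propagators in the z directions differ by half the Poisson tensor. This lets a
common bivector describe both, the line needing in addition only the order sign. -/
theorem P₁₂_eq : M.P₁₂ = M.loopZ - (1 / 2 : ℂ) • M.P₂ := by
  rw [P₁₂, loopZ, resolvent]
  module

/-- Invariance of `P₂` gives `(1-g)P₂(1-g)ᵀ = P₂(1-g)ᵀ + (1-g)P₂`, with `g` standing for `gPerpC`;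
sandwich this between the resolvent and its transpose. The identity is equivalent to the symmetry of
the loop propagator. -/
theorem resolvent_P₂ : M.resolvent * M.P₂ + M.P₂ * M.resolventᵀ = M.P₂ := by
  have h1 := M.gPerpC_P₂
  have e : (1 - M.gPerpC) * M.P₂ * (1 - M.gPerpC)ᵀ =
      M.P₂ * (1 - M.gPerpC)ᵀ + (1 - M.gPerpC) * M.P₂ := by
    rw [Matrix.transpose_sub, Matrix.transpose_one]
    have : (1 - M.gPerpC) * M.P₂ * (1 - M.gPerpCᵀ) =
      M.P₂ * (1 - M.gPerpCᵀ) + (1 - M.gPerpC) * M.P₂ - M.P₂ + M.gPerpC * M.P₂ * M.gPerpCᵀ := by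
      noncomm_ring
    rw [this, h1, sub_add_cancel]
  have t : (1 - M.gPerpC)ᵀ * M.resolventᵀ = 1 := by
    rw [← Matrix.transpose_mul, resolvent_mul, Matrix.transpose_one]
  have e2 := congrArg (fun A => M.resolvent * A * M.resolventᵀ) e
  simp only [Matrix.mul_add, Matrix.add_mul] at e2
  have s1 : M.resolvent * ((1 - M.gPerpC) * M.P₂ * (1 - M.gPerpC)ᵀ) * M.resolventᵀ = M.P₂ := by
    calc _ = (M.resolvent * (1 - M.gPerpC)) * M.P₂ * ((1 - M.gPerpC)ᵀ * M.resolventᵀ) := by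
          simp only [Matrix.mul_assoc]
      _ = _ := by rw [resolvent_mul, t, Matrix.one_mul, Matrix.mul_one]
  have s2 : M.resolvent * (M.P₂ * (1 - M.gPerpC)ᵀ) * M.resolventᵀ = M.resolvent * M.P₂ := by
    rw [Matrix.mul_assoc, Matrix.mul_assoc, t, Matrix.mul_one]
  have s3 : M.resolvent * ((1 - M.gPerpC) * M.P₂) * M.resolventᵀ = M.P₂ * M.resolventᵀ := by
    rw [← Matrix.mul_assoc M.resolvent, resolvent_mul, Matrix.one_mul]
  rw [s1, s2, s3] at e2
  exact e2.symm

theorem loopZ_transpose : M.loopZᵀ = M.loopZ := by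
  rw [loopZ, Matrix.transpose_add, Matrix.transpose_neg, Matrix.transpose_mul,
    Matrix.transpose_transpose, Matrix.transpose_smul, P₂_transpose]
  have h : M.resolvent * M.P₂ = M.P₂ - M.P₂ * M.resolventᵀ := eq_sub_of_add_eq M.resolvent_P₂
  rw [Matrix.mul_neg, h]
  module

theorem loopProp_transpose : M.loopPropᵀ = M.loopProp := by
  rw [loopProp_eq, Matrix.fromBlocks_transpose, loopZ_transpose]
  simp

/-- The Poisson tensor in the directions `y`, on all coordinates. -/
def PY : Matrix (Idx k l) (Idx k l) ℂ := Matrix.fromBlocks M.P₁ 0 0 0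

theorem PY_transpose : M.PYᵀ = -M.PY := by
  rw [PY, Matrix.fromBlocks_transpose, P₁_transpose, Matrix.fromBlocks_neg]
  simp

/-- In the z block this says that `loopZ` is half the Cayley transform of g applied to `P₂`, namely
`(g - 1) loopZ = ½ (g + 1) P₂`. In the y block g is trivial, the loop vanishes, and the two halves
of the Poisson tensor cancel `PY`. -/
theorem coordMat_g_loopProp : M.coordMat M.g * M.loopProp = M.loopProp
    + (1 / 2 : ℂ) • (M.coordMat M.g * M.P) + (1 / 2 : ℂ) • M.P - M.PY := by
  have h1 : M.P₂ * M.gPerpCᵀ = M.gz * M.P₂ := by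
    have := congrArg (fun A => M.gz * A) M.gPerpC_P₂
    simp only [← Matrix.mul_assoc] at this
    rwa [gz_mul_gPerpC, Matrix.one_mul] at this
  have t : (1 - M.gPerpC)ᵀ * M.resolventᵀ = 1 := by
    rw [← Matrix.transpose_mul, resolvent_mul, Matrix.transpose_one]
  have h2 : M.P₂ - M.gz * M.P₂ = M.P₂ * (1 - M.gPerpC)ᵀ := by
    rw [Matrix.transpose_sub, Matrix.mul_sub, h1, Matrix.transpose_one, Matrix.mul_one]
  have h3 : M.gz * M.P₂ * M.resolventᵀ = M.P₂ * M.resolventᵀ - M.P₂ := by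
    have : M.P₂ * M.resolventᵀ - M.gz * M.P₂ * M.resolventᵀ = M.P₂ := by
      rw [← Matrix.sub_mul, h2, Matrix.mul_assoc, t, Matrix.mul_one]
    exact eq_sub_of_add_eq (by rw [← sub_eq_iff_eq_add'.1 this])
  have h4 : M.gz * M.loopZ = M.loopZ + (1 / 2 : ℂ) • (M.gz * M.P₂) + (1 / 2 : ℂ) • M.P₂ := by
    rw [loopZ, Matrix.mul_add, Matrix.mul_neg, ← Matrix.mul_assoc, h3, Matrix.mul_smul]
    module
  rw [loopProp_eq, coordMat_g, P, PY, Matrix.fromBlocks_multiply, Matrix.fromBlocks_multiply,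
    Matrix.fromBlocks_smul, Matrix.fromBlocks_smul, Matrix.fromBlocks_add, Matrix.fromBlocks_add,
    sub_eq_add_neg, Matrix.fromBlocks_neg, Matrix.fromBlocks_add]
  simp only [Matrix.zero_mul, Matrix.mul_zero, Matrix.one_mul, add_zero, zero_add, smul_zero,
    neg_zero, h4]
  congr 1
  module

theorem coordMat_g_PY : M.coordMat M.g * M.PY = M.PY := by
  rw [coordMat_g, PY, Matrix.fromBlocks_multiply]
  simp

theorem PY_coordMat_g : M.PY * (M.coordMat M.g)ᵀ = M.PY := by
  rw [coordMat_g, PY, Matrix.fromBlocks_transpose, Matrix.fromBlocks_multiply]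
  simp

/-! ### Invariance of the bivectors under the centralizer -/

section Centralizer

variable {h : G} (hh : h ∈ Subgroup.centralizer {M.g})
include hh

theorem coordMat_comm : M.coordMat h * M.coordMat M.g⁻¹ = M.coordMat M.g⁻¹ * M.coordMat h := by
  have e : M.g * h = h * M.g := Subgroup.mem_centralizer_singleton_iff.1 hh |>.symm
  have e' : M.g⁻¹ * h = h * M.g⁻¹ := by
    rw [inv_mul_eq_iff_eq_mul, ← mul_assoc, e, mul_assoc, mul_inv_cancel, mul_one]
  rw [← coordMat_mul, ← coordMat_mul, e']

/-- Commuting with g forces an off-diagonal block to be annihilated by `1 - gPerpC` on one side, and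
that matrix is invertible. -/
theorem coordMat_blocks : M.coordMat h =
    Matrix.fromBlocks (M.coordMat h).toBlocks₁₁ 0 0 (M.coordMat h).toBlocks₂₂ ∧
    (M.coordMat h).toBlocks₂₂ * M.gPerpC = M.gPerpC * (M.coordMat h).toBlocks₂₂ := by
  have e := M.coordMat_comm hh
  rw [coordMat_g_inv, ← Matrix.fromBlocks_toBlocks (M.coordMat h), Matrix.fromBlocks_multiply,
    Matrix.fromBlocks_multiply, Matrix.fromBlocks_inj] at e
  simp only [Matrix.mul_one, Matrix.mul_zero, Matrix.zero_mul, Matrix.one_mul, add_zero,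
    zero_add, true_and] at e
  obtain ⟨e1, e2, e3⟩ := e
  have h1 : (M.coordMat h).toBlocks₁₂ = 0 := by
    have : (M.coordMat h).toBlocks₁₂ * (1 - M.gPerpC) = 0 := by
      rw [Matrix.mul_sub, e1, Matrix.mul_one, sub_self]
    rw [← Matrix.mul_one (M.coordMat h).toBlocks₁₂, ← M.mul_resolvent, ← Matrix.mul_assoc, this,
      Matrix.zero_mul]
  have h2 : (M.coordMat h).toBlocks₂₁ = 0 := by
    have : (1 - M.gPerpC) * (M.coordMat h).toBlocks₂₁ = 0 := by
      rw [Matrix.sub_mul, ← e2, Matrix.one_mul, sub_self]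
    rw [← Matrix.one_mul (M.coordMat h).toBlocks₂₁, ← M.resolvent_mul, Matrix.mul_assoc, this,
      Matrix.mul_zero]
  refine ⟨?_, e3⟩
  conv_lhs => rw [← Matrix.fromBlocks_toBlocks (M.coordMat h), h1, h2]

theorem coordMat_blocks_P : (M.coordMat h).toBlocks₁₁ * M.P₁ * (M.coordMat h).toBlocks₁₁ᵀ = M.P₁ ∧
    (M.coordMat h).toBlocks₂₂ * M.P₂ * (M.coordMat h).toBlocks₂₂ᵀ = M.P₂ := by
  have e := M.coordMat_P h
  rw [(M.coordMat_blocks hh).1, P, Matrix.fromBlocks_transpose, Matrix.fromBlocks_multiply,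
    Matrix.fromBlocks_multiply, Matrix.fromBlocks_inj] at e
  simpa using And.intro e.1 e.2.2.2

theorem coordMat_PY : M.coordMat h * M.PY * (M.coordMat h)ᵀ = M.PY := by
  rw [(M.coordMat_blocks hh).1, PY, Matrix.fromBlocks_transpose, Matrix.fromBlocks_multiply,
    Matrix.fromBlocks_multiply]
  simp [(M.coordMat_blocks_P hh).1]

/-- The z block of `h` commutes with g, hence with the resolvent, and preserves `P₂`; the loop
propagator is built from these two. -/
theorem coordMat_loopProp : M.coordMat h * M.loopProp * (M.coordMat h)ᵀ = M.loopProp := by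
  set C := (M.coordMat h).toBlocks₂₂ with hC
  have e3 := (M.coordMat_blocks hh).2
  rw [← hC] at e3
  have hr : C * M.resolvent = M.resolvent * C := by
    have e : C * (1 - M.gPerpC) = (1 - M.gPerpC) * C := by
      rw [Matrix.mul_sub, Matrix.sub_mul, e3, Matrix.one_mul, Matrix.mul_one]
    calc C * M.resolvent = M.resolvent * (1 - M.gPerpC) * C * M.resolvent := by
          rw [resolvent_mul, Matrix.one_mul]
      _ = M.resolvent * (C * (1 - M.gPerpC)) * M.resolvent := by rw [e, Matrix.mul_assoc _ _ C]
      _ = _ := by rw [Matrix.mul_assoc, Matrix.mul_assoc C, mul_resolvent, Matrix.mul_one]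
  have hP := (M.coordMat_blocks_P hh).2
  rw [← hC] at hP
  have hz : C * M.loopZ * Cᵀ = M.loopZ := by
    rw [loopZ, Matrix.mul_add, Matrix.add_mul, Matrix.mul_smul, Matrix.smul_mul, hP, Matrix.mul_neg,
      Matrix.neg_mul]
    congr 2
    rw [Matrix.mul_assoc, Matrix.mul_assoc, ← Matrix.transpose_mul, hr, Matrix.transpose_mul,
      ← Matrix.mul_assoc, ← Matrix.mul_assoc, hP]
  rw [(M.coordMat_blocks hh).1, ← hC, loopProp_eq, Matrix.fromBlocks_transpose,
    Matrix.fromBlocks_multiply, Matrix.fromBlocks_multiply]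
  simp [hz]

end Centralizer

end Matrices

end TwistedSector

/-! ### Dependence of exponentials of symbols on real parameters -/

section Smoothness

variable {R : Type*} [CommRing R] [Algebra ℂ R]

/-- The ring carries no topology, so differentiability is tested through an arbitrary linear
functional. In the induction one factor is absorbed into the functional, which is why `Ψ` must be
general. -/
theorem hasDerivAt_pow_succ (A B : R) (n : ℕ) (Ψ : R →ₗ[ℂ] ℂ) (t : ℝ) :
    HasDerivAt (fun t : ℝ => Ψ ((A + (t : ℂ) • B) ^ (n + 1)))
      ((n + 1 : ℂ) * Ψ ((A + (t : ℂ) • B) ^ n * B)) t := by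
  have hid : HasDerivAt (fun t : ℝ => (t : ℂ)) 1 t := Complex.ofRealCLM.hasDerivAt
  induction n generalizing Ψ with
  | zero =>
    have h := (hid.mul_const (Ψ B)).const_add (Ψ A)
    simpa using h
  | succ n ih =>
    have h := (ih (Ψ ∘ₗ LinearMap.mulRight ℂ A)).add
      (hid.mul (ih (Ψ ∘ₗ LinearMap.mulRight ℂ B)))
    refine (h.congr_deriv ?_).congr_of_eventuallyEq (.of_forall fun t => ?_)
    · simp only [LinearMap.comp_apply, LinearMap.mulRight_apply]
      have e : (A + (t : ℂ) • B) ^ (n + 1) * B =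
          (A + (t : ℂ) • B) ^ n * B * A + (t : ℂ) • ((A + (t : ℂ) • B) ^ n * B * B) := by
        simp only [Algebra.smul_def]; ring
      rw [e, map_add, map_smul, smul_eq_mul]
      push_cast
      ring
    · simp only [LinearMap.comp_apply, LinearMap.mulRight_apply, Pi.add_apply, Pi.mul_apply]
      rw [pow_succ, mul_add, mul_smul_comm, map_add, map_smul, smul_eq_mul]

theorem continuous_pow_affine {N : ℕ} (A : R) (B : Fin N → R) (n : ℕ) (Ψ : R →ₗ[ℂ] ℂ) :
    Continuous fun θ : Fin N → ℝ => Ψ ((A + ∑ α, (θ α : ℂ) • B α) ^ n) := by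
  induction n generalizing Ψ with
  | zero => simpa using continuous_const
  | succ n ih =>
    have e : ∀ θ : Fin N → ℝ, Ψ ((A + ∑ α, (θ α : ℂ) • B α) ^ (n + 1)) =
        (Ψ ∘ₗ LinearMap.mulRight ℂ A) ((A + ∑ α, (θ α : ℂ) • B α) ^ n) + ∑ α, (θ α : ℂ) *
          (Ψ ∘ₗ LinearMap.mulRight ℂ (B α)) ((A + ∑ α, (θ α : ℂ) • B α) ^ n) := fun θ => by
      rw [pow_succ, mul_add, map_add, Finset.mul_sum, map_sum]
      simp only [mul_smul_comm, map_smul, smul_eq_mul]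
      rfl
    simp only [e]
    exact (ih _).add (continuous_finsetSum _ fun α _ =>
      (Complex.continuous_ofReal.comp (continuous_apply α)).mul (ih _))

variable {σ : Type} [Fintype σ]

theorem lpair_mul_eq_sum (F : Laur σ) (N : ℤ) (E P : PowerSeries (MvPolynomial σ ℂ)) {K : ℕ}
    (hK : ∀ n : ℕ, K ≤ n → F.coeff (N - n) = 0) :
    lpair F N (E * P) = ∑ M ∈ Finset.range K, ∑ x ∈ Finset.HasAntidiagonal.antidiagonal M,
      pair (F.coeff (N - M)) (PowerSeries.coeff x.1 E * PowerSeries.coeff x.2 P) := by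
  rw [lpair_eq_sum F N _ hK]
  refine Finset.sum_congr rfl fun M _ => ?_
  rw [PowerSeries.coeff_mul, map_sum]

theorem hasDerivAt_lpair_symbolExp (F : Laur σ) (N : ℤ) (A B : MvPolynomial σ ℂ)
    (P : PowerSeries (MvPolynomial σ ℂ)) (t : ℝ) :
    HasDerivAt (fun t : ℝ => lpair F N (symbolExp (A + (t : ℂ) • B) * P))
      (lpair F N (PowerSeries.X * PowerSeries.C B * symbolExp (A + (t : ℂ) • B) * P)) t := by
  obtain ⟨K, hK⟩ := exists_coeff_bound F N
  simp only [lpair_mul_eq_sum F N _ _ hK]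
  refine HasDerivAt.fun_sum fun M _ => HasDerivAt.fun_sum fun x _ => ?_
  generalize F.coeff (N - M) = f
  obtain ⟨n, n'⟩ := x
  dsimp only
  rcases n with _ | n
  -- The term of order 0 in the exponential does not depend on `t`; on the other side it is killed
  -- by the factor ħ.
  · rw [mul_assoc, PowerSeries.coeff_zero_X_mul, zero_mul, map_zero]
    simp only [coeff_symbolExp, pow_zero]
    exact hasDerivAt_const _ _
  · rw [mul_assoc PowerSeries.X, PowerSeries.coeff_succ_X_mul, PowerSeries.coeff_C_mul,
      coeff_symbolExp]
    simp only [coeff_symbolExp]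
    have h := (hasDerivAt_pow_succ A B n
      (pair f ∘ₗ LinearMap.mulRight ℂ (PowerSeries.coeff n' P)) t).const_mul
        (((n + 1).factorial : ℂ)⁻¹)
    refine (h.congr_deriv ?_).congr_of_eventuallyEq (.of_forall fun t => ?_)
    · simp only [LinearMap.comp_apply, LinearMap.mulRight_apply]
      rw [mul_smul_comm, smul_mul_assoc, map_smul, smul_eq_mul, ← mul_assoc, Nat.factorial_succ,
        mul_comm B]
      congr 1
      have : (n + 1 : ℂ) ≠ 0 := by exact_mod_cast Nat.succ_ne_zero n
      push_cast
      field_simp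
    · simp only [LinearMap.comp_apply, LinearMap.mulRight_apply]
      rw [smul_mul_assoc, map_smul, smul_eq_mul]

theorem continuous_lpair_symbolExp {n : ℕ} (F : Laur σ) (N : ℤ) (A : MvPolynomial σ ℂ)
    (B : Fin n → MvPolynomial σ ℂ) (P : PowerSeries (MvPolynomial σ ℂ)) :
    Continuous fun θ : Fin n → ℝ => lpair F N (symbolExp (A + ∑ α, (θ α : ℂ) • B α) * P) := by
  obtain ⟨K, hK⟩ := exists_coeff_bound F N
  simp only [lpair_mul_eq_sum F N _ _ hK, coeff_symbolExp]
  refine continuous_finsetSum _ fun M _ => continuous_finsetSum _ fun x _ => ?_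
  simp only [smul_mul_assoc, map_smul, smul_eq_mul]
  exact continuous_const.mul (continuous_pow_affine A B x.1
    (pair (F.coeff (N - M)) ∘ₗ LinearMap.mulRight ℂ (PowerSeries.coeff x.2 P)))

theorem lpair_X_mul (F : Laur σ) (N : ℤ) (P : PowerSeries (MvPolynomial σ ℂ)) :
    lpair F N (PowerSeries.X * P) = lpair F (N - 1) P := by
  obtain ⟨K, hK⟩ := exists_coeff_bound F N
  rw [lpair_eq_sum F N _ (K := K + 1) fun n hn => hK n (by omega), Finset.sum_range_succ',
    lpair_eq_sum F (N - 1) _ (K := K) fun n hn => by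
      rw [show N - 1 - n = N - (n + 1 : ℕ) by push_cast; ring]; exact hK _ (by omega)]
  simp only [PowerSeries.coeff_succ_X_mul, PowerSeries.coeff_zero_X_mul, map_zero, add_zero]
  exact Finset.sum_congr rfl fun n _ => by
    rw [show N - 1 - n = N - (n + 1 : ℕ) by push_cast; ring]

theorem pair_eq_sum (F : PS σ) (p : MvPolynomial σ ℂ) :
    pair F p = ∑ ν ∈ p.support,
      MvPolynomial.coeff ν p * (multiFactorial ν * MvPowerSeries.coeff ν F) := by
  conv_lhs => rw [p.as_sum, map_sum]
  refine Finset.sum_congr rfl fun ν _ => ?_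
  have e : MvPolynomial.monomial ν (MvPolynomial.coeff ν p) =
      MvPolynomial.coeff ν p • MvPolynomial.monomial ν (1 : ℂ) := by
    rw [MvPolynomial.smul_monomial, smul_eq_mul, mul_one]
  rw [e, map_smul, pair_monomial, smul_eq_mul]

end Smoothness

/-- The symbols `∂_i^{(α)}`. -/
def symVar (N : ℕ) (σ : Type) (α : Fin N) (i : σ) : MvPolynomial (Fin N × σ) ℂ :=
  MvPolynomial.X (α, i)

open Classical in
/-- `1` if `α` comes after `β`, and `-1` if `α` comes before `β`. -/
def orderSign {m : ℕ} (α β : Fin (m + 1)) : ℂ :=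
  if α = β then 0 else if TwistedSector.isAfter α β then 1 else -1

/-- On distinct labels `isAfter` is the strict total order in which 0 comes last. -/
theorem isAfter_swap {m : ℕ} {α β : Fin (m + 1)} (h : α ≠ β) :
    TwistedSector.isAfter β α ↔ ¬ TwistedSector.isAfter α β := by
  unfold TwistedSector.isAfter
  rcases eq_or_ne α 0 with rfl | hα
  · simp [h.symm]
  · rcases eq_or_ne β 0 with rfl | hβ
    · simp [hα]
    · simp only [ne_eq, hα, not_false_eq_true, hβ, false_or, true_and, not_lt]
      exact ⟨fun h => h.le, fun h' => lt_of_le_of_ne h' h⟩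

theorem orderSign_swap {m : ℕ} (α β : Fin (m + 1)) : orderSign β α = -orderSign α β := by
  unfold orderSign
  by_cases h : α = β
  · simp [h]
  · rw [if_neg h, if_neg (Ne.symm h)]
    by_cases h' : TwistedSector.isAfter α β
    · rw [if_neg (by rw [isAfter_swap h]; exact not_not.2 h'), if_pos h']
    · rw [if_pos ((isAfter_swap h).2 h'), if_neg h', neg_neg]

namespace TwistedSector

/-! ### The correlation map as an integral of one exponential -/

section Kernel

variable {k l r : ℕ} {G : Type*} [Group G] (M : TwistedSector k l r G)

/-- The symbol of `∂_{P₁}`. -/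
def lineSym {m : ℕ} (θ : Fin (m + 1) → ℝ) : MvPolynomial (Fin (m + 1) × Idx k l) ℂ :=
  (1 / 2 : ℂ) • ∑ α, ∑ β, if α = β then 0 else
    bil _ (M.prop₁ θ α β) (symVar _ _ α) (symVar _ _ β)

/-- The symbol of `∂_{P₂}`. -/
def loopSym (m : ℕ) : MvPolynomial (Fin (m + 1) × Idx k l) ℂ :=
  (1 / 2 : ℂ) • ∑ α, bil _ M.loopProp (symVar _ _ α) (symVar _ _ α)

/-- The symbol of `∂_{P₁} + ∂_{P₂}`. -/
def corrQuad {m : ℕ} (θ : Fin (m + 1) → ℝ) : MvPolynomial (Fin (m + 1) × Idx k l) ℂ :=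
  quad (bil _ M.PY) (bil _ M.loopProp) (bil _ M.P) θ orderSign (symVar _ _)

theorem hasSymbol_lineOp {m : ℕ} (θ : Fin (m + 1) → ℝ) :
    HasSymbol (M.lineOp θ) (M.lineSym θ) := by
  refine (HasSymbol.sum _ fun α _ => HasSymbol.sum _ fun β _ => ?_).smul _
  split_ifs
  · exact HasSymbol.zero
  · exact HasSymbol.sum _ fun i _ => HasSymbol.sum _ fun j _ =>
      ((hasSymbol_pd _).comp (hasSymbol_pd _)).smul _

theorem hasSymbol_loopOp (m : ℕ) : HasSymbol (M.loopOp m) (M.loopSym m) :=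
  (HasSymbol.sum _ fun _ _ => HasSymbol.sum _ fun _ _ => HasSymbol.sum _ fun _ _ =>
    ((hasSymbol_pd _).comp (hasSymbol_pd _)).smul _).smul _

theorem PY_skew {R : Type*} [CommRing R] [Algebra ℂ R] (x y : Idx k l → R) :
    bil R M.PY x y = -bil R M.PY y x := by
  rw [bil_swap, PY_transpose, bil_neg]

theorem P_skew {R : Type*} [CommRing R] [Algebra ℂ R] (x y : Idx k l → R) :
    bil R M.P x y = -bil R M.P y x := by
  rw [bil_swap, P_transpose, bil_neg]

theorem loopProp_symm {R : Type*} [CommRing R] [Algebra ℂ R] (x y : Idx k l → R) :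
    bil R M.loopProp x y = bil R M.loopProp y x := by
  rw [bil_swap, loopProp_transpose]

theorem lineProp_eq (s : ℝ) :
    M.lineProp s = (s : ℂ) • M.PY + M.loopProp - (1 / 2 : ℂ) • M.P := by
  rw [lineProp, P₁₂_eq, PY, P, loopProp_eq]
  ext (i | i) (j | j) <;> simp [sub_mul]

/-- `PY` and `P` are skew and the loop propagator is symmetric, so transposing the propagator flips
the difference of the points and the order sign together. One formula covers both branches of the
definition. -/
theorem prop₁_eq {m : ℕ} (θ : Fin (m + 1) → ℝ) {α β : Fin (m + 1)} (h : α ≠ β) :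
    M.prop₁ θ α β = ((θ α - θ β : ℝ) : ℂ) • M.PY + M.loopProp
      - ((1 / 2 : ℂ) * orderSign α β) • M.P := by
  unfold prop₁ orderSign
  rw [if_neg h]
  split_ifs
  · rw [lineProp_eq, mul_one]
  · rw [lineProp_eq, Matrix.transpose_sub, Matrix.transpose_add, Matrix.transpose_smul,
      Matrix.transpose_smul, PY_transpose, loopProp_transpose, P_transpose]
    push_cast
    module

/-- The lines omit the diagonal of the double sum and the self loops fill it in, so the symmetric
part becomes a function of the total vector alone. -/
theorem lineSym_add_loopSym {m : ℕ} (θ : Fin (m + 1) → ℝ) :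
    M.lineSym θ + M.loopSym m = M.corrQuad θ := by
  set X := symVar (m + 1) (Idx k l)
  have e1 : M.lineSym θ + M.loopSym m = (1 / 2 : ℂ) • ∑ α, ∑ β,
      ((((θ α - θ β : ℝ) : ℂ) • bil _ M.PY (X α) (X β) + bil _ M.loopProp (X α) (X β))
        - ((1 / 2 : ℂ) * orderSign α β) • bil _ M.P (X α) (X β)) := by
    rw [lineSym, loopSym, ← smul_add, ← Finset.sum_add_distrib]
    congr 1
    refine Finset.sum_congr rfl fun α _ => ?_
    -- A self loop is the term β = α; on the diagonal the two other parts of the propagator vanish.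
    have e : bil _ M.loopProp (X α) (X α) =
        ∑ β, if α = β then bil _ M.loopProp (X α) (X β) else 0 := by simp
    rw [e, ← Finset.sum_add_distrib]
    refine Finset.sum_congr rfl fun β _ => ?_
    by_cases h : α = β
    · subst h
      simp [orderSign]
    · rw [if_neg h, if_neg h, add_zero, M.prop₁_eq θ h, bil_sub, bil_add, bil_smul, bil_smul]
  have hs : ∀ (b : (Idx k l → MvPolynomial (Fin (m + 1) × Idx k l) ℂ) →ₗ[ℂ]
      (Idx k l → MvPolynomial (Fin (m + 1) × Idx k l) ℂ) →ₗ[ℂ]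
      MvPolynomial (Fin (m + 1) × Idx k l) ℂ),
      ∑ α, ∑ β, b (X α) (X β) = b (∑ α, X α) (∑ α, X α) := fun b => by
    rw [LinearMap.map_sum₂]
    exact Finset.sum_congr rfl fun α _ => (map_sum _ _ _).symm
  -- By skewness of `PY` the terms with `θ α` and with `-θ β` contribute equally.
  have e2 : ∑ α, ∑ β, ((θ α - θ β : ℝ) : ℂ) • bil _ M.PY (X α) (X β) =
      (2 : ℂ) • ∑ α, (θ α : ℂ) • bil _ M.PY (X α) (∑ β, X β) := by
    have e3 : ∑ α, ∑ β, (θ β : ℂ) • bil _ M.PY (X α) (X β) =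
        -∑ α, (θ α : ℂ) • bil _ M.PY (X α) (∑ β, X β) := by
      rw [Finset.sum_comm, ← Finset.sum_neg_distrib]
      refine Finset.sum_congr rfl fun α _ => ?_
      rw [map_sum, ← Finset.smul_sum, ← smul_neg, ← Finset.sum_neg_distrib]
      congr 1
      exact Finset.sum_congr rfl fun β _ => M.PY_skew _ _
    have e4 : ∑ α, ∑ β, (θ α : ℂ) • bil _ M.PY (X α) (X β) =
        ∑ α, (θ α : ℂ) • bil _ M.PY (X α) (∑ β, X β) := by
      refine Finset.sum_congr rfl fun α _ => ?_
      rw [map_sum, Finset.smul_sum]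
    push_cast
    simp only [sub_smul, Finset.sum_sub_distrib]
    rw [e3, e4, two_smul, sub_neg_eq_add]
  rw [e1]
  simp only [Finset.sum_sub_distrib, Finset.sum_add_distrib, e2, hs, mul_smul, ← Finset.smul_sum]
  unfold corrQuad quad
  module

theorem corrQuad_eq_affine {m : ℕ} (θ : Fin (m + 1) → ℝ) :
    M.corrQuad θ = M.corrQuad (fun _ : Fin (m + 1) => 0) + ∑ α, (θ α : ℂ) •
      bil _ M.PY (symVar _ _ α) (∑ β, symVar _ _ β) := by
  unfold corrQuad quad
  simp only [Complex.ofReal_zero, zero_smul, Finset.sum_const_zero]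
  module

theorem continuous_lpair_corrQuad {m : ℕ} (F : Laur (Fin (m + 1) × Idx k l)) (N : ℤ)
    (P : PowerSeries (MvPolynomial (Fin (m + 1) × Idx k l) ℂ)) :
    Continuous fun θ : Fin (m + 1) → ℝ => lpair F N (symbolExp (M.corrQuad θ) * P) := by
  refine (continuous_lpair_symbolExp F N (M.corrQuad fun _ : Fin (m + 1) => 0) (fun α =>
    bil _ M.PY (symVar _ _ α) (∑ β, symVar _ _ β)) P).congr fun θ => ?_
  rw [M.corrQuad_eq_affine θ]

theorem corrQuad_update {m : ℕ} (θ : Fin (m + 1) → ℝ) (a : Fin (m + 1)) (t : ℝ) :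
    M.corrQuad (Function.update θ a t) = M.corrQuad (Function.update θ a 0) + (t : ℂ) •
      bil _ M.PY (symVar _ _ a) (∑ β, symVar _ _ β) := by
  rw [corrQuad_eq_affine, M.corrQuad_eq_affine (Function.update θ a 0), add_assoc]
  congr 1
  rw [← Finset.add_sum_erase _ _ (Finset.mem_univ a),
    ← Finset.add_sum_erase Finset.univ (fun α => ((Function.update θ a 0 α : ℝ) : ℂ) •
      bil _ M.PY (symVar _ _ α) (∑ β, symVar (m + 1) (Idx k l) β)) (Finset.mem_univ a)]
  simp only [Function.update_self, Complex.ofReal_zero, zero_smul, zero_add]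
  refine (add_comm _ _).trans (congrArg (· + _) (Finset.sum_congr rfl fun b hb => ?_))
  rw [Function.update_of_ne (Finset.ne_of_mem_erase hb),
    Function.update_of_ne (Finset.ne_of_mem_erase hb)]

theorem hasDerivAt_lpair_corrQuad {m : ℕ} (F : Laur (Fin (m + 1) × Idx k l)) (N : ℤ)
    (P : PowerSeries (MvPolynomial (Fin (m + 1) × Idx k l) ℂ)) (θ : Fin (m + 1) → ℝ)
    (a : Fin (m + 1)) (t : ℝ) :
    HasDerivAt (fun t => lpair F N (symbolExp (M.corrQuad (Function.update θ a t)) * P))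
      (lpair F N (PowerSeries.X * PowerSeries.C
        (bil _ M.PY (symVar _ _ a) (∑ β, symVar _ _ β)) *
        symbolExp (M.corrQuad (Function.update θ a t)) * P)) t := by
  refine ((hasDerivAt_lpair_symbolExp F N (M.corrQuad (Function.update θ a 0))
    (bil _ M.PY (symVar _ _ a) (∑ β, symVar _ _ β)) P t).congr_deriv ?_).congr_of_eventuallyEq
      (.of_forall fun t => ?_)
  · rw [← corrQuad_update]
  · dsimp only
    rw [← corrQuad_update]

-- Pairing with a polynomial involves finitely many coefficients, and `intLineOp` integrates
-- coefficient by coefficient, so the integral can be taken out of the pairing. Integrability is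
-- recorded as well, for the finite sums over powers of ħ.
open MeasureTheory in
theorem pair_intLineOp (m n : ℕ) (f : PS (Fin (m + 1) × Idx k l))
    (p : MvPolynomial (Fin (m + 1) × Idx k l) ℂ) :
    IntegrableOn (fun θ => pair f (((n.factorial : ℂ)⁻¹ • M.lineSym θ ^ n) * p)) (cyc m) ∧
    pair (M.intLineOp m n f) p =
      ∫ θ in cyc m, pair f (((n.factorial : ℂ)⁻¹ • M.lineSym θ ^ n) * p) := by
  have e : ∀ θ : Fin (m + 1) → ℝ, pair f (((n.factorial : ℂ)⁻¹ • M.lineSym θ ^ n) * p) =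
      ∑ ν ∈ p.support, MvPolynomial.coeff ν p * (multiFactorial ν *
        ((n.factorial : ℂ)⁻¹ * MvPowerSeries.coeff ν ((M.lineOp θ ^ n) f))) := fun θ => by
    rw [← (((M.hasSymbol_lineOp θ).pow n).smul _) f p, pair_eq_sum]
    rfl
  have hi : ∀ ν, IntegrableOn (fun θ : Fin (m + 1) → ℝ => MvPolynomial.coeff ν p *
      (multiFactorial ν * ((n.factorial : ℂ)⁻¹ *
        MvPowerSeries.coeff ν ((M.lineOp θ ^ n) f)))) (cyc m) := fun ν =>
    (continuous_const.mul (continuous_const.mul (continuous_const.mul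
      (M.continuous_coeff_lineOp_pow n f ν)))).continuousOn.integrableOn_compact (isCompact_cyc m)
  simp only [e]
  refine ⟨integrable_finsetSum _ fun ν _ => hi ν, ?_⟩
  rw [integral_finsetSum _ fun ν _ => hi ν, pair_eq_sum]
  refine Finset.sum_congr rfl fun ν _ => ?_
  rw [integral_const_mul, integral_const_mul]
  rfl

open MeasureTheory in
theorem lpair_intLineOp (m : ℕ) (F : Laur (Fin (m + 1) × Idx k l)) (N : ℤ)
    (P : PowerSeries (MvPolynomial (Fin (m + 1) × Idx k l) ℂ)) :
    lpair (hbarSeries (M.intLineOp m) F) N P =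
      ∫ θ in cyc m, lpair F N (symbolExp (M.lineSym θ) * P) := by
  obtain ⟨K, hK⟩ := exists_coeff_bound F N
  rw [lpair_hbarSeries_eq_sum _ F N P hK]
  simp only [lpair_mul_eq_sum F N _ P hK, coeff_symbolExp]
  have hi : ∀ (n : ℕ) (x : ℕ × ℕ), Integrable (fun θ : Fin (m + 1) → ℝ => pair (F.coeff (N - n))
      (((x.1.factorial : ℂ)⁻¹ • M.lineSym θ ^ x.1) * PowerSeries.coeff x.2 P))
      (volume.restrict (cyc m)) := fun n x => (M.pair_intLineOp m x.1 _ _).1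
  rw [integral_finsetSum _ fun n _ => integrable_finsetSum _ fun x _ => hi n x]
  refine Finset.sum_congr rfl fun n _ => ?_
  rw [integral_finsetSum _ fun x _ => hi n x]
  exact Finset.sum_congr rfl fun x _ => (M.pair_intLineOp m x.1 _ _).2

/-- The transpose of the multiplication of all factors followed by `z ↦ 0`. -/
def totalSym (k l m : ℕ) :
    MvPolynomial (Fin (2 * k)) ℂ →ₐ[ℂ] MvPolynomial (Fin (m + 1) × Idx k l) ℂ :=
  (dualRename Prod.snd).comp (MvPolynomial.rename Function.Embedding.inl)

theorem totalSym_X {m : ℕ} (i : Fin (2 * k)) :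
    totalSym k l m (MvPolynomial.X i) = ∑ α, MvPolynomial.X (α, Sum.inl i) := by
  classical
  rw [totalSym, AlgHom.comp_apply, MvPolynomial.rename_X, dualRename, MvPolynomial.aeval_X,
    Fintype.sum_prod_type]
  refine Finset.sum_congr rfl fun α _ => ?_
  rw [Finset.sum_eq_single (Sum.inl i)]
  · simp
  · intro t _ ht
    exact if_neg ht
  · simp

theorem hasTranspose_totalSym (k l m : ℕ) :
    HasTranspose ((symbolZ (k := k) (l := l)).toLinearMap ∘ₗ
      (multMap (m + 1) (Idx k l)).toLinearMap) (totalSym k l m) :=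
  (hasTranspose_killCompl _).comp (hasTranspose_rename _)

-- The formula on which all later computations rest. Symbols commute, so the line and loop
-- exponentials merge into a single one, and multiplication followed by setting z to 0 acts only on
-- the test symbol.
open MeasureTheory in
theorem lpair_kernel (m : ℕ) (f : Fin (m + 1) → Laur (Idx k l)) (N : ℤ)
    (p : MvPolynomial (Fin (2 * k)) ℂ) :
    lpair (M.kernel m f) N (PowerSeries.C p) = ((1 - M.gz⁻¹).det)⁻¹ * ∫ θ in cyc m,
      lpair (extProd (m + 1) (Idx k l) f) N
        (symbolExp (M.corrQuad θ) * PowerSeries.C (totalSym k l m p)) := by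
  have e : M.kernel m f = ((1 - M.gz⁻¹).det)⁻¹ •
      mapCoeff (symbolZ.toLinearMap ∘ₗ (multMap (m + 1) (Idx k l)).toLinearMap)
        (hbarSeries (M.intLineOp m) (hbarExp (M.loopOp m) (extProd (m + 1) (Idx k l) f))) := rfl
  rw [e, lpair_smul_left, lpair_mapCoeff (hasTranspose_totalSym k l m), lpair_intLineOp]
  refine congrArg (fun h : (Fin (m + 1) → ℝ) → ℂ => ((1 - M.gz⁻¹).det)⁻¹ * ∫ θ in cyc m, h θ)
    (funext fun θ => ?_)
  rw [lpair_hbarExp (M.hasSymbol_loopOp m), ← mul_assoc, ← symbolExp_add, add_comm (M.loopSym m),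
    lineSym_add_loopSym, PowerSeries.map_C]
  rfl

/-- The factors `f₀, ∂_{y^{I₁}} f₁, …, ∂_{y^{I_m}} f_m`. -/
def scalarSlot {m : ℕ} (I : Fin m → Fin (2 * k)) (f : Fin (m + 1) → Laur (Idx k l)) :
    Fin (m + 1) → Laur (Idx k l) :=
  Fin.cons (f 0) fun α => mapCoeff (pd (Sum.inl (I α))) (f α.succ)

/-- The symbol `∏ ∂_{y^{I_α}}^{(α)}`. -/
def slotSym (l : ℕ) {m : ℕ} (I : Fin m → Fin (2 * k)) :
    MvPolynomial (Fin (m + 1) × Idx k l) ℂ :=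
  ∏ α, MvPolynomial.X (α.succ, Sum.inl (I α))

theorem lpair_extProd_scalarSlot {m : ℕ} (I : Fin m → Fin (2 * k))
    (f : Fin (m + 1) → Laur (Idx k l)) (N : ℤ)
    (P : PowerSeries (MvPolynomial (Fin (m + 1) × Idx k l) ℂ)) :
    lpair (extProd (m + 1) (Idx k l) (scalarSlot I f)) N P =
      lpair (extProd (m + 1) (Idx k l) f) N (PowerSeries.C (slotSym l I) * P) := by
  classical
  -- Induction over the set of slots already differentiated: each new slot costs one variable in the
  -- symbol.
  have key : ∀ S : Finset (Fin m), ∀ P, lpair (extProd (m + 1) (Idx k l) (Fin.cons (f 0) fun α =>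
      if α ∈ S then mapCoeff (pd (Sum.inl (I α))) (f α.succ) else f α.succ)) N P =
      lpair (extProd (m + 1) (Idx k l) f) N
        (PowerSeries.C (∏ α ∈ S, MvPolynomial.X (α.succ, Sum.inl (I α))) * P) := by
    intro S
    induction S using Finset.induction_on with
    | empty =>
      intro P
      have : (Fin.cons (f 0) fun α : Fin m => f α.succ : Fin (m + 1) → Laur (Idx k l)) = f :=
        Fin.cons_self_tail f
      simp [this]
    | insert a S ha ih =>
      intro P
      set h : Fin (m + 1) → Laur (Idx k l) := Fin.cons (f 0) fun α =>
        if α ∈ S then mapCoeff (pd (Sum.inl (I α))) (f α.succ) else f α.succ with hh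
      have e : (Fin.cons (f 0) fun α => if α ∈ insert a S then
          mapCoeff (pd (Sum.inl (I α))) (f α.succ) else f α.succ : Fin (m + 1) → Laur (Idx k l)) =
          Function.update h a.succ (mapCoeff (pd (Sum.inl (I a))) (h a.succ)) := by
        have e0 : h a.succ = f a.succ := by simp [hh, ha]
        rw [e0]
        funext β
        refine Fin.cases ?_ (fun β => ?_) β
        · rw [Function.update_of_ne (Fin.succ_ne_zero a).symm]
          rfl
        · by_cases hβ : β = a
          · subst hβ
            simp
          · rw [Function.update_of_ne (fun e => hβ (Fin.succ_injective _ e))]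
            simp [hh, hβ]
      rw [e, ← mapCoeff_pd_extProd, lpair_mapCoeff_symbol (hasSymbol_pd _), ih,
        Finset.prod_insert ha, map_mul, ← mul_assoc, mul_comm (PowerSeries.C (∏ α ∈ S, _))]
  have := key Finset.univ P
  simpa [scalarSlot, slotSym] using this

/-- The coefficient of `dy^{I₁} ∧ ⋯ ∧ dy^{I_m}` in the correlation map of scalar factors. -/
def coeffForm {m : ℕ} (I : Fin m → Fin (2 * k)) (f : Fin (m + 1) → Laur (Idx k l)) :
    Laur (Fin (2 * k)) :=
  M.kernel m (scalarSlot I f)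

open MeasureTheory in
theorem lpair_coeffForm {m : ℕ} (I : Fin m → Fin (2 * k)) (f : Fin (m + 1) → Laur (Idx k l))
    (N : ℤ) (p : MvPolynomial (Fin (2 * k)) ℂ) :
    lpair (M.coeffForm I f) N (PowerSeries.C p) = ((1 - M.gz⁻¹).det)⁻¹ * ∫ θ in cyc m,
      lpair (extProd (m + 1) (Idx k l) f) N
        (symbolExp (M.corrQuad θ) * PowerSeries.C (slotSym l I * totalSym k l m p)) := by
  rw [coeffForm, lpair_kernel]
  refine congrArg (fun h : (Fin (m + 1) → ℝ) → ℂ => ((1 - M.gz⁻¹).det)⁻¹ * ∫ θ in cyc m, h θ)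
    (funext fun θ => ?_)
  rw [lpair_extProd_scalarSlot, map_mul PowerSeries.C, mul_left_comm]

end Kernel

/-! ### Integration over cyclically ordered configurations -/

section CyclicIntegrals

open MeasureTheory

/-- The point of the circle that precedes the point inserted after `a`. -/
def precedingPoint {m : ℕ} (a : Fin (m + 1)) (θ : Fin (m + 1) → ℝ) : ℝ :=
  if a = 0 then θ 0 - 1 else θ a

/-- With the other points fixed, the point with label `a + 1` runs over the interval between its
neighbours. The upper neighbour uses addition modulo `m + 1`, so it is the point 0 when `a` is the
last label. The lower one is `θ 0 - 1` when `a = 0`, because the lift begins one turn before the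
point 0. -/
theorem insertNth_mem_cyc {m : ℕ} (a : Fin (m + 1)) (t : ℝ) (θ : Fin (m + 1) → ℝ) :
    (a.succ.insertNth t θ : Fin (m + 2) → ℝ) ∈ cyc (m + 1) ↔
      θ ∈ cyc m ∧ t ∈ Set.Icc (precedingPoint a θ) (θ (a + 1)) := by
  have h0 : (a.succ.insertNth t θ : Fin (m + 2) → ℝ) 0 = θ 0 := by
    have := Fin.insertNth_apply_succAbove (α := fun _ => ℝ) a.succ t θ 0
    rwa [Fin.succ_succAbove_zero] at this
  have hs : ∀ β : Fin (m + 1), (a.succ.insertNth t θ : Fin (m + 2) → ℝ) β.succ =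
      (a.insertNth t (fun γ : Fin m => θ γ.succ) : Fin (m + 1) → ℝ) β := by
    intro β
    rcases Fin.eq_self_or_eq_succAbove a β with rfl | ⟨γ, rfl⟩
    · simp
    · rw [← Fin.succ_succAbove_succ, Fin.insertNth_apply_succAbove, Fin.insertNth_apply_succAbove]
  have hlast : ∀ h : a = Fin.last m, θ (a + 1) = θ 0 := by
    rintro rfl; simp
  have hnext : ∀ γ : Fin m, a = γ.castSucc → θ (a + 1) = θ γ.succ := by
    rintro γ rfl; rw [Fin.coeSucc_eq_succ]
  simp only [cyc, Set.mem_ofPred_eq, h0, hs]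
  constructor
  · rintro ⟨h1, h2, h3⟩
    have ha := h2 a
    rw [Fin.insertNth_apply_same] at ha
    refine ⟨⟨h1, fun γ => ?_, fun γ δ h => ?_⟩, ?_, ?_⟩
    · simpa using h2 (a.succAbove γ)
    · simpa using h3 (Fin.succAbove_le_succAbove_iff.2 h : a.succAbove γ ≤ a.succAbove δ)
    · unfold precedingPoint
      split_ifs with h
      · exact ha.1
      · obtain ⟨γ, rfl⟩ := Fin.exists_succ_eq.2 h
        have := h3 (show γ.succ.succAbove γ ≤ γ.succ by
          rw [Fin.succAbove_succ_self]; exact Fin.castSucc_lt_succ.le)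
        dsimp only at this
        rwa [Fin.insertNth_apply_succAbove, Fin.insertNth_apply_same] at this
    · rcases Fin.eq_castSucc_or_eq_last a with ⟨γ, hγ⟩ | h
      · rw [hnext γ hγ]
        subst hγ
        have := h3 (show γ.castSucc ≤ γ.castSucc.succAbove γ by
          rw [Fin.succAbove_castSucc_self]; exact Fin.castSucc_lt_succ.le)
        dsimp only at this
        rwa [Fin.insertNth_apply_succAbove, Fin.insertNth_apply_same] at this
      · rw [hlast h]
        exact ha.2
  · rintro ⟨⟨h1, h2, h3⟩, h4, h5⟩
    -- Monotonicity of the larger configuration has to be checked only against the inserted value: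
    -- all earlier labels lie below it and, by the next claim, all later ones above.
    have lo : ∀ γ : Fin m, γ.castSucc < a → θ γ.succ ≤ t := by
      intro γ h
      have ha : a ≠ 0 := fun e => by subst e; exact absurd h (Fin.not_lt_zero _)
      obtain ⟨δ, rfl⟩ := Fin.exists_succ_eq.2 ha
      rw [precedingPoint, if_neg ha] at h4
      exact (h3 (Fin.castSucc_lt_succ_iff.1 h)).trans h4
    have hi : ∀ γ : Fin m, a ≤ γ.castSucc → t ≤ θ γ.succ := by
      intro γ h
      rcases Fin.eq_castSucc_or_eq_last a with ⟨δ, hδ⟩ | h'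
      · rw [hnext δ hδ] at h5
        subst hδ
        exact h5.trans (h3 (by simpa using h))
      · subst h'
        exact absurd h (not_le.2 (Fin.castSucc_lt_last γ))
    refine ⟨h1, fun β => ?_, fun β δ h => ?_⟩
    · rcases Fin.eq_self_or_eq_succAbove a β with rfl | ⟨γ, rfl⟩
      · rw [Fin.insertNth_apply_same]
        constructor
        · refine le_trans ?_ h4
          unfold precedingPoint
          split_ifs with h
          · exact le_rfl
          · obtain ⟨γ, rfl⟩ := Fin.exists_succ_eq.2 h
            exact (h2 γ).1
        · refine h5.trans ?_
          rcases Fin.eq_castSucc_or_eq_last β with ⟨δ, hδ⟩ | h'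
          · rw [hnext δ hδ]; exact (h2 δ).2
          · rw [hlast h']
      · rw [Fin.insertNth_apply_succAbove]
        exact h2 γ
    · dsimp only
      rcases Fin.eq_self_or_eq_succAbove a β with h6 | ⟨γ, rfl⟩ <;>
        rcases Fin.eq_self_or_eq_succAbove a δ with h' | ⟨ε, rfl⟩
      · rw [h', h6]
      · rw [h6] at h ⊢
        rw [Fin.insertNth_apply_same, Fin.insertNth_apply_succAbove]
        have h7 : a < a.succAbove ε := lt_of_le_of_ne h (Fin.succAbove_ne a ε).symm
        exact hi ε ((Fin.lt_succAbove_iff_le_castSucc _ _).1 h7)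
      · rw [h', Fin.insertNth_apply_same, Fin.insertNth_apply_succAbove]
        rw [h'] at h
        have h6 : a.succAbove γ < a := lt_of_le_of_ne h (Fin.succAbove_ne a γ)
        exact lo γ ((Fin.succAbove_lt_iff_castSucc_lt _ _).1 h6)
      · rw [Fin.insertNth_apply_succAbove, Fin.insertNth_apply_succAbove]
        exact h3 (Fin.succAbove_le_succAbove_iff.1 h)

theorem precedingPoint_le {m : ℕ} (a : Fin (m + 1)) {θ : Fin (m + 1) → ℝ} (hθ : θ ∈ cyc m) :
    precedingPoint a θ ≤ θ (a + 1) := by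
  obtain ⟨h1, h2, h3⟩ := hθ
  unfold precedingPoint
  split_ifs with h
  · subst h
    refine Fin.cases ?_ (fun γ => (h2 γ).1) (0 + 1 : Fin (m + 1))
    linarith
  · obtain ⟨γ, rfl⟩ := Fin.exists_succ_eq.2 h
    rcases Fin.eq_castSucc_or_eq_last γ.succ with ⟨δ, hδ⟩ | h'
    · rw [hδ, Fin.coeSucc_eq_succ, ← hδ]
      refine h3 ?_
      have := congrArg Fin.val hδ
      simp only [Fin.val_succ, Fin.val_castSucc] at this
      rw [Fin.le_def]; omega
    · rw [h', Fin.last_add_one, ← h']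
      exact (h2 γ).2

theorem measurableSet_cyc (m : ℕ) : MeasurableSet (cyc m) := (isCompact_cyc m).measurableSet

/-- Fubini in the coordinate `a + 1`, followed by the fundamental theorem of calculus on the
interval between its neighbours. -/
theorem setIntegral_cyc_deriv {m : ℕ} (a : Fin (m + 1)) (f f' : (Fin (m + 2) → ℝ) → ℂ)
    (hf' : Continuous f')
    (hd : ∀ θ t, HasDerivAt (fun t => f (Function.update θ a.succ t))
      (f' (Function.update θ a.succ t)) t) :
    ∫ θ in cyc (m + 1), f' θ = ∫ θ in cyc m,
      (f (a.succ.insertNth (θ (a + 1)) θ) - f (a.succ.insertNth (precedingPoint a θ) θ)) := by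
  have hm := (volume_preserving_piFinSuccAbove (fun _ : Fin (m + 2) => ℝ) a.succ).symm
  have hint : Integrable ((cyc (m + 1)).indicator f') :=
    (integrable_indicator_iff (measurableSet_cyc _)).2
      (hf'.continuousOn.integrableOn_compact (isCompact_cyc _))
  rw [← integral_indicator (measurableSet_cyc _), ← integral_indicator (measurableSet_cyc _),
    ← hm.integral_comp', Measure.volume_eq_prod, integral_prod_symm]
  · refine integral_congr_ae (.of_forall fun θ => ?_)
    change ∫ t : ℝ, (cyc (m + 1)).indicator f' (a.succ.insertNth t θ) = _
    by_cases hθ : θ ∈ cyc m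
    · rw [Set.indicator_of_mem hθ]
      have e : ∀ t : ℝ, (cyc (m + 1)).indicator f' (a.succ.insertNth t θ) =
          (Set.Icc (precedingPoint a θ) (θ (a + 1))).indicator
            (fun t => f' (a.succ.insertNth t θ)) t := fun t => by
        by_cases ht : t ∈ Set.Icc (precedingPoint a θ) (θ (a + 1))
        · rw [Set.indicator_of_mem ht, Set.indicator_of_mem ((insertNth_mem_cyc a t θ).2 ⟨hθ, ht⟩)]
        · rw [Set.indicator_of_notMem ht, Set.indicator_of_notMem
            fun h => ht ((insertNth_mem_cyc a t θ).1 h).2]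
      simp only [e]
      rw [integral_indicator measurableSet_Icc, integral_Icc_eq_integral_Ioc,
        ← intervalIntegral.integral_of_le (precedingPoint_le a hθ)]
      -- The hypothesis on derivatives is phrased with updates of one coordinate, so insertion is
      -- rewritten as updating a fixed configuration.
      obtain ⟨w, hu⟩ : ∃ w : Fin (m + 2) → ℝ, ∀ t : ℝ,
          (a.succ.insertNth t θ : Fin (m + 2) → ℝ) = Function.update w a.succ t :=
        ⟨a.succ.insertNth 0 θ, fun t => by rw [Fin.update_insertNth]⟩
      refine intervalIntegral.integral_eq_sub_of_hasDerivAt (f := fun t => f (a.succ.insertNth t θ))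
        (fun t _ => ?_) ((hf'.comp ?_).intervalIntegrable _ _)
      · simp only [hu]
        exact hd _ t
      · simp only [hu]
        exact continuous_const.update _ continuous_id
    · rw [Set.indicator_of_notMem hθ]
      have e : ∀ t : ℝ, (cyc (m + 1)).indicator f' (a.succ.insertNth t θ) = 0 := fun t =>
        Set.indicator_of_notMem (fun h => hθ ((insertNth_mem_cyc a t θ).1 h).1) _
      simp only [e, integral_zero]
  · exact hm.integrable_comp_of_integrable hint

/-- The configuration `(θ₀, …, θ_m)` obtained from `v` by the rotation by `i`; the points that have
passed the twist are shifted by a full turn. -/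
def unrotate {m : ℕ} (i : Fin (m + 1)) (v : Fin (m + 1) → ℝ) : Fin (m + 1) → ℝ := fun α =>
  v (α + i) - if i < α + i then 1 else 0

/-- The inverse of `unrotate`. -/
def rotate {m : ℕ} (i : Fin (m + 1)) (θ : Fin (m + 1) → ℝ) : Fin (m + 1) → ℝ := fun s =>
  θ (s - i) + if i < s then 1 else 0

theorem rotate_unrotate {m : ℕ} (i : Fin (m + 1)) (v : Fin (m + 1) → ℝ) :
    rotate i (unrotate i v) = v := by
  funext s
  simp [rotate, unrotate]

/-- `unrotate` is a permutation of the coordinates followed by a translation, and both preserve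
Lebesgue measure. -/
theorem integral_comp_unrotate {m : ℕ} (i : Fin (m + 1)) (H : (Fin (m + 1) → ℝ) → ℂ) :
    ∫ v, H (unrotate i v) = ∫ θ, H θ := by
  have hm := volume_measurePreserving_piCongrLeft (fun _ : Fin (m + 1) => ℝ)
    (Equiv.subRight i)
  rw [← integral_sub_right_eq_self H (fun α => if i < α + i then (1 : ℝ) else 0),
    ← hm.integral_comp' fun θ => H (θ - fun α => if i < α + i then (1 : ℝ) else 0)]
  refine integral_congr_ae (.of_forall fun v => congrArg H (funext fun α => ?_))
  simp only [unrotate, Pi.sub_apply]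
  congr 1
  obtain ⟨s, rfl⟩ := (Equiv.subRight i).surjective α
  refine Eq.trans ?_ (Equiv.piCongrLeft_apply_apply (fun _ : Fin (m + 1) => ℝ)
    (Equiv.subRight i) v s).symm
  simp

/-- The ordered configurations in an interval. -/
def orderedCube (m : ℕ) : Set (Fin (m + 1) → ℝ) :=
  {v | (∀ s, v s ∈ Set.Icc 0 1) ∧ Monotone v}

/-- After rotation by `i` the point 0 sits at position `i`. Later positions carry points raised by
1, which must therefore have been negative; earlier positions carry points that are nonnegative. The
rotation that brings a configuration into the ordered cube is thus read off from which points are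
negative. Nonvanishing coordinates exclude ties. -/
theorem rotate_mem_orderedCube {m : ℕ} (i : Fin (m + 1)) {θ : Fin (m + 1) → ℝ}
    (hθ : ∀ α, θ α ≠ 0) : rotate i θ ∈ orderedCube m ↔
      θ ∈ cyc m ∧ ∀ α, α ≠ 0 → (θ α < 0 ↔ (α : ℕ) + i ≤ m) := by
  -- Positions are translated into labels: a position `s` after `i` holds the label `s - i`, raised
  -- by a turn, and one before `i` holds the label `s + m + 1 - i`, unshifted.
  have hup : ∀ s : Fin (m + 1), ∀ h : i < s, ∃ α : Fin (m + 1), (α : ℕ) + i = s ∧ α ≠ 0 ∧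
      rotate i θ s = θ α + 1 := fun s h => by
    have hv : ((s - i : Fin (m + 1)) : ℕ) = s - i := Fin.sub_val_of_le h.le
    have h' : (i : ℕ) < s := h
    refine ⟨s - i, by omega, fun e => ?_, by simp [rotate, h]⟩
    rw [e] at hv
    simp at hv
    omega
  have hdown : ∀ s : Fin (m + 1), ∀ h : s < i, ∃ α : Fin (m + 1), (α : ℕ) + i = s + (m + 1) ∧
      α ≠ 0 ∧ rotate i θ s = θ α := fun s h => by
    have hv : ((s - i : Fin (m + 1)) : ℕ) = m + 1 + s - i := Fin.coe_sub_iff_lt.2 h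
    have h' : (s : ℕ) < i := h
    have := i.2
    refine ⟨s - i, by omega, fun e => ?_, by simp [rotate, h.le.not_gt]⟩
    rw [e] at hv
    simp at hv
    omega
  have hself : rotate i θ i = θ 0 := by simp [rotate]
  have hw : ∀ α : Fin (m + 1), ∀ h : (α : ℕ) + i ≤ m, α ≠ 0 → ∃ s, i < s ∧
      (α : ℕ) + i = s ∧ rotate i θ s = θ α + 1 := fun α h h0 => by
    have hα : 0 < (α : ℕ) := Nat.pos_of_ne_zero fun e => h0 (Fin.ext e)
    have his : i < (⟨α + i, by omega⟩ : Fin (m + 1)) := by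
      rw [Fin.lt_def]; dsimp only; omega
    obtain ⟨β, h1, -, h2⟩ := hup _ his
    have : β = α := Fin.ext (by dsimp only at h1; omega)
    exact ⟨_, his, rfl, this ▸ h2⟩
  have hn : ∀ α : Fin (m + 1), ∀ h : ¬(α : ℕ) + i ≤ m, α ≠ 0 → ∃ s, s < i ∧
      (α : ℕ) + i = s + (m + 1) ∧ rotate i θ s = θ α := fun α h h0 => by
    have := α.2
    have := i.2
    have his : (⟨α + i - (m + 1), by omega⟩ : Fin (m + 1)) < i := by
      rw [Fin.lt_def]; dsimp only; omega
    obtain ⟨β, h1, -, h2⟩ := hdown _ his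
    have h3 : β = α := Fin.ext (by dsimp only at h1; omega)
    exact ⟨_, his, by dsimp only; omega, h3 ▸ h2⟩
  constructor
  · rintro ⟨h1, h2⟩
    have hneg : ∀ α, α ≠ 0 → (θ α < 0 ↔ (α : ℕ) + i ≤ m) := fun α h0 => by
      by_cases h : (α : ℕ) + i ≤ m
      · obtain ⟨s, -, -, hs⟩ := hw α h h0
        have := (h1 s).2
        exact ⟨fun _ => h, fun _ => lt_of_le_of_ne (by linarith) (hθ α)⟩
      · obtain ⟨s, -, -, hs⟩ := hn α h h0
        have := (h1 s).1
        exact ⟨fun h' => by linarith, fun h' => absurd h' h⟩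
    refine ⟨⟨hself ▸ h1 i, fun γ => ?_, fun γ δ hγδ => ?_⟩, hneg⟩
    · by_cases h : (γ.succ : ℕ) + i ≤ m
      · obtain ⟨s, his, -, hs⟩ := hw γ.succ h (Fin.succ_ne_zero γ)
        have e1 := h2 his.le
        have e2 := (h1 s).2
        have e3 := (h1 i).1
        rw [hself] at e1 e3
        constructor <;> linarith
      · obtain ⟨s, his, -, hs⟩ := hn γ.succ h (Fin.succ_ne_zero γ)
        have e1 := h2 his.le
        have e2 := (h1 s).1
        have e3 := (h1 i).2
        rw [hself] at e1 e3
        constructor <;> linarith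
    · have hle : (γ : ℕ) ≤ δ := hγδ
      dsimp only
      by_cases hd : (δ.succ : ℕ) + i ≤ m
      · have hg : (γ.succ : ℕ) + i ≤ m := by simp only [Fin.val_succ] at hd ⊢; omega
        obtain ⟨s, -, hs', hs⟩ := hw γ.succ hg (Fin.succ_ne_zero γ)
        obtain ⟨s', -, ht', ht⟩ := hw δ.succ hd (Fin.succ_ne_zero δ)
        have := h2 (show s ≤ s' by
          rw [Fin.le_def]; simp only [Fin.val_succ] at hs' ht'; omega)
        linarith
      · by_cases hg : (γ.succ : ℕ) + i ≤ m
        · have e1 := (hneg γ.succ (Fin.succ_ne_zero γ)).2 hg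
          have e2 : ¬ θ δ.succ < 0 := fun h => hd ((hneg δ.succ (Fin.succ_ne_zero δ)).1 h)
          linarith
        · obtain ⟨s, -, hs', hs⟩ := hn γ.succ hg (Fin.succ_ne_zero γ)
          obtain ⟨s', -, ht', ht⟩ := hn δ.succ hd (Fin.succ_ne_zero δ)
          have := h2 (show s ≤ s' by
            rw [Fin.le_def]; simp only [Fin.val_succ] at hs' ht'; omega)
          linarith
  · rintro ⟨⟨h1, h2, h3⟩, hneg⟩
    have hb : ∀ α : Fin (m + 1), α ≠ 0 → θ α ∈ Set.Icc (θ 0 - 1) (θ 0) := fun α h0 => by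
      obtain ⟨γ, rfl⟩ := Fin.exists_succ_eq.2 h0
      exact h2 γ
    have hmono : ∀ α β : Fin (m + 1), α ≠ 0 → (α : ℕ) ≤ β → θ α ≤ θ β := fun α β h0 h => by
      have hα : 0 < (α : ℕ) := Nat.pos_of_ne_zero fun e => h0 (Fin.ext e)
      have hβ : β ≠ 0 := fun e => by rw [e] at h; simp at h; omega
      obtain ⟨γ, rfl⟩ := Fin.exists_succ_eq.2 h0
      obtain ⟨δ, rfl⟩ := Fin.exists_succ_eq.2 hβ
      exact h3 (Fin.succ_le_succ_iff.1 (Fin.le_def.2 h))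
    have key : ∀ s, (i < s → rotate i θ s ∈ Set.Icc (θ 0) 1) ∧
        (s < i → rotate i θ s ∈ Set.Icc 0 (θ 0)) := fun s => by
      constructor
      · intro h
        obtain ⟨α, e1, e2, e3⟩ := hup s h
        have h4 := (hneg α e2).2 (by omega)
        have h5 := (hb α e2).1
        rw [e3]
        constructor <;> linarith
      · intro h
        obtain ⟨α, e1, e2, e3⟩ := hdown s h
        have h4 : ¬ θ α < 0 := fun h' => by
          have := (hneg α e2).1 h'
          omega
        have h5 := (hb α e2).2
        rw [e3]
        constructor <;> linarith
    refine ⟨fun s => ?_, fun s s' h => ?_⟩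
    · rcases lt_trichotomy i s with h | rfl | h
      · have := (key s).1 h
        exact ⟨h1.1.trans this.1, this.2⟩
      · rw [hself]; exact h1
      · have := (key s).2 h
        exact ⟨this.1, this.2.trans h1.2⟩
    · have hss : (s : ℕ) ≤ s' := h
      rcases lt_trichotomy i s with h4 | rfl | h4
      · obtain ⟨α, e1, e2, e3⟩ := hup s h4
        obtain ⟨β, e4, e5, e6⟩ := hup s' (h4.trans_le h)
        rw [e3, e6]
        have := hmono α β e2 (by omega)
        linarith
      · rcases h.eq_or_lt with rfl | h5
        · exact le_rfl
        · rw [hself]; exact ((key s').1 h5).1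
      · rcases lt_trichotomy i s' with h5 | rfl | h5
        · exact ((key s).2 h4).2.trans ((key s').1 h5).1
        · rw [hself]; exact ((key s).2 h4).2
        · obtain ⟨α, e1, e2, e3⟩ := hdown s h4
          obtain ⟨β, e4, e5, e6⟩ := hdown s' h5
          rw [e3, e6]
          exact hmono α β e2 (by omega)

/-- Exactly one rotation brings a given cyclic configuration without zero coordinates into the
ordered cube. -/
theorem sum_indicator_rotate {m : ℕ} (f : (Fin (m + 1) → ℝ) → ℂ) {θ : Fin (m + 1) → ℝ}
    (hθ : ∀ α, θ α ≠ 0) :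
    ∑ i, (rotate i ⁻¹' orderedCube m).indicator f θ = (cyc m).indicator f θ := by
  by_cases h : θ ∈ cyc m
  · rw [Set.indicator_of_mem h]
    have hex : ∃ j : ℕ, ∀ α : Fin m, j ≤ (α : ℕ) → 0 < θ α.succ :=
      ⟨m, fun α h => absurd α.2 (by omega)⟩
    classical
    -- `j` is the number of negative points among `θ₁, …, θ_m`; since these increase, they are the
    -- first `j`. The required rotation is `m - j`.
    set j := Nat.find hex
    have hj : j ≤ m := Nat.find_min' hex fun α h => absurd α.2 (by omega)
    have hneg : ∀ α : Fin (m + 1), α ≠ 0 → (θ α < 0 ↔ (α : ℕ) + (m - j) ≤ m) := fun α h0 => by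
      obtain ⟨γ, rfl⟩ := Fin.exists_succ_eq.2 h0
      rw [Fin.val_succ]
      constructor
      · intro hlt
        by_contra hc
        exact absurd (Nat.find_spec hex γ (by change j ≤ _; omega)) (not_lt.2 hlt.le)
      · intro hle
        have hlt : (γ : ℕ) < Nat.find hex := by change (γ : ℕ) < j; omega
        have h' := Nat.find_min hex hlt
        push Not at h'
        obtain ⟨δ, hδ, hδ'⟩ := h'
        exact lt_of_le_of_ne ((h.2.2 (show γ ≤ δ from hδ)).trans hδ') (hθ _)
    rw [Finset.sum_eq_single (⟨m - j, by omega⟩ : Fin (m + 1))]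
    · exact Set.indicator_of_mem (s := rotate _ ⁻¹' orderedCube m) ((rotate_mem_orderedCube ⟨m - j, by omega⟩ hθ).2 ⟨h, hneg⟩) f
    -- Any other `i` predicts a different number of negative points. The label `m - i` gives the
    -- contradiction when `i` is too small, the label `j` when it is too large.
    · intro i _ hi
      refine Set.indicator_of_notMem (fun hm => hi (Fin.ext ?_)) f
      have hm' := ((rotate_mem_orderedCube i hθ).1 hm).2
      have hi2 := i.2
      dsimp only
      rcases lt_trichotomy (i : ℕ) (m - j) with hlt | he | hlt
      · have h1 : (⟨m - i, by omega⟩ : Fin (m + 1)) ≠ 0 := fun e => by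
          have := congrArg Fin.val e; simp at this; omega
        have h2 := (hneg _ h1).1 ((hm' _ h1).2 (by dsimp only; omega))
        dsimp only at h2
        omega
      · exact he
      · have h1 : (⟨j, by omega⟩ : Fin (m + 1)) ≠ 0 := fun e => by
          have := congrArg Fin.val e; simp at this; omega
        have h2 := (hm' _ h1).1 ((hneg _ h1).2 (by dsimp only; omega))
        dsimp only at h2
        omega
    · simp
  · rw [Set.indicator_of_notMem h]
    exact Finset.sum_eq_zero fun i _ => Set.indicator_of_notMem (s := rotate i ⁻¹' orderedCube m)
      (fun hm => h ((rotate_mem_orderedCube i hθ).1 hm).1) f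

theorem isCompact_orderedCube (m : ℕ) : IsCompact (orderedCube m) := by
  have e : orderedCube m = Set.Icc (fun _ => 0) (fun _ => 1) ∩ {v | Monotone v} := by
    ext v
    simp only [orderedCube, Set.mem_ofPred_eq, Set.mem_inter_iff, Set.mem_Icc, Pi.le_def,
      forall_and]
  rw [e]
  refine isCompact_Icc.inter_right ?_
  simp only [Monotone, Set.ofPred_forall]
  exact isClosed_iInter fun a => isClosed_iInter fun b => isClosed_iInter fun _ =>
    isClosed_le (continuous_apply a) (continuous_apply b)

theorem continuous_rotate {m : ℕ} (i : Fin (m + 1)) : Continuous (rotate (m := m) i) :=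
  continuous_pi fun _ => (continuous_apply _).add continuous_const

theorem continuous_unrotate {m : ℕ} (i : Fin (m + 1)) : Continuous (unrotate (m := m) i) :=
  continuous_pi fun _ => (continuous_apply _).sub continuous_const

/-- The rotated ordered cubes tile the cyclic configuration space up to the null set where some
coordinate vanishes. -/
theorem sum_integral_orderedCube {m : ℕ} (f : (Fin (m + 1) → ℝ) → ℂ) (hf : Continuous f) :
    ∑ i, ∫ v in orderedCube m, f (unrotate i v) = ∫ θ in cyc m, f θ := by
  have hms : ∀ i : Fin (m + 1), MeasurableSet (rotate i ⁻¹' orderedCube m) := fun i =>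
    (isCompact_orderedCube m).measurableSet.preimage (continuous_rotate i).measurable
  have e : ∀ i : Fin (m + 1), ∫ v in orderedCube m, f (unrotate i v) =
      ∫ θ, (rotate i ⁻¹' orderedCube m).indicator f θ := fun i => by
    rw [← integral_comp_unrotate i, ← integral_indicator (isCompact_orderedCube m).measurableSet]
    refine integral_congr_ae (.of_forall fun v => ?_)
    dsimp only
    by_cases hv : v ∈ orderedCube m
    · rw [Set.indicator_of_mem hv, Set.indicator_of_mem]
      rwa [Set.mem_preimage, rotate_unrotate]
    · rw [Set.indicator_of_notMem hv, Set.indicator_of_notMem]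
      rwa [Set.mem_preimage, rotate_unrotate]
  have hi : ∀ i : Fin (m + 1), Integrable ((rotate i ⁻¹' orderedCube m).indicator f) := fun i => by
    refine (integrable_indicator_iff (hms i)).2 (hf.continuousOn.integrableOn_compact ?_)
    have hc := (isCompact_orderedCube m).image (continuous_unrotate i)
    convert hc using 1
    ext θ
    constructor
    · intro h
      refine ⟨rotate i θ, h, ?_⟩
      funext α
      simp [rotate, unrotate]
    · rintro ⟨v, hv, rfl⟩
      rwa [Set.mem_preimage, rotate_unrotate]
  simp only [e]
  rw [← integral_finsetSum _ fun i _ => hi i, ← integral_indicator (measurableSet_cyc m)]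
  refine integral_congr_ae ?_
  have hae : ∀ᵐ θ : Fin (m + 1) → ℝ, ∀ α, θ α ≠ 0 := by
    rw [ae_all_iff]
    exact fun α => Measure.ae_eval_ne (fun _ : Fin (m + 1) => (volume : Measure ℝ)) α 0
  filter_upwards [hae] with θ hθ
  exact sum_indicator_rotate f hθ

/-- Cutting the circle at the point 0 leaves an ordered configuration in an interval of length 1
starting at `t - 1`. -/
theorem cons_mem_cyc {m : ℕ} (t : ℝ) (v : Fin (m + 1) → ℝ) :
    (Fin.cons t v : Fin (m + 2) → ℝ) ∈ cyc (m + 1) ↔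
      t ∈ Set.Icc (0 : ℝ) 1 ∧ (v - fun _ => t - 1) ∈ orderedCube m := by
  simp only [cyc, orderedCube, Set.mem_ofPred_eq, Fin.cons_zero, Fin.cons_succ, Set.mem_Icc,
    Pi.sub_apply, Monotone]
  refine and_congr_right fun _ => and_congr (forall_congr' fun α => ?_) ?_
  · constructor <;> rintro ⟨h1, h2⟩ <;> constructor <;> linarith
  · simp

/-- The point 0 here carries the unit inserted by the Connes operator, so the integrand ignores it.
Translation invariance makes the inner integral independent of its position, which ranges over an
interval of length 1; the remaining sum over rotations is the tiling above. -/
theorem sum_setIntegral_unrotate {m : ℕ} (f : (Fin (m + 1) → ℝ) → ℂ) (hf : Continuous f)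
    (hinv : ∀ θ (c : ℝ), f (θ - fun _ => c) = f θ) :
    ∑ i, ∫ u in cyc (m + 1), f (unrotate i fun s => u s.succ) = ∫ θ in cyc m, f θ := by
  rw [← sum_integral_orderedCube f hf]
  refine Finset.sum_congr rfl fun i _ => ?_
  set h : (Fin (m + 1) → ℝ) → ℂ := fun v => f (unrotate i v)
  have hh : Continuous h := hf.comp (continuous_unrotate i)
  have hhinv : ∀ v (c : ℝ), h (v - fun _ => c) = h v := fun v c => by
    change f _ = f _
    rw [← hinv (unrotate i v) c]
    congr 1
    funext α
    simp only [unrotate, Pi.sub_apply]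
    ring
  change ∫ u in cyc (m + 1), h (fun s => u s.succ) = ∫ v in orderedCube m, h v
  have hm := (volume_preserving_piFinSuccAbove (fun _ : Fin (m + 2) => ℝ) 0).symm
  have hint : Integrable ((cyc (m + 1)).indicator fun u => h fun s => u s.succ) :=
    (integrable_indicator_iff (measurableSet_cyc _)).2
      ((hh.comp (by fun_prop : Continuous fun (u : Fin (m + 2) → ℝ) (s : Fin (m + 1)) =>
        u s.succ)).continuousOn.integrableOn_compact (isCompact_cyc _))
  rw [← integral_indicator (measurableSet_cyc _), ← hm.integral_comp', Measure.volume_eq_prod,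
    integral_prod]
  · have e : ∀ t : ℝ, (∫ v : Fin (m + 1) → ℝ, (cyc (m + 1)).indicator
        (fun u => h fun s => u s.succ) (Fin.cons t v : Fin (m + 2) → ℝ)) =
        (Set.Icc (0 : ℝ) 1).indicator (fun _ => ∫ v in orderedCube m, h v) t := fun t => by
      by_cases ht : t ∈ Set.Icc (0 : ℝ) 1
      · rw [Set.indicator_of_mem ht, ← integral_indicator (isCompact_orderedCube m).measurableSet,
          ← integral_sub_right_eq_self ((orderedCube m).indicator h) (fun _ => t - 1)]
        refine integral_congr_ae (.of_forall fun v => ?_)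
        dsimp only
        by_cases hv : (v - fun _ => t - 1) ∈ orderedCube m
        · rw [Set.indicator_of_mem hv, Set.indicator_of_mem ((cons_mem_cyc t v).2 ⟨ht, hv⟩), hhinv]
          simp
        · rw [Set.indicator_of_notMem hv, Set.indicator_of_notMem fun h' =>
            hv ((cons_mem_cyc t v).1 h').2]
      · rw [Set.indicator_of_notMem ht]
        refine integral_eq_zero_of_ae (.of_forall fun v => ?_)
        exact Set.indicator_of_notMem (fun h' => ht ((cons_mem_cyc t v).1 h').1) _
    have e' : ∀ t v, (MeasurableEquiv.piFinSuccAbove (fun _ : Fin (m + 2) => ℝ) 0).symm (t, v) =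
        (Fin.cons t v : Fin (m + 2) → ℝ) := fun t v => by
      funext j
      refine Fin.cases ?_ (fun j => ?_) j <;> simp [MeasurableEquiv.piFinSuccAbove]
    simp only [e', e]
    rw [integral_indicator measurableSet_Icc]
    simp
  · exact hm.integrable_comp_of_integrable hint

end CyclicIntegrals

end TwistedSector

section LastFace

variable {A : Type} [NonAssocRing A] {m : ℕ} (a : Fin (m + 2) → A)

theorem lastFace_zero : lastFace a 0 = a (Fin.last (m + 1)) * a 0 := if_pos rfl

theorem lastFace_of_ne {j : Fin (m + 1)} (h : j ≠ 0) : lastFace a j = a j.castSucc := if_neg h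

end LastFace

namespace TwistedSector

/-! ### Colliding points and crossing the twist -/

section Faces

variable {k l r : ℕ} {G : Type*} [Group G] (M : TwistedSector k l r G)

-- Pulling the exponent back along the identification of `u` with `v` leaves sign 0 between them.
-- The Moyal exponent adds -1 at `(u, v)` and 1 at `(v, u)`, which places `u` before `v` in
-- agreement with the order of multiplication.
open Classical in
theorem lpair_extProd_merge {m n : ℕ} (φ : Fin (n + 1) → Fin (m + 1)) (u v : Fin (n + 1))
    (huv : u ≠ v) (f : Fin (n + 1) → Laur (Idx k l)) (f' : Fin (m + 1) → Laur (Idx k l))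
    (hφ : φ u = φ v) (hinj : ∀ a b, φ a = φ b → a = b ∨ (a = u ∧ b = v) ∨ (a = v ∧ b = u))
    (hsurj : Function.Surjective φ) (h1 : f' (φ u) = moyal M.P (f u) (f v))
    (h2 : ∀ w, w ≠ u → w ≠ v → f' (φ w) = f w) (ε : Fin (n + 1) → Fin (n + 1) → ℂ)
    (huv' : ε u v = -1) (hvu : ε v u = 1) (hself : ∀ α, ε α α = 0)
    (hε : ∀ α β, φ α ≠ φ β → ε α β = orderSign (φ α) (φ β))
    (θ : Fin (m + 1) → ℝ) (N : ℤ) (q : MvPolynomial (Fin (m + 1) × Idx k l) ℂ) :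
    lpair (extProd (m + 1) (Idx k l) f') N (symbolExp (M.corrQuad θ) * PowerSeries.C q) =
      lpair (extProd (n + 1) (Idx k l) f) N (symbolExp (quad (bil _ M.PY) (bil _ M.loopProp)
        (bil _ M.P) (fun α => θ (φ α)) ε (symVar _ _)) *
          PowerSeries.C (dualRelabel (Idx k l) φ q)) := by
  have hX : ∀ β, (fun i => dualRelabel (Idx k l) φ (symVar (m + 1) (Idx k l) β i)) =
      ∑ α, if φ α = β then symVar (n + 1) (Idx k l) α else 0 := fun β => by
    funext i
    rw [Finset.sum_apply]
    refine (dualRelabel_X φ β i).trans (Finset.sum_congr rfl fun α _ => ?_)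
    split_ifs <;> rfl
  have hQ : (1 / 2 : ℂ) • ∑ i, ∑ j, M.P i j • ((MvPolynomial.X (u, i) : MvPolynomial _ ℂ) *
      MvPolynomial.X (v, j)) + dualRelabel (Idx k l) φ (M.corrQuad θ) =
      quad (bil _ M.PY) (bil _ M.loopProp) (bil _ M.P) (fun α => θ (φ α)) ε (symVar _ _) := by
    rw [corrQuad, algHom_quad, funext hX, quad_fiber]
    refine (add_comm _ _).trans
      ((quad_add_single (M.P_skew) _ _ (symVar (n + 1) (Idx k l)) u v).trans ?_)
    congr 1
    funext α β
    by_cases h : φ α = φ β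
    · have h0 : orderSign (φ β) (φ β) = 0 := if_pos rfl
      rw [h, h0]
      rcases hinj α β h with rfl | ⟨rfl, rfl⟩ | ⟨rfl, rfl⟩
      · have e1 : ¬(α = u ∧ α = v) := fun h => huv (h.1.symm.trans h.2)
        have e2 : ¬(α = v ∧ α = u) := fun h => huv (h.2.symm.trans h.1)
        rw [if_neg e1, if_neg e2, hself]
        ring
      · rw [huv', if_pos ⟨rfl, rfl⟩, if_neg fun h => huv h.1]
        ring
      · rw [hvu, if_neg fun h => huv h.2, if_pos ⟨rfl, rfl⟩]
        ring
    · have e1 : ¬(α = u ∧ β = v) := fun e => h (by rw [e.1, e.2, hφ])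
      have e2 : ¬(α = v ∧ β = u) := fun e => h (by rw [e.1, e.2, hφ])
      rw [if_neg e1, if_neg e2, hε α β h]
      ring
  rw [extProd_merge M.P φ u v huv f f' hφ hinj hsurj h1 h2, mapLaur_apply,
    lpair_mapCoeff (hasTranspose_relabel φ), lpair_hbarExp (hasSymbol_poissonAt M.P u v), map_mul,
    map_symbolExp, PowerSeries.map_C, ← mul_assoc, ← symbolExp_add]
  rw [hQ]
  rfl

theorem predAbove_eq {m : ℕ} (i : Fin (m + 1)) (α : Fin (m + 2)) :
    ((i.predAbove α : Fin (m + 1)) : ℕ) = if (i : ℕ) < α then (α : ℕ) - 1 else α := by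
  unfold Fin.predAbove
  split_ifs with h h' h'
  · rfl
  · exact absurd h h'
  · exact absurd h' h
  · rfl

/-- The map of labels that identifies the last point with the point `0`. -/
def wrapLast {m : ℕ} (α : Fin (m + 2)) : Fin (m + 1) :=
  if h : α = Fin.last (m + 1) then 0 else α.castPred h

theorem wrapLast_val {m : ℕ} (α : Fin (m + 2)) :
    ((wrapLast α : Fin (m + 1)) : ℕ) = if (α : ℕ) = m + 1 then 0 else (α : ℕ) := by
  unfold wrapLast
  by_cases h : α = Fin.last (m + 1)
  · simp [h]
  · have h' : (α : ℕ) ≠ m + 1 := fun e => h (Fin.ext e)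
    simp [h, h']

open Classical in
theorem orderSign_val {m : ℕ} (α β : Fin (m + 1)) : orderSign α β =
    if (α : ℕ) = β then 0 else if (β : ℕ) ≠ 0 ∧ ((α : ℕ) = 0 ∨ (β : ℕ) < α) then 1 else -1 := by
  unfold orderSign isAfter
  simp only [Fin.ext_iff, Fin.lt_def, ne_eq, Fin.val_zero]

/-- For `i ≠ 0` the points `i` and `i + 1` are neighbours in the cut order, so the merged signs are
those of the larger configuration and the twist plays no role. -/
theorem lpair_extProd_face {m : ℕ} (i : Fin (m + 1)) (hi : i ≠ 0) (f : Fin (m + 2) → Weyl M.P)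
    (θ : Fin (m + 1) → ℝ) (N : ℤ) (q : MvPolynomial (Fin (m + 1) × Idx k l) ℂ) :
    lpair (extProd (m + 1) (Idx k l) (face (M.actWeyl M.g) i f)) N
      (symbolExp (M.corrQuad θ) * PowerSeries.C q) =
    lpair (extProd (m + 2) (Idx k l) f) N
      (symbolExp (M.corrQuad fun α => θ (i.predAbove α)) *
        PowerSeries.C (dualRelabel (Idx k l) i.predAbove q)) := by
  have hi' : (i : ℕ) ≠ 0 := fun e => hi (Fin.ext e)
  refine M.lpair_extProd_merge i.predAbove i.castSucc i.succ (Fin.castSucc_lt_succ.ne) f _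
    (by simp) ?_ ?_ ?_ ?_ orderSign ?_ ?_ (fun _ => if_pos rfl) ?_ θ N q
  · intro a b h
    have h := congrArg Fin.val h
    rw [predAbove_eq, predAbove_eq] at h
    simp only [Fin.ext_iff, Fin.val_castSucc, Fin.val_succ]
    split_ifs at h <;> omega
  · intro j
    rcases lt_or_ge i j with h | h
    · exact ⟨j.succ, by
        ext; rw [predAbove_eq]; simp only [Fin.val_succ]
        have : (i : ℕ) < j := h
        split_ifs <;> omega⟩
    · exact ⟨j.castSucc, by
        ext; rw [predAbove_eq]; simp only [Fin.val_castSucc]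
        have : (j : ℕ) ≤ i := h
        split_ifs <;> omega⟩
  · rw [Fin.predAbove_castSucc_self]
    simp only [face, lt_irrefl, if_true, if_false, hi]
    rfl
  · intro w hw1 hw2
    have e1 : (w : ℕ) ≠ i := fun e => hw1 (Fin.ext e)
    have e2 : (w : ℕ) ≠ i + 1 := fun e => hw2 (Fin.ext (by simpa using e))
    have hv := predAbove_eq i w
    unfold face
    split_ifs at hv with h
    · have e3 : ¬ (i.predAbove w < i) := by rw [Fin.lt_def]; omega
      have e4 : i.predAbove w ≠ i := fun e => by rw [e] at hv; omega
      rw [if_neg e3, if_neg e4]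
      congr 1
      ext
      rw [Fin.val_succ]; omega
    · have e3 : i.predAbove w < i := by rw [Fin.lt_def]; omega
      rw [if_pos e3]
      congr 1
      ext
      rw [Fin.val_castSucc, hv]
  · simp only [orderSign_val, Fin.val_succ, Fin.val_castSucc]
    rw [if_neg (by omega), if_neg (by omega)]
  · simp only [orderSign_val, Fin.val_succ, Fin.val_castSucc]
    rw [if_neg (by omega), if_pos (by omega)]
  · intro α β h
    have h' : (i.predAbove α : ℕ) ≠ i.predAbove β := fun e => h (Fin.ext e)
    simp only [orderSign_val]
    rw [predAbove_eq, predAbove_eq] at *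
    have ha := α.2
    have hb := β.2
    split_ifs at h' <;> split_ifs <;> first | rfl | omega

/-- In the cut order the last label comes immediately before 0, so this collision also does not meet
the twist. -/
theorem lpair_extProd_lastFace {m : ℕ} (f : Fin (m + 2) → Weyl M.P)
    (θ : Fin (m + 1) → ℝ) (N : ℤ) (q : MvPolynomial (Fin (m + 1) × Idx k l) ℂ) :
    lpair (extProd (m + 1) (Idx k l) (lastFace (A := Weyl M.P) f)) N
      (symbolExp (M.corrQuad θ) * PowerSeries.C q) =
    lpair (extProd (m + 2) (Idx k l) f) N
      (symbolExp (M.corrQuad fun α => θ (wrapLast α)) *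
        PowerSeries.C (dualRelabel (Idx k l) wrapLast q)) := by
  refine M.lpair_extProd_merge wrapLast (Fin.last (m + 1)) 0 (Fin.last_pos.ne') f _
    ?_ ?_ ?_ ?_ ?_ orderSign ?_ ?_ (fun _ => if_pos rfl) ?_ θ N q
  · ext; simp [wrapLast_val]
  · intro a b h
    have h := congrArg Fin.val h
    rw [wrapLast_val, wrapLast_val] at h
    simp only [Fin.ext_iff, Fin.val_last, Fin.val_zero]
    split_ifs at h <;> omega
  · intro j
    exact ⟨j.castSucc, by
      ext; rw [wrapLast_val]; simp only [Fin.val_castSucc]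
      have := j.2
      split_ifs <;> omega⟩
  · have e : wrapLast (Fin.last (m + 1)) = 0 := by ext; simp [wrapLast_val]
    rw [e]
    exact lastFace_zero f
  · intro w hw1 hw2
    have e1 : (w : ℕ) ≠ m + 1 := fun e => hw1 (Fin.ext e)
    have e2 : (w : ℕ) ≠ 0 := fun e => hw2 (Fin.ext e)
    have hv := wrapLast_val w
    rw [if_neg e1] at hv
    have e3 : wrapLast w ≠ 0 := fun e => e2 (by rw [← hv, e]; rfl)
    refine (lastFace_of_ne f e3).trans (congrArg f ?_)
    ext
    rw [Fin.val_castSucc, hv]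
  · simp [orderSign_val]
  · simp [orderSign_val]
  · intro α β h
    have h' : (wrapLast α : ℕ) ≠ wrapLast β := fun e => h (Fin.ext e)
    simp only [orderSign_val]
    rw [wrapLast_val, wrapLast_val] at *
    have ha := α.2
    have hb := β.2
    split_ifs at h' <;> split_ifs <;> first | rfl | omega

theorem dualRelabel_totalSym {m n : ℕ} (φ : Fin (n + 1) → Fin (m + 1))
    (p : MvPolynomial (Fin (2 * k)) ℂ) :
    dualRelabel (Idx k l) φ (totalSym k l m p) = totalSym k l n p := by
  have h : (dualRelabel (Idx k l) φ).comp (totalSym k l m) = totalSym k l n := by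
    refine MvPolynomial.algHom_ext fun i => ?_
    rw [AlgHom.comp_apply, totalSym_X, totalSym_X, map_sum]
    simp only [dualRelabel_X]
    exact sum_fiber fun α _ => MvPolynomial.X (α, Sum.inl i)
  exact DFunLike.congr_fun h p

/-- The matrices that act by `g` in the slots in `J`. -/
def twistOn {N : ℕ} (J : Fin N → Prop) [DecidablePred J] (α : Fin N) :
    Matrix (Idx k l) (Idx k l) ℂ :=
  if J α then M.coordMat M.g else 1

theorem dualBlock_twistOn_X {N : ℕ} (J : Fin N → Prop) [DecidablePred J] (α : Fin N)
    (i : Fin (2 * k)) : dualBlock (M.twistOn J) (MvPolynomial.X (α, Sum.inl i)) =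
      MvPolynomial.X (α, Sum.inl i) := by
  have e : ∀ s : Idx k l, M.twistOn J α s (Sum.inl i) = if s = Sum.inl i then 1 else 0 := by
    intro s
    unfold twistOn
    split_ifs with h h' h'
    · rw [coordMat_g, h']; simp
    · rw [coordMat_g]
      rcases s with s | s
      · exact Matrix.one_apply_ne fun e => h' (by rw [e])
      · rfl
    · rw [h']; simp
    · exact Matrix.one_apply_ne h'
  rw [dualBlock_X]
  simp [e]

theorem dualBlock_twistOn_totalSym {m : ℕ} (J : Fin (m + 1) → Prop) [DecidablePred J]
    (p : MvPolynomial (Fin (2 * k)) ℂ) :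
    dualBlock (M.twistOn J) (totalSym k l m p) = totalSym k l m p := by
  have h : (dualBlock (M.twistOn J)).comp (totalSym k l m) = totalSym k l m := by
    refine MvPolynomial.algHom_ext fun i => ?_
    rw [AlgHom.comp_apply, totalSym_X, map_sum]
    exact Finset.sum_congr rfl fun α _ => M.dualBlock_twistOn_X J α i
  exact DFunLike.congr_fun h p

theorem mapLaur_twistOn_of_mem {N : ℕ} {J : Fin N → Prop} [DecidablePred J] {α : Fin N}
    (h : J α) (F : Laur (Idx k l)) :
    mapLaur (linSubst (M.twistOn J α)) F = M.actWeyl M.g F := by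
  rw [twistOn, if_pos h]
  rfl

theorem mapLaur_twistOn_of_notMem {N : ℕ} {J : Fin N → Prop} [DecidablePred J] {α : Fin N}
    (h : ¬ J α) (F : Laur (Idx k l)) : mapLaur (linSubst (M.twistOn J α)) F = F := by
  rw [twistOn, if_neg h, linSubst_one]
  rfl

/-- In the order `ε` the labels in `J` come after all others and carry g; in the standard order they
come before all others without g. By `quad_wrap` the passage between the two lowers their points by
one turn. -/
theorem lpair_extProd_twistOn {m : ℕ} (J : Fin (m + 1) → Prop) [DecidablePred J]
    (f : Fin (m + 1) → Laur (Idx k l)) (θ : Fin (m + 1) → ℝ) (ε : Fin (m + 1) → Fin (m + 1) → ℂ)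
    (h1 : ∀ α β, J α → J β → ε α β = orderSign α β)
    (h2 : ∀ α β, ¬ J α → ¬ J β → ε α β = orderSign α β)
    (h3 : ∀ α β, J α → ¬ J β → ε α β = 1 ∧ orderSign α β = -1)
    (h4 : ∀ α β, ¬ J α → J β → ε α β = -1 ∧ orderSign α β = 1)
    (N : ℤ) (q : MvPolynomial (Fin (m + 1) × Idx k l) ℂ) :
    lpair (extProd (m + 1) (Idx k l) fun α => mapLaur (linSubst (M.twistOn J α)) (f α)) N
      (symbolExp (quad (bil _ M.PY) (bil _ M.loopProp) (bil _ M.P) θ ε (symVar _ _)) *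
        PowerSeries.C q) =
    lpair (extProd (m + 1) (Idx k l) f) N
      (symbolExp (M.corrQuad fun α => θ α - if J α then 1 else 0) *
        PowerSeries.C (dualBlock (M.twistOn J) q)) := by
  have hX : ∀ α, (fun i => dualBlock (M.twistOn J) (symVar (m + 1) (Idx k l) α i)) =
      if J α then dualAct _ (M.coordMat M.g) (symVar (m + 1) (Idx k l) α)
        else symVar (m + 1) (Idx k l) α := fun α => by
    funext i
    refine (dualBlock_X _ α i).trans ?_
    unfold twistOn
    split_ifs
    · rfl
    · simp [Matrix.one_apply, symVar]
  have hPP : ∀ x y : Idx k l → MvPolynomial (Fin (m + 1) × Idx k l) ℂ,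
      bil _ M.P (dualAct _ (M.coordMat M.g) x) (dualAct _ (M.coordMat M.g) y) = bil _ M.P x y := by
    intro x y
    rw [bil_dualAct_left, bil_dualAct_right, coordMat_P]
  have hSS : ∀ x y : Idx k l → MvPolynomial (Fin (m + 1) × Idx k l) ℂ,
      bil _ M.loopProp (dualAct _ (M.coordMat M.g) x) y = bil _ M.loopProp x y
        + (1 / 2 : ℂ) • bil _ M.P (dualAct _ (M.coordMat M.g) x) y
        + (1 / 2 : ℂ) • bil _ M.P x y - bil _ M.PY x y := by
    intro x y
    rw [bil_dualAct_left, bil_dualAct_left, coordMat_g_loopProp, bil_sub, bil_add, bil_add,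
      bil_smul, bil_smul]
  have hQ := quad_wrap (b₁ := bil _ M.PY) (bS := bil _ M.loopProp) (bP := bil _ M.P)
    (dualAct _ (M.coordMat M.g)) M.loopProp_symm M.P_skew hPP
    (fun x y => by rw [bil_dualAct_left, coordMat_g_PY])
    (fun x y => by rw [bil_dualAct_right, PY_coordMat_g]) hSS J θ orderSign ε h1 h2 h3 h4
    (symVar (m + 1) (Idx k l))
  rw [← mapLaur_linSubst_extProd, mapLaur_apply, lpair_mapCoeff (hasTranspose_blockMatrix _),
    map_mul, map_symbolExp, PowerSeries.map_C, algHom_quad, funext hX, hQ]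
  rfl

/-- The points 0 and 1 lie at opposite ends of the cut. The factor 1 is first placed after 0 with g
applied, where merging is an ordinary collision, and then carried back through the twist; this
removes the g and lowers its point by 1. -/
theorem lpair_extProd_face_zero {m : ℕ} (f : Fin (m + 2) → Weyl M.P)
    (θ : Fin (m + 1) → ℝ) (N : ℤ) (q : MvPolynomial (Fin (m + 1) × Idx k l) ℂ) :
    lpair (extProd (m + 1) (Idx k l) (face (M.actWeyl M.g) 0 f)) N
      (symbolExp (M.corrQuad θ) * PowerSeries.C q) =
    lpair (extProd (m + 2) (Idx k l) f) N
      (symbolExp (M.corrQuad fun α => θ ((0 : Fin (m + 1)).predAbove α) - if α = 1 then 1 else 0) *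
        PowerSeries.C (dualBlock (M.twistOn fun α => α = 1)
          (dualRelabel (Idx k l) (0 : Fin (m + 1)).predAbove q))) := by
  have h01 : (0 : Fin (m + 2)) ≠ 1 := by simp
  -- The auxiliary order: the label 1 is moved to the very end, behind 0, and the rest is unchanged.
  set ε : Fin (m + 2) → Fin (m + 2) → ℂ := fun α β =>
    if α = β then 0 else if α = 1 then 1 else if β = 1 then -1 else orderSign α β with hε
  have hlast : ∀ β : Fin (m + 2), β ≠ 1 → orderSign 1 β = -1 := fun β h => by
    have h' : (β : ℕ) ≠ 1 := fun e => h (Fin.ext e)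
    rw [orderSign_val, Fin.val_one, if_neg (Ne.symm h'), if_neg (by omega)]
  have hlast' : ∀ β : Fin (m + 2), β ≠ 1 → orderSign β 1 = 1 := fun β h => by
    rw [orderSign_swap, hlast β h, neg_neg]
  refine (M.lpair_extProd_merge (0 : Fin (m + 1)).predAbove 0 1 h01
    (fun α => mapLaur (linSubst (M.twistOn (fun α => α = 1) α)) (f α)) _ ?_ ?_ ?_ ?_ ?_ ε
    ?_ ?_ ?_ ?_ θ N q).trans (M.lpair_extProd_twistOn (fun α => α = 1) f _ ε ?_ ?_ ?_ ?_ N _)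
  · ext
    simp
  · intro a b h
    have h := congrArg Fin.val h
    rw [predAbove_eq, predAbove_eq, Fin.val_zero] at h
    simp only [Fin.ext_iff, Fin.val_zero, Fin.val_one]
    split_ifs at h <;> omega
  · intro j
    exact ⟨j.succ, by
      ext; rw [predAbove_eq]; simp⟩
  · have e : (0 : Fin (m + 1)).predAbove (0 : Fin (m + 2)) = 0 := by ext; simp
    rw [e]
    refine Eq.trans ?_ (congrArg₂ (moyal M.P)
      (M.mapLaur_twistOn_of_notMem (J := fun α : Fin (m + 2) => α = 1) h01 (f 0)).symm
      (M.mapLaur_twistOn_of_mem (J := fun α : Fin (m + 2) => α = 1) rfl (f 1)).symm)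
    simp only [face, lt_irrefl, if_true, if_false]
    rfl
  · intro w hw1 hw2
    have e1 : (w : ℕ) ≠ 0 := fun e => hw1 (Fin.ext e)
    have e2 : (w : ℕ) ≠ 1 := fun e => hw2 (Fin.ext (by simpa using e))
    have hv := predAbove_eq (0 : Fin (m + 1)) w
    rw [Fin.val_zero, if_pos (by omega)] at hv
    have e4 : (0 : Fin (m + 1)).predAbove w ≠ 0 := fun e => by
      rw [e, Fin.val_zero] at hv; omega
    refine Eq.trans ?_
      (M.mapLaur_twistOn_of_notMem (J := fun α : Fin (m + 2) => α = 1) hw2 (f w)).symm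
    unfold face
    rw [if_neg (Fin.not_lt_zero _), if_neg e4]
    congr 1
    ext
    rw [Fin.val_succ]; omega
  · simp [hε, h01]
  · simp [hε, h01.symm]
  · intro α
    simp [hε]
  · intro α β h
    have h' : ((0 : Fin (m + 1)).predAbove α : ℕ) ≠ (0 : Fin (m + 1)).predAbove β :=
      fun e => h (Fin.ext e)
    simp only [hε, orderSign_val, Fin.ext_iff, Fin.val_one]
    rw [predAbove_eq, predAbove_eq, Fin.val_zero] at *
    split_ifs at h' <;> split_ifs <;> first | rfl | omega
  · rintro α β rfl rfl
    simp [hε, orderSign]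
  · intro α β hα hβ
    simp only [hε, hα, hβ, if_false]
    split_ifs with h
    · rw [h]; simp [orderSign]
    · rfl
  · rintro α β rfl hβ
    refine ⟨?_, hlast β hβ⟩
    simp [hε, Ne.symm hβ]
  · rintro α β hα rfl
    refine ⟨?_, hlast' α hα⟩
    simp [hε, hα]

end Faces

/-! ### Boundary components of the configuration space -/

section BoundaryPoints

/-- The boundary components of the space of `m + 2` cyclically ordered points: the points `b` and
`b + 1` collide. -/
def boundaryPoint {m : ℕ} (b : Fin (m + 2)) (θ : Fin (m + 1) → ℝ) : Fin (m + 2) → ℝ :=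
  Fin.lastCases (motive := fun _ => Fin (m + 2) → ℝ) (fun α => θ (wrapLast α))
    (fun i α => θ (i.predAbove α) - if i = 0 ∧ α = 1 then 1 else 0) b

theorem boundaryPoint_last {m : ℕ} (θ : Fin (m + 1) → ℝ) :
    boundaryPoint (Fin.last (m + 1)) θ = fun α => θ (wrapLast α) := Fin.lastCases_last

theorem boundaryPoint_castSucc {m : ℕ} (i : Fin (m + 1)) (θ : Fin (m + 1) → ℝ) :
    boundaryPoint i.castSucc θ = fun α => θ (i.predAbove α) - if i = 0 ∧ α = 1 then 1 else 0 :=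
  Fin.lastCases_castSucc _

theorem continuous_boundaryPoint {m : ℕ} (b : Fin (m + 2)) : Continuous (boundaryPoint (m := m) b) := by
  refine continuous_pi fun α => ?_
  induction b using Fin.lastCases with
  | last => simp only [boundaryPoint_last]; fun_prop
  | cast i => simp only [boundaryPoint_castSucc]; fun_prop

theorem succAbove_val {n : ℕ} (a : Fin (n + 1)) (γ : Fin n) :
    ((a.succAbove γ : Fin (n + 1)) : ℕ) = if (γ : ℕ) < a then (γ : ℕ) else γ + 1 := by
  unfold Fin.succAbove
  split_ifs with h h' h'
  · rfl
  · exact absurd h h'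
  · exact absurd h' h
  · rfl

/-- The lower end of the interval is the collision of `a` with `a + 1`. For `a = 0` the label 1
meets the point 0 one turn earlier, hence the shift in `boundaryPoint`. -/
theorem insertNth_precedingPoint {m : ℕ} (a : Fin (m + 1)) (θ : Fin (m + 1) → ℝ) :
    (a.succ.insertNth (precedingPoint a θ) θ : Fin (m + 2) → ℝ) =
      boundaryPoint a.castSucc θ := by
  rw [boundaryPoint_castSucc]
  funext j
  rcases Fin.eq_self_or_eq_succAbove a.succ j with rfl | ⟨γ, rfl⟩
  · rw [Fin.insertNth_apply_same, Fin.predAbove_succ_self]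
    unfold precedingPoint
    by_cases h : a = 0
    · subst h
      simp
    · simp [h]
  · have e : a.predAbove (a.succ.succAbove γ) = γ := by
      ext
      rw [predAbove_eq, succAbove_val, Fin.val_succ]
      split_ifs <;> omega
    rw [Fin.insertNth_apply_succAbove, e, if_neg, sub_zero]
    rintro ⟨rfl, h⟩
    exact Fin.succAbove_ne _ _ h

/-- The upper end is the collision of `a + 1` with the next label, which is 0 when `a` is last; no
shift occurs on this side of the cut. -/
theorem insertNth_next {m : ℕ} (a : Fin (m + 1)) (θ : Fin (m + 1) → ℝ) :
    (a.succ.insertNth (θ (a + 1)) θ : Fin (m + 2) → ℝ) = boundaryPoint a.succ θ := by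
  funext j
  rcases Fin.eq_castSucc_or_eq_last a with ⟨c, rfl⟩ | rfl
  · rw [Fin.succ_castSucc, boundaryPoint_castSucc, Fin.coeSucc_eq_succ]
    dsimp only
    rw [if_neg (fun h => Fin.succ_ne_zero _ h.1), sub_zero]
    rcases Fin.eq_self_or_eq_succAbove c.succ.castSucc j with rfl | ⟨γ, rfl⟩
    · rw [Fin.insertNth_apply_same, Fin.predAbove_castSucc_self]
    · rw [Fin.insertNth_apply_succAbove]
      congr 1
      ext
      rw [predAbove_eq, succAbove_val, Fin.val_castSucc, Fin.val_succ]
      split_ifs <;> omega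
  · rw [Fin.succ_last, boundaryPoint_last, Fin.last_add_one]
    rcases Fin.eq_self_or_eq_succAbove (Fin.last (m + 1)) j with rfl | ⟨γ, rfl⟩
    · rw [Fin.insertNth_apply_same]
      congr 1
      ext
      simp [wrapLast_val]
    · rw [Fin.insertNth_apply_succAbove]
      congr 1
      ext
      rw [wrapLast_val, succAbove_val, Fin.val_last]
      have := γ.2
      split_ifs <;> omega

end BoundaryPoints

/-! ### Distribution of the form indices over merged factors -/

section SlotSymbols

variable {k l m : ℕ}

/-- The symbol `∏ ∂_{y^{I_α}}` over the factors other than `0` and `a + 1`. -/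
def omitSym (l : ℕ) (a : Fin (m + 1)) (I : Fin m → Fin (2 * k)) :
    MvPolynomial (Fin (m + 2) × Idx k l) ℂ :=
  ∏ α, MvPolynomial.X ((a.succAbove α).succ, Sum.inl (I α))

theorem slotSym_insertNth (a : Fin (m + 1)) (j : Fin (2 * k)) (I : Fin m → Fin (2 * k)) :
    slotSym l (a.insertNth j I : Fin (m + 1) → Fin (2 * k)) =
      MvPolynomial.X (a.succ, Sum.inl j) * omitSym l a I := by
  rw [slotSym, Fin.prod_univ_succAbove _ a, omitSym]
  simp only [Fin.insertNth_apply_same, Fin.insertNth_apply_succAbove]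

theorem dualRelabel_X_of_fiber {N N' : ℕ} {σ : Type} [Fintype σ] (φ : Fin N → Fin N') (α : Fin N)
    (β : Fin N') (h : ∀ γ, φ γ = β ↔ γ = α) (s : σ) :
    dualRelabel σ φ (MvPolynomial.X (β, s)) = MvPolynomial.X (α, s) := by
  rw [dualRelabel_X, Finset.sum_eq_single α]
  · rw [if_pos ((h α).2 rfl)]
  · intro γ _ hγ
    rw [if_neg fun e => hγ ((h γ).1 e)]
  · simp

theorem dualRelabel_X_of_fiber_pair {N N' : ℕ} {σ : Type} [Fintype σ] (φ : Fin N → Fin N')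
    {α α' : Fin N} (hne : α ≠ α') (β : Fin N') (h : ∀ γ, φ γ = β ↔ γ = α ∨ γ = α') (s : σ) :
    dualRelabel σ φ (MvPolynomial.X (β, s)) = MvPolynomial.X (α, s) + MvPolynomial.X (α', s) := by
  rw [dualRelabel_X, ← Finset.sum_pair (f := fun γ => (MvPolynomial.X (γ, s) :
    MvPolynomial (Fin N × σ) ℂ)) hne, ← Finset.sum_filter]
  refine Finset.sum_congr ?_ fun _ _ => rfl
  ext γ
  simp [h]

/-- The factor merged from 0 and 1 is in the slot that is not differentiated, so the factor 1 loses
its derivative. -/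
theorem dualRelabel_slotSym_zero (I : Fin m → Fin (2 * k)) :
    dualRelabel (Idx k l) (0 : Fin (m + 1)).predAbove (slotSym l I) = omitSym l 0 I := by
  rw [slotSym, omitSym, map_prod]
  refine Finset.prod_congr rfl fun α _ => dualRelabel_X_of_fiber _ _ _ (fun γ => ?_) _
  simp only [Fin.ext_iff]
  rw [predAbove_eq, Fin.val_zero, Fin.val_succ, Fin.val_succ, succAbove_val, Fin.val_zero]
  split_ifs <;> omega

theorem dualRelabel_slotSym_wrapLast (I : Fin m → Fin (2 * k)) :
    dualRelabel (Idx k l) wrapLast (slotSym l I) = omitSym l (Fin.last m) I := by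
  rw [slotSym, omitSym, map_prod]
  refine Finset.prod_congr rfl fun α _ => dualRelabel_X_of_fiber _ _ _ (fun γ => ?_) _
  have := α.2
  simp only [Fin.ext_iff]
  rw [wrapLast_val, Fin.val_succ, Fin.val_succ, succAbove_val, Fin.val_last, if_pos this]
  rcases eq_or_ne (γ : ℕ) (m + 1) with h | h
  · rw [if_pos h, h]
    constructor <;> intro e <;> omega
  · rw [if_neg h]

theorem prod_eq_add_of_eq {ι R : Type*} [Fintype ι] [DecidableEq ι] [CommRing R] (c : ι)
    (f u v : ι → R) (hc : f c = u c + v c) (hu : ∀ i, i ≠ c → f i = u i)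
    (hv : ∀ i, i ≠ c → f i = v i) : ∏ i, f i = ∏ i, u i + ∏ i, v i := by
  have e : ∀ w : ι → R, (∀ i, i ≠ c → f i = w i) →
      ∏ i, w i = w c * ∏ i ∈ Finset.univ.erase c, f i := fun w hw => by
    rw [← Finset.mul_prod_erase _ _ (Finset.mem_univ c)]
    congr 1
    exact Finset.prod_congr rfl fun i hi => (hw i (Finset.ne_of_mem_erase hi)).symm
  rw [e f fun _ _ => rfl, e u hu, e v hv, hc, add_mul]

/-- This is the Leibniz rule: the derivative of a merged factor falls on either of the two original
factors, and the other one is left without derivative. -/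
theorem dualRelabel_slotSym_succ (γ : Fin m) (I : Fin m → Fin (2 * k)) :
    dualRelabel (Idx k l) γ.succ.predAbove (slotSym l I) =
      omitSym l γ.succ I + omitSym l γ.castSucc I := by
  rw [slotSym, map_prod]
  have hfib : ∀ α, α ≠ γ → ∀ a : Fin (m + 1), (a = γ.succ ∨ a = γ.castSucc) →
      dualRelabel (Idx k l) γ.succ.predAbove (MvPolynomial.X (α.succ, Sum.inl (I α))) =
        MvPolynomial.X ((a.succAbove α).succ, Sum.inl (I α)) := by
    intro α hα a ha
    have hα' : (α : ℕ) ≠ γ := fun e => hα (Fin.ext e)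
    refine dualRelabel_X_of_fiber _ _ _ (fun δ => ?_) _
    simp only [Fin.ext_iff]
    rw [predAbove_eq, Fin.val_succ, Fin.val_succ, Fin.val_succ, succAbove_val]
    rcases ha with rfl | rfl
    · rw [Fin.val_succ]
      split_ifs <;> omega
    · rw [Fin.val_castSucc]
      split_ifs <;> omega
  refine prod_eq_add_of_eq γ _ _ _ ?_ (fun α hα => hfib α hα _ (Or.inl rfl))
    (fun α hα => hfib α hα _ (Or.inr rfl))
  rw [Fin.succAbove_succ_self, Fin.succAbove_castSucc_self]
  refine dualRelabel_X_of_fiber_pair _ ?_ _ (fun δ => ?_) _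
  · exact fun e => (Fin.castSucc_lt_succ (i := γ)).ne (Fin.succ_injective _ e)
  · simp only [Fin.ext_iff]
    rw [predAbove_eq, Fin.val_succ, Fin.val_succ, Fin.val_succ, Fin.val_succ, Fin.val_castSucc]
    split_ifs <;> omega

theorem dualBlock_twistOn_omitSym {r : ℕ} {G : Type*} [Group G] (M : TwistedSector k l r G)
    (J : Fin (m + 2) → Prop) [DecidablePred J] (a : Fin (m + 1)) (I : Fin m → Fin (2 * k)) :
    dualBlock (M.twistOn J) (omitSym l a I) = omitSym l a I := by
  rw [omitSym, map_prod]
  exact Finset.prod_congr rfl fun α _ => M.dualBlock_twistOn_X J _ _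

end SlotSymbols

/-! ### The BV operator and the faces, for scalar factors -/

section ScalarBoundary

open MeasureTheory

variable {k l r : ℕ} {G : Type*} [Group G] (M : TwistedSector k l r G) {m : ℕ}

/-- The integrand of the correlation function with the factor `a + 1` not differentiated. -/
def omitIntegrand (f : Fin (m + 2) → Laur (Idx k l)) (I : Fin m → Fin (2 * k)) (N : ℤ)
    (p : MvPolynomial (Fin (2 * k)) ℂ) (a : Fin (m + 1)) (θ : Fin (m + 2) → ℝ) : ℂ :=
  lpair (extProd (m + 2) (Idx k l) f) N
    (symbolExp (M.corrQuad θ) * PowerSeries.C (omitSym l a I * totalSym k l (m + 1) p))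

/-- The integral of `omitIntegrand` over a boundary component. -/
def boundaryIntegral (f : Fin (m + 2) → Laur (Idx k l)) (I : Fin m → Fin (2 * k)) (N : ℤ)
    (p : MvPolynomial (Fin (2 * k)) ℂ) (a : Fin (m + 1)) (b : Fin (m + 2)) : ℂ :=
  ((1 - M.gz⁻¹).det)⁻¹ * ∫ θ in cyc m, M.omitIntegrand f I N p a (boundaryPoint b θ)

theorem integrableOn_omitIntegrand (f : Fin (m + 2) → Laur (Idx k l)) (I : Fin m → Fin (2 * k))
    (N : ℤ) (p : MvPolynomial (Fin (2 * k)) ℂ) (a : Fin (m + 1)) (b : Fin (m + 2)) :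
    IntegrableOn (fun θ => M.omitIntegrand f I N p a (boundaryPoint b θ)) (cyc m) :=
  ((M.continuous_lpair_corrQuad _ N _).comp (continuous_boundaryPoint b)).continuousOn.integrableOn_compact
    (isCompact_cyc m)

theorem lpair_coeffForm_face_zero (f : Fin (m + 2) → Weyl M.P) (I : Fin m → Fin (2 * k)) (N : ℤ)
    (p : MvPolynomial (Fin (2 * k)) ℂ) :
    lpair (M.coeffForm I (face (M.actWeyl M.g) 0 f)) N (PowerSeries.C p) =
      M.boundaryIntegral f I N p 0 0 := by
  refine (M.lpair_coeffForm I _ N p).trans ?_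
  refine congrArg (fun h : (Fin (m + 1) → ℝ) → ℂ => ((1 - M.gz⁻¹).det)⁻¹ * ∫ θ in cyc m, h θ)
    (funext fun θ => ?_)
  refine (M.lpair_extProd_face_zero f θ N _).trans ?_
  unfold omitIntegrand
  rw [map_mul, map_mul, dualRelabel_slotSym_zero, dualRelabel_totalSym,
    dualBlock_twistOn_omitSym, dualBlock_twistOn_totalSym,
    show (0 : Fin (m + 2)) = (0 : Fin (m + 1)).castSucc from rfl, boundaryPoint_castSucc]
  simp only [true_and]

theorem lpair_coeffForm_face_succ (f : Fin (m + 2) → Weyl M.P) (I : Fin m → Fin (2 * k)) (N : ℤ)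
    (p : MvPolynomial (Fin (2 * k)) ℂ) (γ : Fin m) :
    lpair (M.coeffForm I (face (M.actWeyl M.g) γ.succ f)) N (PowerSeries.C p) =
      M.boundaryIntegral f I N p γ.succ γ.succ.castSucc +
        M.boundaryIntegral f I N p γ.castSucc γ.castSucc.succ := by
  unfold boundaryIntegral
  rw [← mul_add, Fin.succ_castSucc,
    ← integral_add (M.integrableOn_omitIntegrand f I N p _ _)
      (M.integrableOn_omitIntegrand f I N p _ _)]
  refine (M.lpair_coeffForm I _ N p).trans ?_
  refine congrArg (fun h : (Fin (m + 1) → ℝ) → ℂ => ((1 - M.gz⁻¹).det)⁻¹ * ∫ θ in cyc m, h θ)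
    (funext fun θ => ?_)
  refine (M.lpair_extProd_face γ.succ (Fin.succ_ne_zero γ) f θ N _).trans ?_
  have e : (fun α => θ (γ.succ.predAbove α) - if γ.succ = 0 ∧ α = 1 then 1 else 0) =
      fun α => θ (γ.succ.predAbove α) := by
    funext α
    rw [if_neg fun h => Fin.succ_ne_zero γ h.1, sub_zero]
  unfold omitIntegrand
  rw [boundaryPoint_castSucc, e, map_mul, dualRelabel_slotSym_succ,
    dualRelabel_totalSym, add_mul, map_add, mul_add]
  exact map_add (lpairHom _ N) _ _

theorem lpair_coeffForm_lastFace (f : Fin (m + 2) → Weyl M.P) (I : Fin m → Fin (2 * k)) (N : ℤ)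
    (p : MvPolynomial (Fin (2 * k)) ℂ) :
    lpair (M.coeffForm I (lastFace (A := Weyl M.P) f)) N (PowerSeries.C p) =
      M.boundaryIntegral f I N p (Fin.last m) (Fin.last (m + 1)) := by
  refine (M.lpair_coeffForm I _ N p).trans ?_
  refine congrArg (fun h : (Fin (m + 1) → ℝ) → ℂ => ((1 - M.gz⁻¹).det)⁻¹ * ∫ θ in cyc m, h θ)
    (funext fun θ => ?_)
  refine (M.lpair_extProd_lastFace f θ N _).trans ?_
  unfold omitIntegrand
  rw [map_mul, dualRelabel_slotSym_wrapLast, dualRelabel_totalSym, boundaryPoint_last]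

theorem _root_.OrbifoldHKR.C_smul {τ : Type*} (c : ℂ) (x : MvPolynomial τ ℂ) :
    PowerSeries.C (c • x) = c • PowerSeries.C x := by
  ext1 n
  have e : PowerSeries.coeff n (c • PowerSeries.C x) = c • PowerSeries.coeff n (PowerSeries.C x) :=
    rfl
  rw [e, PowerSeries.coeff_C, PowerSeries.coeff_C]
  split_ifs <;> simp

theorem bil_PY_sum {R : Type*} [CommRing R] [Algebra ℂ R] (x y : Idx k l → R) :
    bil R M.PY x y = ∑ i, ∑ j, M.P₁ i j • (x (Sum.inl i) * y (Sum.inl j)) := by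
  simp [bil_apply, PY, Fintype.sum_sum_type]

/-- The index removed by the contraction gives the variable of the factor `a + 1`, and the Lie
derivative gives the total variable. Their `PY`-pairing is minus the derivative of the exponent in
the position of that factor, so integration leaves the lower boundary value minus the upper one. -/
theorem lpair_contract (f : Fin (m + 2) → Laur (Idx k l)) (I : Fin m → Fin (2 * k)) (N : ℤ)
    (p : MvPolynomial (Fin (2 * k)) ℂ) (a : Fin (m + 1)) :
    lpair (∑ i, ∑ j, M.P₁ i j • (hbar (Fin (2 * k)) *
      mapCoeff (pd i) (M.coeffForm (a.insertNth j I : Fin (m + 1) → Fin (2 * k)) f))) N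
        (PowerSeries.C p) =
      M.boundaryIntegral f I N p a a.castSucc - M.boundaryIntegral f I N p a a.succ := by
  set F := extProd (m + 2) (Idx k l) f with hF
  set tot : Idx k l → MvPolynomial (Fin (m + 2) × Idx k l) ℂ :=
    ∑ β, symVar (m + 2) (Idx k l) β with htot
  set q := omitSym l a I * totalSym k l (m + 1) p with hq
  have hcont : ∀ Q, Continuous fun θ : Fin (m + 2) → ℝ =>
      lpair F (N - 1) (symbolExp (M.corrQuad θ) * PowerSeries.C Q) := fun Q =>
    M.continuous_lpair_corrQuad F (N - 1) (PowerSeries.C Q)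
  have h1 : ∀ i j, lpair (hbar (Fin (2 * k)) *
      mapCoeff (pd i) (M.coeffForm (a.insertNth j I : Fin (m + 1) → Fin (2 * k)) f)) N
        (PowerSeries.C p) = ((1 - M.gz⁻¹).det)⁻¹ * ∫ θ in cyc (m + 1), lpair F (N - 1)
          (symbolExp (M.corrQuad θ) * PowerSeries.C
            (tot (Sum.inl i) * symVar (m + 2) (Idx k l) a.succ (Sum.inl j) * q)) := fun i j => by
    rw [lpair_hbar_mul, lpair_mapCoeff_symbol (hasSymbol_pd i), mul_left_comm, lpair_X_mul,
      ← map_mul, lpair_coeffForm, slotSym_insertNth, map_mul (totalSym k l (m + 1)), totalSym_X]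
    refine congrArg (fun h : (Fin (m + 2) → ℝ) → ℂ =>
      ((1 - M.gz⁻¹).det)⁻¹ * ∫ θ in cyc (m + 1), h θ) (funext fun θ => ?_)
    have e : tot (Sum.inl i) = ∑ α, MvPolynomial.X (α, Sum.inl i) := by
      rw [htot, Finset.sum_apply]; rfl
    rw [e, hq, symVar]
    refine congrArg (fun Q => lpair F (N - 1) (symbolExp (M.corrQuad θ) * PowerSeries.C Q)) ?_
    ring
  -- The minus sign is the skewness of `PY`: the total derivative occupies the first slot of the
  -- bivector here but the second slot in the derivative of the exponent.
  have h2 : ∀ θ : Fin (m + 2) → ℝ, ∑ i, ∑ j, M.P₁ i j * lpair F (N - 1)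
      (symbolExp (M.corrQuad θ) * PowerSeries.C
        (tot (Sum.inl i) * symVar (m + 2) (Idx k l) a.succ (Sum.inl j) * q)) =
      -lpair F N (PowerSeries.X * PowerSeries.C (bil _ M.PY (symVar _ _ a.succ) tot) *
        symbolExp (M.corrQuad θ) * PowerSeries.C q) := fun θ => by
    rw [mul_assoc, mul_assoc, lpair_X_mul, mul_left_comm, ← map_mul PowerSeries.C, M.PY_skew,
      neg_mul, map_neg, mul_neg, bil_PY_sum]
    have e : ∀ P, lpair F (N - 1) (-P) = -lpair F (N - 1) P := map_neg (lpairHom F (N - 1))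
    rw [e, neg_neg]
    simp only [Finset.sum_mul, map_sum, Finset.mul_sum, ← lpairHom_apply, smul_mul_assoc,
      C_smul, mul_smul_comm, map_smul, smul_eq_mul]
  have h3 := setIntegral_cyc_deriv a (M.omitIntegrand f I N p a)
    (fun θ => lpair F N (PowerSeries.X * PowerSeries.C (bil _ M.PY (symVar _ _ a.succ) tot) *
        symbolExp (M.corrQuad θ) * PowerSeries.C q))
    ((M.continuous_lpair_corrQuad F N (PowerSeries.X * PowerSeries.C
      (bil _ M.PY (symVar _ _ a.succ) tot) * PowerSeries.C q)).congr fun θ =>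
        congrArg (lpair F N) (by ring))
    (fun θ t => M.hasDerivAt_lpair_corrQuad F N _ θ a.succ t)
  simp only [insertNth_precedingPoint, insertNth_next] at h3
  rw [integral_sub (M.integrableOn_omitIntegrand f I N p a _)
    (M.integrableOn_omitIntegrand f I N p a _)] at h3
  rw [boundaryIntegral, boundaryIntegral, ← mul_sub, ← neg_sub (∫ θ in cyc m, _), ← h3,
    ← integral_neg]
  simp only [← h2]
  have hi : ∀ i j, Integrable (fun θ : Fin (m + 2) → ℝ => M.P₁ i j * lpair F (N - 1)
      (symbolExp (M.corrQuad θ) * PowerSeries.C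
        (tot (Sum.inl i) * symVar (m + 2) (Idx k l) a.succ (Sum.inl j) * q)))
      (volume.restrict (cyc (m + 1))) := fun i j =>
    ((continuous_const.mul (hcont _)).continuousOn.integrableOn_compact (isCompact_cyc _))
  rw [integral_finsetSum _ fun i _ => integrable_finsetSum _ fun j _ => hi i j, Finset.mul_sum,
    ← lpairLeft_apply, map_sum]
  refine Finset.sum_congr rfl fun i _ => ?_
  rw [integral_finsetSum _ fun j _ => hi i j, Finset.mul_sum, map_sum]
  refine Finset.sum_congr rfl fun j _ => ?_
  rw [integral_const_mul, map_smul, lpairLeft_apply, h1, smul_eq_mul, mul_left_comm]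

/-- An inner boundary component occurs once as an upper end and once as the lower end of the next
interval. Both occurrences carry the sign of the same face, while the two extreme components occur
once each. -/
theorem sum_faces {V : Fin (m + 1) → Fin (m + 2) → ℂ} {F : Fin (m + 1) → ℂ} {L : ℂ}
    (h0 : F 0 = V 0 0)
    (hs : ∀ γ : Fin m, F γ.succ = V γ.succ γ.succ.castSucc + V γ.castSucc γ.castSucc.succ)
    (hl : L = V (Fin.last m) (Fin.last (m + 1))) :
    ∑ a : Fin (m + 1), (-1 : ℂ) ^ (a : ℕ) * (V a a.castSucc - V a a.succ) =
      ∑ i : Fin (m + 1), (-1 : ℂ) ^ (i : ℕ) * F i + (-1) ^ (m + 1) * L := by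
  simp only [mul_sub, Finset.sum_sub_distrib]
  rw [Fin.sum_univ_castSucc (fun a => (-1 : ℂ) ^ (a : ℕ) * V a a.succ), Fin.sum_univ_succ,
    Fin.sum_univ_succ (fun i => (-1 : ℂ) ^ (i : ℕ) * F i), h0, hl]
  simp only [hs, mul_add, Finset.sum_add_distrib, Fin.val_succ, Fin.val_castSucc, Fin.val_last,
    Fin.succ_last, pow_succ, Fin.castSucc_zero]
  simp only [mul_neg, mul_one, neg_mul, Finset.sum_neg_distrib]
  ring

theorem coeffForm_boundary (f : Fin (m + 2) → Weyl M.P) (I : Fin m → Fin (2 * k)) :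
    ∑ a : Fin (m + 1), (-1 : ℂ) ^ (a : ℕ) • ∑ i, ∑ j, M.P₁ i j • (hbar (Fin (2 * k)) *
      mapCoeff (pd i) (M.coeffForm (a.insertNth j I : Fin (m + 1) → Fin (2 * k)) f)) =
    ∑ i : Fin (m + 1), (-1 : ℂ) ^ (i : ℕ) • M.coeffForm I (face (M.actWeyl M.g) i f) +
      (-1 : ℂ) ^ (m + 1) • M.coeffForm I (lastFace (A := Weyl M.P) f) := by
  refine lpair_injective fun N p => ?_
  have h := sum_faces (F := fun i => lpair (M.coeffForm I (face (M.actWeyl M.g) i f)) N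
    (PowerSeries.C p)) (M.lpair_coeffForm_face_zero f I N p)
    (M.lpair_coeffForm_face_succ f I N p) (M.lpair_coeffForm_lastFace f I N p)
  rw [← lpairLeft_apply, ← lpairLeft_apply, map_add, map_sum, map_sum, map_smul]
  simp only [map_smul (lpairLeft N _), lpairLeft_apply, smul_eq_mul]
  refine Eq.trans (Finset.sum_congr rfl fun a _ => ?_) h
  rw [M.lpair_contract f I N p a]

end ScalarBoundary

/-! ### The de Rham differential and the cyclic terms, for scalar factors -/

section ScalarConnes

open MeasureTheory

variable {k l r : ℕ} {G : Type*} [Group G] (M : TwistedSector k l r G) {m : ℕ}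

/-- A common shift of all points changes the exponent by a multiple of `PY` evaluated twice on the
total vector, which is 0. -/
theorem corrQuad_sub_const (θ : Fin (m + 1) → ℝ) (c : ℝ) :
    M.corrQuad (θ - fun _ => c) = M.corrQuad θ := by
  rw [corrQuad_eq_affine, M.corrQuad_eq_affine θ]
  congr 1
  set tot := ∑ β, symVar (m + 1) (Idx k l) β with htot
  have h0 : bil _ M.PY tot tot = 0 := by
    have h := M.PY_skew tot tot
    have h' : (2 : ℂ) • bil _ M.PY tot tot = 0 := by
      rw [two_smul]; nth_rw 1 [h]; exact neg_add_cancel _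
    exact (smul_eq_zero.1 h').resolve_left two_ne_zero
  have h1 : ∑ α, (c : ℂ) • bil _ M.PY (symVar (m + 1) (Idx k l) α) tot = 0 := by
    rw [← Finset.smul_sum, ← LinearMap.sum_apply, ← map_sum, ← htot, h0, smul_zero]
  simp only [Pi.sub_apply, Complex.ofReal_sub, sub_smul, Finset.sum_sub_distrib, h1, sub_zero]

/-- The factors `s` with the factor `α` differentiated along `y^j`. -/
def diffSlot (s : Fin (m + 1) → Laur (Idx k l)) (α : Fin (m + 1)) (j : Fin (2 * k)) :
    Fin (m + 1) → Laur (Idx k l) :=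
  Function.update s α (mapCoeff (pd (Sum.inl j)) (s α))

theorem lpair_kernel_diffSlot (s : Fin (m + 1) → Laur (Idx k l)) (α : Fin (m + 1))
    (j : Fin (2 * k)) (N : ℤ) (p : MvPolynomial (Fin (2 * k)) ℂ) :
    lpair (M.kernel m (diffSlot s α j)) N (PowerSeries.C p) =
      ((1 - M.gz⁻¹).det)⁻¹ * ∫ θ in cyc m, lpair (extProd (m + 1) (Idx k l) s) N
        (symbolExp (M.corrQuad θ) *
          PowerSeries.C (MvPolynomial.X (α, Sum.inl j) * totalSym k l m p)) := by
  rw [lpair_kernel]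
  refine congrArg (fun h : (Fin (m + 1) → ℝ) → ℂ => ((1 - M.gz⁻¹).det)⁻¹ * ∫ θ in cyc m, h θ)
    (funext fun θ => ?_)
  rw [diffSlot, ← mapCoeff_pd_extProd, lpair_mapCoeff_symbol (hasSymbol_pd _), map_mul,
    mul_left_comm]

theorem mapCoeff_pd_kernel (s : Fin (m + 1) → Laur (Idx k l)) (j : Fin (2 * k)) :
    mapCoeff (pd j) (M.kernel m s) = ∑ α, M.kernel m (diffSlot s α j) := by
  refine lpair_injective fun N p => ?_
  rw [lpair_mapCoeff_symbol (hasSymbol_pd j), ← map_mul, lpair_kernel, map_mul, totalSym_X,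
    ← lpairLeft_apply, map_sum]
  simp only [lpairLeft_apply, lpair_kernel_diffSlot]
  rw [← Finset.mul_sum, ← integral_finsetSum]
  · refine congrArg (fun h : (Fin (m + 1) → ℝ) → ℂ => ((1 - M.gz⁻¹).det)⁻¹ * ∫ θ in cyc m, h θ)
      (funext fun θ => ?_)
    rw [Finset.sum_mul, map_sum, Finset.mul_sum, ← lpairHom_apply, map_sum]
    rfl
  · exact fun α _ => (M.continuous_lpair_corrQuad _ N _).continuousOn.integrableOn_compact
      (isCompact_cyc m)

/-- The symbol `∏ ∂_{y^{K_α}}^{(α)}`. -/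
def fullSym (l : ℕ) (K : Fin (m + 1) → Fin (2 * k)) : MvPolynomial (Fin (m + 1) × Idx k l) ℂ :=
  ∏ α, MvPolynomial.X (α, Sum.inl (K α))

/-- The integrand of the correlation function with all factors differentiated. -/
def fullIntegrand (f : Fin (m + 1) → Laur (Idx k l)) (K : Fin (m + 1) → Fin (2 * k)) (N : ℤ)
    (p : MvPolynomial (Fin (2 * k)) ℂ) (θ : Fin (m + 1) → ℝ) : ℂ :=
  lpair (extProd (m + 1) (Idx k l) f) N
    (symbolExp (M.corrQuad θ) * PowerSeries.C (fullSym l K * totalSym k l m p))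

theorem lpair_kernel_diffSlot_zero (f : Fin (m + 1) → Laur (Idx k l))
    (K : Fin (m + 1) → Fin (2 * k)) (N : ℤ) (p : MvPolynomial (Fin (2 * k)) ℂ) :
    lpair (M.kernel m (diffSlot (scalarSlot (Fin.tail K) f) 0 (K 0))) N (PowerSeries.C p) =
      ((1 - M.gz⁻¹).det)⁻¹ * ∫ θ in cyc m, M.fullIntegrand f K N p θ := by
  rw [lpair_kernel_diffSlot]
  refine congrArg (fun h : (Fin (m + 1) → ℝ) → ℂ => ((1 - M.gz⁻¹).det)⁻¹ * ∫ θ in cyc m, h θ)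
    (funext fun θ => ?_)
  rw [lpair_extProd_scalarSlot, fullIntegrand, mul_left_comm, ← map_mul, fullSym,
    Fin.prod_univ_succ, slotSym]
  refine congrArg (fun Q => lpair (extProd (m + 1) (Idx k l) f) N
    (symbolExp (M.corrQuad θ) * PowerSeries.C Q)) ?_
  simp only [Fin.tail]
  ring

/-- The position of the factor `α` in the term `i` of the Connes operator. -/
def cyclicPos (i : Fin (m + 1)) (α : Fin (m + 1)) : Fin (m + 2) := (α + i).succ

theorem extProd_cyclicTerm (i : Fin (m + 1)) (f : Fin (m + 1) → Weyl M.P) :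
    extProd (m + 2) (Idx k l) (cyclicTerm (M.actWeyl M.g) i f) =
      mapLaur (relabel (Idx k l) (cyclicPos i)) (extProd (m + 1) (Idx k l) fun α =>
        mapLaur (linSubst (M.twistOn (fun α => i < α + i) α)) (f α)) := by
  rw [mapLaur_relabel_extProd]
  refine (extProd_apply (N := m + 2) (σ := Idx k l) (cyclicTerm (M.actWeyl M.g) i f)).trans ?_
  rw [Fin.prod_univ_succ]
  -- The inserted unit contributes the factor 1 and drops out of the external product.
  have h0 : mapLaur (copyAt (0 : Fin (m + 2)))
      ((cyclicTerm (M.actWeyl M.g) i f : Fin (m + 2) → Laur (Idx k l)) 0) = 1 :=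
    map_one (mapLaur (copyAt (σ := Idx k l) (0 : Fin (m + 2))))
  rw [h0, one_mul, ← Equiv.prod_comp (Equiv.addRight i)]
  refine Finset.prod_congr rfl fun α _ => ?_
  refine congrArg (mapLaur (copyAt (α + i).succ)) ?_
  change (if i < α + i then M.actWeyl M.g (f (α + i - i)) else f (α + i - i)) = _
  rw [add_sub_cancel_right]
  split_ifs with h
  · exact (M.mapLaur_twistOn_of_mem (J := fun α => i < α + i) h (f α)).symm
  · exact (M.mapLaur_twistOn_of_notMem (J := fun α => i < α + i) h (f α)).symm

/-- `orderSign` in terms of the numerical values of the labels. -/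
def orderVal (a b : ℕ) : ℂ := if a = b then 0 else if b ≠ 0 ∧ (a = 0 ∨ b < a) then 1 else -1

theorem orderSign_eq_orderVal (α β : Fin (m + 1)) : orderSign α β = orderVal α β := by
  rw [orderSign_val]
  unfold orderVal
  congr

theorem orderVal_congr {a b c d : ℕ} (h : a = b ↔ c = d)
    (h' : (b ≠ 0 ∧ (a = 0 ∨ b < a)) ↔ (d ≠ 0 ∧ (c = 0 ∨ d < c))) : orderVal a b = orderVal c d := by
  unfold orderVal
  simp only [h, h']

theorem add_val_of_lt {i α : Fin (m + 1)} (h : i < α + i) :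
    ((α + i : Fin (m + 1)) : ℕ) = α + i ∧ 0 < (α : ℕ) := by
  have h' : (i : ℕ) < ((α + i : Fin (m + 1)) : ℕ) := h
  rw [Fin.val_add_eq_ite] at h' ⊢
  have := α.2
  split_ifs at h' ⊢ <;> omega

theorem add_val_of_not_lt {i α : Fin (m + 1)} (h : ¬ i < α + i) :
    ((α : ℕ) = 0 ∧ ((α + i : Fin (m + 1)) : ℕ) = i) ∨
      (((α + i : Fin (m + 1)) : ℕ) + (m + 1) = α + i ∧ 0 < (α : ℕ)) := by
  have h' : ¬ (i : ℕ) < ((α + i : Fin (m + 1)) : ℕ) := h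
  rw [Fin.val_add_eq_ite] at h' ⊢
  split_ifs at h' ⊢ <;> omega

/-- Once the unit is removed, the factor α sits at position `α + i + 1`. The factors with `i < α +
i` stand after the original factor 0 and carry g. Moving exactly these back through the twist
restores the original order, and `unrotate` records the resulting points. -/
theorem lpair_extProd_cyclicTerm (i : Fin (m + 1)) (f : Fin (m + 1) → Weyl M.P)
    (u : Fin (m + 2) → ℝ) (N : ℤ) (q : MvPolynomial (Fin (m + 2) × Idx k l) ℂ) :
    lpair (extProd (m + 2) (Idx k l) (cyclicTerm (M.actWeyl M.g) i f)) N
      (symbolExp (M.corrQuad u) * PowerSeries.C q) =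
    lpair (extProd (m + 1) (Idx k l) f) N
      (symbolExp (M.corrQuad (unrotate i fun s => u s.succ)) * PowerSeries.C
        (dualBlock (M.twistOn fun α => i < α + i) (dualRelabel (Idx k l) (cyclicPos i) q))) := by
  have hX : ∀ β, (fun t => dualRelabel (Idx k l) (cyclicPos i) (symVar (m + 2) (Idx k l) β t)) =
      ∑ α, if cyclicPos i α = β then symVar (m + 1) (Idx k l) α else 0 := fun β => by
    funext t
    rw [Finset.sum_apply]
    refine (dualRelabel_X (cyclicPos i) β t).trans (Finset.sum_congr rfl fun α _ => ?_)
    split_ifs <;> rfl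
  have e1 : dualRelabel (Idx k l) (cyclicPos i) (M.corrQuad u) =
      quad (bil _ M.PY) (bil _ M.loopProp) (bil _ M.P) (fun α => u (cyclicPos i α))
        (fun α β => orderSign (cyclicPos i α) (cyclicPos i β)) (symVar (m + 1) (Idx k l)) := by
    rw [corrQuad, algHom_quad, funext hX, quad_fiber]
  rw [extProd_cyclicTerm, mapLaur_apply, lpair_mapCoeff (hasTranspose_relabel _), map_mul,
    map_symbolExp, PowerSeries.map_C, e1]
  refine (M.lpair_extProd_twistOn (fun α => i < α + i) f _ _ ?_ ?_ ?_ ?_ N _)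
  · intro α β hα hβ
    obtain ⟨h1, h1'⟩ := add_val_of_lt hα
    obtain ⟨h2, h2'⟩ := add_val_of_lt hβ
    rw [cyclicPos, cyclicPos, orderSign_eq_orderVal, orderSign_eq_orderVal, Fin.val_succ,
      Fin.val_succ, h1, h2]
    exact orderVal_congr (by omega) (by omega)
  · intro α β hα hβ
    have h1 := add_val_of_not_lt hα
    have h2 := add_val_of_not_lt hβ
    have h3 := α.2
    have h4 := β.2
    rw [cyclicPos, cyclicPos, orderSign_eq_orderVal, orderSign_eq_orderVal, Fin.val_succ,
      Fin.val_succ]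
    generalize ((α + i : Fin (m + 1)) : ℕ) = a at *
    generalize ((β + i : Fin (m + 1)) : ℕ) = b at *
    exact orderVal_congr (by omega) (by omega)
  · intro α β hα hβ
    have h1 := add_val_of_lt hα
    have h2 := add_val_of_not_lt hβ
    have h3 := α.2
    have h4 := β.2
    have h5 := (α + i).2
    rw [cyclicPos, cyclicPos, orderSign_eq_orderVal, orderSign_eq_orderVal, Fin.val_succ,
      Fin.val_succ]
    generalize ((α + i : Fin (m + 1)) : ℕ) = a at *
    generalize ((β + i : Fin (m + 1)) : ℕ) = b at *
    unfold orderVal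
    constructor
    · rw [if_neg (by omega), if_pos (by omega)]
    · rw [if_neg (by omega), if_neg (by omega)]
  · intro α β hα hβ
    have h1 := add_val_of_not_lt hα
    have h2 := add_val_of_lt hβ
    have h3 := α.2
    have h4 := β.2
    have h5 := (β + i).2
    rw [cyclicPos, cyclicPos, orderSign_eq_orderVal, orderSign_eq_orderVal, Fin.val_succ,
      Fin.val_succ]
    generalize ((α + i : Fin (m + 1)) : ℕ) = a at *
    generalize ((β + i : Fin (m + 1)) : ℕ) = b at *
    unfold orderVal
    constructor
    · rw [if_neg (by omega), if_neg (by omega)]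
    · rw [if_neg (by omega), if_pos (by omega)]

theorem dualRelabel_slotSym_cyclicPos (i : Fin (m + 1)) (K : Fin (m + 1) → Fin (2 * k)) :
    dualRelabel (Idx k l) (cyclicPos i) (slotSym l fun s => K (s - i)) = fullSym l K := by
  rw [slotSym, fullSym, map_prod, ← Equiv.prod_comp (Equiv.addRight i)]
  refine Finset.prod_congr rfl fun α _ => ?_
  simp only [Equiv.coe_addRight, add_sub_cancel_right]
  refine dualRelabel_X_of_fiber _ _ _ (fun γ => ?_) _
  rw [cyclicPos, Fin.succ_inj, add_left_inj]

theorem dualBlock_twistOn_fullSym (J : Fin (m + 1) → Prop) [DecidablePred J]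
    (K : Fin (m + 1) → Fin (2 * k)) :
    dualBlock (M.twistOn J) (fullSym l K) = fullSym l K := by
  rw [fullSym, map_prod]
  exact Finset.prod_congr rfl fun α _ => M.dualBlock_twistOn_X J _ _

/-- After the reduction of each cyclic term, all terms have the same fully differentiated integrand,
evaluated on rotated configurations; these together cover the cyclic configuration space once. -/
theorem sum_coeffForm_cyclicTerm (f : Fin (m + 1) → Weyl M.P) (K : Fin (m + 1) → Fin (2 * k)) :
    ∑ i, M.coeffForm (fun s => K (s - i)) (cyclicTerm (M.actWeyl M.g) i f) =
      M.kernel m (diffSlot (scalarSlot (Fin.tail K) f) 0 (K 0)) := by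
  refine lpair_injective fun N p => ?_
  rw [← lpairLeft_apply, map_sum]
  refine Eq.trans ?_ (M.lpair_kernel_diffSlot_zero f K N p).symm
  have hc : Continuous (M.fullIntegrand f K N p) := M.continuous_lpair_corrQuad _ N _
  have h := sum_setIntegral_unrotate (M.fullIntegrand f K N p) hc fun θ c => by
    unfold fullIntegrand
    rw [corrQuad_sub_const]
  rw [← h, Finset.mul_sum]
  refine Finset.sum_congr rfl fun i _ => (M.lpair_coeffForm _ _ N p).trans ?_
  refine congrArg (fun h : (Fin (m + 2) → ℝ) → ℂ =>
    ((1 - M.gz⁻¹).det)⁻¹ * ∫ θ in cyc (m + 1), h θ) (funext fun u => ?_)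
  refine (M.lpair_extProd_cyclicTerm i f u N _).trans ?_
  unfold fullIntegrand
  rw [map_mul, map_mul, dualRelabel_slotSym_cyclicPos, dualRelabel_totalSym,
    dualBlock_twistOn_fullSym, dualBlock_twistOn_totalSym]

/-- In this slot two derivatives fall on the same factor, and mixed partial derivatives commute. -/
theorem diffSlot_swap (f : Fin (m + 1) → Laur (Idx k l)) (K : Fin (m + 1) → Fin (2 * k))
    (a : Fin m) :
    diffSlot (scalarSlot (Fin.tail (K ∘ Equiv.swap 0 a.succ)) f) a.succ
      ((K ∘ Equiv.swap 0 a.succ) 0) = diffSlot (scalarSlot (Fin.tail K) f) a.succ (K 0) := by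
  have hcomm : ∀ (i j : Idx k l) (F : Laur (Idx k l)),
      mapCoeff (pd i) (mapCoeff (pd j) F) = mapCoeff (pd j) (mapCoeff (pd i) F) := fun i j F => by
    refine lpair_injective fun N p => ?_
    simp only [lpair_mapCoeff_symbol (hasSymbol_pd _)]
    rw [mul_left_comm]
  funext β
  by_cases hβ : β = a.succ
  · subst hβ
    simp [diffSlot, scalarSlot, Fin.tail, hcomm (Sum.inl (K a.succ))]
  · rw [diffSlot, diffSlot, Function.update_of_ne hβ, Function.update_of_ne hβ]
    refine Fin.cases ?_ (fun γ hγ => ?_) β hβ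
    · intro _
      rfl
    · simp [scalarSlot, Fin.tail, Equiv.swap_apply_of_ne_of_ne (Fin.succ_ne_zero γ) hγ]

end ScalarConnes

/-! ### Equivariance under the centralizer, for scalar factors -/

section ScalarInvariance

open MeasureTheory

variable {k l r : ℕ} {G : Type*} [Group G] (M : TwistedSector k l r G) {m : ℕ} {h : G}
  (hh : h ∈ Subgroup.centralizer {M.g})

include hh

theorem dualBlock_coordMat_X (α : Fin (m + 1)) (i : Fin (2 * k)) :
    dualBlock (fun _ : Fin (m + 1) => M.coordMat h) (MvPolynomial.X (α, Sum.inl i)) =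
      ∑ j, (M.coordMat h).toBlocks₁₁ j i • MvPolynomial.X (α, Sum.inl j) := by
  have e : ∀ s, M.coordMat h (Sum.inr s) (Sum.inl i) = 0 := fun s => by
    rw [(M.coordMat_blocks hh).1, Matrix.fromBlocks_apply₂₁, Matrix.zero_apply]
  rw [dualBlock_X, Fintype.sum_sum_type]
  simp only [e, zero_smul, Finset.sum_const_zero, add_zero]
  rfl

theorem dualBlock_coordMat_slotSym (I : Fin m → Fin (2 * k)) :
    dualBlock (fun _ : Fin (m + 1) => M.coordMat h) (slotSym l I) =
      ∑ J : Fin m → Fin (2 * k), (∏ α, (M.coordMat h).toBlocks₁₁ (J α) (I α)) • slotSym l J := by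
  rw [slotSym, map_prod]
  simp only [M.dualBlock_coordMat_X hh, Finset.prod_univ_sum, Fintype.piFinset_univ,
    Finset.prod_smul]
  rfl

theorem dualBlock_coordMat_totalSym (p : MvPolynomial (Fin (2 * k)) ℂ) :
    dualBlock (fun _ : Fin (m + 1) => M.coordMat h) (totalSym k l m p) =
      totalSym k l m (MvPolynomial.aeval (fun t => ∑ s, (M.coordMat h).toBlocks₁₁ s t •
        (MvPolynomial.X s : MvPolynomial (Fin (2 * k)) ℂ)) p) := by
  have e : (dualBlock (fun _ : Fin (m + 1) => M.coordMat h)).comp (totalSym k l m) =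
      (totalSym k l m).comp (MvPolynomial.aeval fun t => ∑ s, (M.coordMat h).toBlocks₁₁ s t •
        MvPolynomial.X s) := by
    refine MvPolynomial.algHom_ext fun i => ?_
    rw [AlgHom.comp_apply, AlgHom.comp_apply, totalSym_X, MvPolynomial.aeval_X, map_sum, map_sum]
    simp only [M.dualBlock_coordMat_X hh, map_smul, totalSym_X, Finset.smul_sum]
    exact Finset.sum_comm
  exact DFunLike.congr_fun e p

/-- Every bivector in the exponent is preserved when `h` acts on both of its slots, whatever the
points and signs are. -/
theorem dualBlock_coordMat_corrQuad (θ : Fin (m + 1) → ℝ) :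
    dualBlock (fun _ : Fin (m + 1) => M.coordMat h) (M.corrQuad θ) = M.corrQuad θ := by
  have hX : ∀ α, (fun i => dualBlock (fun _ : Fin (m + 1) => M.coordMat h)
      (symVar (m + 1) (Idx k l) α i)) = dualAct _ (M.coordMat h) (symVar (m + 1) (Idx k l) α) :=
    fun α => funext fun i => dualBlock_X _ α i
  rw [corrQuad, algHom_quad, funext hX]
  unfold quad
  simp only [← map_sum, bil_dualAct_left, bil_dualAct_right, M.coordMat_P, M.coordMat_PY hh,
    M.coordMat_loopProp hh, ← Matrix.mul_assoc]

/-- The exponent is invariant, so the transposed action affects only the test symbol and the slot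
symbols. Expanding the latter over multi-indices gives the transformation of the form indices. -/
theorem coeffForm_actWeyl (I : Fin m → Fin (2 * k)) (f : Fin (m + 1) → Weyl M.P) :
    M.coeffForm I (fun α => M.actWeyl h (f α)) =
      ∑ J : Fin m → Fin (2 * k), (∏ α, (M.coordMat h).toBlocks₁₁ (J α) (I α)) •
        mapCoeff (linSubst (M.coordMat h).toBlocks₁₁).toLinearMap (M.coeffForm J f) := by
  refine lpair_injective fun N p => ?_
  rw [← lpairLeft_apply N _ (∑ J, _), map_sum]
  simp only [map_smul, lpairLeft_apply, lpair_mapCoeff (hasTranspose_linSubst _),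
    PowerSeries.map_C, smul_eq_mul]
  refine (M.lpair_coeffForm _ _ N p).trans ?_
  have e : ∀ J, lpair (M.coeffForm J f) N (PowerSeries.C (MvPolynomial.aeval
      (fun t => ∑ s, (M.coordMat h).toBlocks₁₁ s t •
        (MvPolynomial.X s : MvPolynomial (Fin (2 * k)) ℂ)) p)) = _ :=
    fun J => M.lpair_coeffForm J f N _
  refine Eq.trans ?_ (Finset.sum_congr rfl fun J _ => congrArg _ (e J)).symm
  simp only [mul_left_comm _ ((1 - M.gz⁻¹).det)⁻¹]
  rw [← Finset.mul_sum]
  simp only [← integral_const_mul]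
  rw [← integral_finsetSum, integral_const_mul]
  · refine congrArg (fun h : (Fin (m + 1) → ℝ) → ℂ => ((1 - M.gz⁻¹).det)⁻¹ * ∫ θ in cyc m, h θ)
      (funext fun θ => ?_)
    have e1 : extProd (m + 1) (Idx k l) (fun α => M.actWeyl h (f α)) =
        mapLaur (linSubst (blockMatrix fun _ : Fin (m + 1) => M.coordMat h))
          (extProd (m + 1) (Idx k l) f) := (mapLaur_linSubst_extProd _ f).symm
    rw [e1, mapLaur_apply, lpair_mapCoeff (hasTranspose_blockMatrix _), map_mul, map_symbolExp,
      PowerSeries.map_C, M.dualBlock_coordMat_corrQuad hh]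
    have e2 : (dualBlock (fun _ : Fin (m + 1) => M.coordMat h) : _ →+* _)
        (slotSym l I * totalSym k l m p) = ∑ J : Fin m → Fin (2 * k),
        (∏ α, (M.coordMat h).toBlocks₁₁ (J α) (I α)) • (slotSym l J * totalSym k l m
          (MvPolynomial.aeval (fun t => ∑ s, (M.coordMat h).toBlocks₁₁ s t •
            (MvPolynomial.X s : MvPolynomial (Fin (2 * k)) ℂ)) p)) := by
      refine (map_mul (dualBlock fun _ : Fin (m + 1) => M.coordMat h) _ _).trans ?_
      rw [M.dualBlock_coordMat_slotSym hh, M.dualBlock_coordMat_totalSym hh, Finset.sum_mul]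
      simp only [smul_mul_assoc]
    rw [e2, map_sum, Finset.mul_sum, ← lpairHom_apply, map_sum]
    refine Finset.sum_congr rfl fun J _ => ?_
    rw [C_smul, mul_smul_comm, map_smul, smul_eq_mul]
    rfl
  · exact fun J _ => ((M.continuous_lpair_corrQuad _ N _).const_mul _).continuousOn
      |>.integrableOn_compact (isCompact_cyc m)

end ScalarInvariance

/-! ### Products of the basic 1-forms -/

variable {k : ℕ}

/-- The form `dy^{I₁} ∧ ⋯ ∧ dy^{I_m}`. -/
def dyProd {m : ℕ} (I : Fin m → Fin (2 * k)) : ExteriorAlgebra ℂ (Fin (2 * k) → ℂ) :=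
  (List.ofFn fun α => dy (I α)).prod

theorem dyProd_zero (I : Fin 0 → Fin (2 * k)) : dyProd I = 1 := by
  rw [dyProd, List.ofFn_zero, List.prod_nil]

theorem dyProd_succ {m : ℕ} (I : Fin (m + 1) → Fin (2 * k)) :
    dyProd I = dy (I 0) * dyProd (Fin.tail I) := by
  rw [dyProd, List.ofFn_succ, List.prod_cons]
  rfl

theorem dyProd_eq_ιMulti {m : ℕ} (I : Fin m → Fin (2 * k)) :
    dyProd I = ExteriorAlgebra.ιMulti ℂ m fun α => Pi.single (I α) 1 := rfl

theorem dyProd_mem {m : ℕ} (I : Fin m → Fin (2 * k)) :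
    dyProd I ∈ ⋀[ℂ]^m (Fin (2 * k) → ℂ) := by
  rw [dyProd_eq_ιMulti]
  exact (exteriorPower.ιMulti ℂ m fun α => (Pi.single (I α) 1 : Fin (2 * k) → ℂ)).2

theorem dyProd_comp_perm {m : ℕ} (I : Fin m → Fin (2 * k)) (σ : Equiv.Perm (Fin m)) :
    dyProd (I ∘ σ) = ((Equiv.Perm.sign σ : ℤ) : ℂ) • dyProd I := by
  rw [dyProd_eq_ιMulti, dyProd_eq_ιMulti]
  refine ((ExteriorAlgebra.ιMulti ℂ m).map_perm
    (fun α => (Pi.single (I α) 1 : Fin (2 * k) → ℂ)) σ).trans ?_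
  rw [Units.smul_def, Int.cast_smul_eq_zsmul]

/-- The shift by `i` is the `i`-th power of a cycle of length `m + 1`, whose sign is `(-1)^m`. This
accounts for the sign in the Connes operator. -/
theorem sign_addRight {m : ℕ} (i : Fin (m + 1)) :
    Equiv.Perm.sign (Equiv.addRight i) = (-1) ^ (m * (i : ℕ)) := by
  have e : (Equiv.addRight i : Equiv.Perm (Fin (m + 1))) = finRotate (m + 1) ^ (i : ℕ) := by
    have h : ∀ n : ℕ, ∀ x : Fin (m + 1),
        (((finRotate (m + 1) ^ n) x : Fin (m + 1)) : ℕ) = ((x : ℕ) + n) % (m + 1) := fun n => by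
      induction n with
      | zero => exact fun x => (Nat.mod_eq_of_lt x.2).symm
      | succ n ih =>
        intro x
        rw [pow_succ', Equiv.Perm.mul_apply, finRotate_apply, Fin.val_add, ih, Fin.val_one',
          ← Nat.add_mod, add_assoc]
    ext x
    rw [h]
    exact Fin.val_add x i
  rw [e, map_pow, sign_finRotate, pow_mul]
  simp

theorem contractLeft_dyProd (j : Fin (2 * k)) {m : ℕ} (I : Fin (m + 1) → Fin (2 * k)) :
    CliffordAlgebra.contractLeft (Q := (0 : QuadraticForm ℂ (Fin (2 * k) → ℂ)))
      (LinearMap.proj j : (Fin (2 * k) → ℂ) →ₗ[ℂ] ℂ) (dyProd I) =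
      ∑ a : Fin (m + 1), (-1 : ℂ) ^ (a : ℕ) •
        if I a = j then dyProd (a.removeNth I) else 0 := by
  have step : ∀ {m : ℕ} (I : Fin (m + 1) → Fin (2 * k)),
      CliffordAlgebra.contractLeft (Q := (0 : QuadraticForm ℂ (Fin (2 * k) → ℂ)))
      (LinearMap.proj j : (Fin (2 * k) → ℂ) →ₗ[ℂ] ℂ) (dyProd I) =
      (if I 0 = j then dyProd (Fin.tail I) else 0) - dy (I 0) *
        CliffordAlgebra.contractLeft (Q := (0 : QuadraticForm ℂ (Fin (2 * k) → ℂ)))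
        (LinearMap.proj j : (Fin (2 * k) → ℂ) →ₗ[ℂ] ℂ) (dyProd (Fin.tail I)) := by
    intro m I
    rw [dyProd_succ]
    refine (CliffordAlgebra.contractLeft_ι_mul _ _ _).trans ?_
    rw [LinearMap.proj_apply, Pi.single_apply]
    congr 1
    simp only [eq_comm, ite_smul, one_smul, zero_smul]
  induction m with
  | zero =>
    rw [step, dyProd_zero (Fin.tail I), CliffordAlgebra.contractLeft_one]
    simp only [Fin.sum_univ_succ, Fin.sum_univ_zero, dyProd_zero, Fin.val_zero, pow_zero, one_smul,
      add_zero, mul_zero, sub_zero]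
  | succ m ih =>
    rw [step, ih, Finset.mul_sum, sub_eq_add_neg, ← Finset.sum_neg_distrib]
    conv_rhs => rw [Fin.sum_univ_succ]
    congr 1
    · simp [Fin.removeNth_zero]
    · refine Finset.sum_congr rfl fun a _ => ?_
      have e : dyProd (a.succ.removeNth I) = dy (I 0) * dyProd (a.removeNth (Fin.tail I)) := by
        rw [dyProd_succ]
        congr 2
        funext b
        simp [Fin.tail, Fin.removeNth]
      rw [e, Fin.val_succ, pow_succ, mul_neg, mul_one, neg_smul, mul_smul_comm]
      by_cases hj : Fin.tail I a = j
      · rw [if_pos hj, if_pos (show I a.succ = j from hj)]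
      · rw [if_neg hj, if_neg (show ¬ I a.succ = j from hj), mul_zero]

/-! ### Correlation forms of scalar factors -/

section Forms

variable {l r : ℕ} {G : Type*} [Group G] (M : TwistedSector k l r G)

/-- The correlation function of scalar factors. -/
def scalarForm (m : ℕ) (f : Fin (m + 1) → Laur (Idx k l)) : Forms k :=
  ∑ I : Fin m → Fin (2 * k), M.coeffForm I f ⊗ₜ dyProd I

theorem scalarForm_mem (m : ℕ) (f : Fin (m + 1) → Laur (Idx k l)) :
    M.scalarForm m f ∈ formsOfDegree k m :=
  Submodule.sum_mem _ fun I _ => ⟨M.coeffForm I f ⊗ₜ ⟨dyProd I, dyProd_mem I⟩, rfl⟩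

theorem map_dyProd {m : ℕ} (C : Matrix (Fin (2 * k)) (Fin (2 * k)) ℂ) (J : Fin m → Fin (2 * k)) :
    ExteriorAlgebra.map (Matrix.toLin' Cᵀ) (dyProd J) =
      ∑ I : Fin m → Fin (2 * k), (∏ α, C (J α) (I α)) • dyProd I := by
  have e : ∀ i, ExteriorAlgebra.map (Matrix.toLin' Cᵀ) (dy i) = ∑ j, C i j • dy j := fun i => by
    rw [dy, ExteriorAlgebra.map_apply_ι, Matrix.toLin'_apply, Matrix.mulVec_single_one]
    have : (Cᵀ.col i) = ∑ j, C i j • (Pi.single j 1 : Fin (2 * k) → ℂ) := by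
      funext j
      simp [Finset.sum_apply, Pi.single_apply]
    rw [this, map_sum]
    simp only [map_smul]
    rfl
  rw [dyProd_eq_ιMulti, ExteriorAlgebra.map_apply_ιMulti]
  have e' : (Matrix.toLin' Cᵀ : (Fin (2 * k) → ℂ) → _) ∘
      (fun α => (Pi.single (J α) 1 : Fin (2 * k) → ℂ)) =
      fun α => ∑ j, C (J α) j • (Pi.single j 1 : Fin (2 * k) → ℂ) := by
    funext α j
    simp [Finset.sum_apply, Pi.single_apply]
  rw [e', ← AlternatingMap.coe_multilinearMap, MultilinearMap.map_sum]
  refine Finset.sum_congr rfl fun I _ => ?_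
  rw [MultilinearMap.map_smul_univ]
  rfl

theorem actForms_scalarForm {h : G} (hh : h ∈ Subgroup.centralizer {M.g}) {m : ℕ}
    (f : Fin (m + 1) → Weyl M.P) :
    M.actForms h (M.scalarForm m f) = M.scalarForm m fun α => M.actWeyl h (f α) := by
  unfold scalarForm
  rw [map_sum]
  have e : ∀ I : Fin m → Fin (2 * k), M.coeffForm I (fun α => M.actWeyl h (f α)) = _ :=
    fun I => M.coeffForm_actWeyl hh I f
  refine Eq.trans ?_ (Finset.sum_congr rfl fun I _ =>
    congrArg (fun F => F ⊗ₜ[ℂ] dyProd I) (e I)).symm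
  simp only [actForms, TensorProduct.map_tmul, AlgHom.toLinearMap_apply, map_dyProd,
    TensorProduct.tmul_sum, TensorProduct.sum_tmul, TensorProduct.tmul_smul,
    TensorProduct.smul_tmul']
  rw [Finset.sum_comm]

theorem bvLaplacian_scalarForm_zero (f : Fin 1 → Laur (Idx k l)) :
    M.bvLaplacian (M.scalarForm 0 f) = 0 := by
  have e : ∀ j, CliffordAlgebra.contractLeft (Q := (0 : QuadraticForm ℂ (Fin (2 * k) → ℂ)))
      (LinearMap.proj j : (Fin (2 * k) → ℂ) →ₗ[ℂ] ℂ)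
        (1 : CliffordAlgebra (0 : QuadraticForm ℂ (Fin (2 * k) → ℂ))) = 0 := fun j =>
    CliffordAlgebra.contractLeft_one _ _
  unfold scalarForm bvLaplacian
  simp only [LinearMap.sum_apply, LinearMap.smul_apply, map_sum, TensorProduct.map_tmul,
    dyProd_zero, e, TensorProduct.tmul_zero, smul_zero, Finset.sum_const_zero]

/-- Contraction at position `a` keeps only the multi-indices with entry `j` there; removing that
entry is inverse to inserting it. -/
theorem sum_contractLeft_dyProd {m : ℕ} (c : (Fin (m + 1) → Fin (2 * k)) → Laur (Fin (2 * k)))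
    (j : Fin (2 * k)) :
    ∑ I, c I ⊗ₜ[ℂ] CliffordAlgebra.contractLeft (Q := (0 : QuadraticForm ℂ (Fin (2 * k) → ℂ)))
      (LinearMap.proj j : (Fin (2 * k) → ℂ) →ₗ[ℂ] ℂ) (dyProd I) =
      ∑ I : Fin m → Fin (2 * k), (∑ a : Fin (m + 1), (-1 : ℂ) ^ (a : ℕ) •
        c (a.insertNth j I : Fin (m + 1) → Fin (2 * k))) ⊗ₜ dyProd I := by
  simp only [contractLeft_dyProd, TensorProduct.tmul_sum, TensorProduct.sum_tmul,
    TensorProduct.tmul_smul, TensorProduct.smul_tmul']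
  rw [Finset.sum_comm]
  conv_rhs => rw [Finset.sum_comm]
  refine Finset.sum_congr rfl fun a _ => ?_
  simp only [← TensorProduct.smul_tmul', ← Finset.smul_sum]
  congr 1
  rw [← (Fin.insertNthEquiv (fun _ : Fin (m + 1) => Fin (2 * k)) a).sum_comp,
    Fintype.sum_prod_type, Finset.sum_eq_single j]
  · refine Finset.sum_congr rfl fun I _ => ?_
    simp [Fin.insertNthEquiv]
  · intro i _ hi
    refine Finset.sum_eq_zero fun I _ => ?_
    simp [Fin.insertNthEquiv, hi]
  · simp

theorem hbarMul_bvLaplacian_scalarForm {m : ℕ} (f : Fin (m + 2) → Weyl M.P) :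
    hbarMul k (M.bvLaplacian (M.scalarForm (m + 1) f)) =
      ∑ i : Fin (m + 1), (-1 : ℂ) ^ (i : ℕ) • M.scalarForm m (face (M.actWeyl M.g) i f) +
        (-1 : ℂ) ^ (m + 1) • M.scalarForm m (lastFace (A := Weyl M.P) f) := by
  have e : ∀ i j, TensorProduct.map (mapCoeff (pd i)) (CliffordAlgebra.contractLeft
      (Q := (0 : QuadraticForm ℂ (Fin (2 * k) → ℂ)))
      (LinearMap.proj j : (Fin (2 * k) → ℂ) →ₗ[ℂ] ℂ)) (M.scalarForm (m + 1) f) =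
      ∑ I : Fin m → Fin (2 * k), (∑ a : Fin (m + 1), (-1 : ℂ) ^ (a : ℕ) • mapCoeff (pd i)
        (M.coeffForm (a.insertNth j I : Fin (m + 1) → Fin (2 * k)) f)) ⊗ₜ[ℂ] dyProd I := by
    intro i j
    refine Eq.trans ?_ (sum_contractLeft_dyProd (fun I => mapCoeff (pd i) (M.coeffForm I f)) j)
    unfold scalarForm
    rw [map_sum]
    rfl
  have e2 : ∀ I : Fin m → Fin (2 * k), ∑ i, ∑ j, M.P₁ i j • (hbar (Fin (2 * k)) *
      ∑ a : Fin (m + 1), (-1 : ℂ) ^ (a : ℕ) • mapCoeff (pd i)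
        (M.coeffForm (a.insertNth j I : Fin (m + 1) → Fin (2 * k)) f)) = _ := fun I => by
    refine Eq.trans ?_ (M.coeffForm_boundary f I)
    have hm : ∀ F, hbar (Fin (2 * k)) * F = hbarMulLaur k F := fun _ => rfl
    simp only [hm, map_sum, map_smul, Finset.smul_sum]
    conv_rhs =>
      rw [Finset.sum_comm]
    refine Finset.sum_congr rfl fun i _ => ?_
    conv_rhs =>
      rw [Finset.sum_comm]
    exact Finset.sum_congr rfl fun j _ => Finset.sum_congr rfl fun a _ => smul_comm _ _ _
  have h1 : hbarMul k (M.bvLaplacian (M.scalarForm (m + 1) f)) =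
      ∑ I : Fin m → Fin (2 * k), (∑ i, ∑ j, M.P₁ i j • (hbar (Fin (2 * k)) *
      ∑ a : Fin (m + 1), (-1 : ℂ) ^ (a : ℕ) • mapCoeff (pd i)
        (M.coeffForm (a.insertNth j I : Fin (m + 1) → Fin (2 * k)) f))) ⊗ₜ[ℂ] dyProd I := by
    have hm : ∀ (F : Laur (Fin (2 * k))) x, hbarMul k (F ⊗ₜ x) = (hbar (Fin (2 * k)) * F) ⊗ₜ x :=
      fun _ _ => rfl
    unfold bvLaplacian
    simp only [LinearMap.sum_apply, LinearMap.smul_apply, e, map_sum, map_smul, hm]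
    simp only [TensorProduct.sum_tmul]
    rw [Finset.sum_comm]
    conv_rhs => rw [Finset.sum_comm]
    refine Eq.trans Finset.sum_comm (Finset.sum_congr rfl fun i _ => ?_)
    conv_rhs => rw [Finset.sum_comm]
    refine Finset.sum_congr rfl fun j _ => ?_
    rw [Finset.smul_sum]
    rfl
  rw [h1]
  refine (Finset.sum_congr rfl fun I _ =>
    congrArg (fun F => F ⊗ₜ[ℂ] dyProd I) (e2 I)).trans ?_
  simp only [scalarForm, TensorProduct.add_tmul, TensorProduct.sum_tmul, Finset.sum_add_distrib,
    ← TensorProduct.smul_tmul', Finset.smul_sum]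
  rw [Finset.sum_comm]

/-- Coefficients symmetric in two indices are summed against an antisymmetric product, so the sum
equals its own negative. -/
theorem sum_eq_zero_of_swap {m : ℕ} (c : (Fin (m + 1) → Fin (2 * k)) → Laur (Fin (2 * k)))
    (a : Fin m) (hc : ∀ K, c (K ∘ Equiv.swap 0 a.succ) = c K) :
    ∑ K, c K ⊗ₜ[ℂ] dyProd K = 0 := by
  set S : Forms k := ∑ K, c K ⊗ₜ[ℂ] dyProd K with hS
  have h : S = (-1 : ℂ) • S := by
    conv_lhs => rw [hS, ← (Equiv.arrowCongr (Equiv.swap 0 a.succ)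
      (Equiv.refl (Fin (2 * k)))).sum_comp]
    rw [hS, Finset.smul_sum]
    refine Finset.sum_congr rfl fun K _ => ?_
    have e : Equiv.arrowCongr (Equiv.swap 0 a.succ) (Equiv.refl (Fin (2 * k))) K =
        K ∘ Equiv.swap 0 a.succ := rfl
    rw [e, hc, dyProd_comp_perm, Equiv.Perm.sign_swap (Fin.succ_ne_zero a).symm,
      TensorProduct.tmul_smul]
    simp
  have h2 : (2 : ℂ) • S = 0 := by
    rw [show (2 : ℂ) • S = S + (1 : ℂ) • S by rw [two_smul, one_smul]]
    nth_rw 1 [h]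
    rw [← add_smul, neg_add_cancel, zero_smul]
  rw [← one_smul ℂ S, show (1 : ℂ) = 2⁻¹ * 2 by norm_num, mul_smul, h2, smul_zero]

theorem sum_cons {U : Type*} [AddCommMonoid U] {m : ℕ} (F : (Fin (m + 1) → Fin (2 * k)) → U) :
    ∑ K, F K = ∑ i, ∑ I : Fin m → Fin (2 * k), F (Fin.cons i I) := by
  rw [← (Fin.consEquiv fun _ : Fin (m + 1) => Fin (2 * k)).sum_comp F, Fintype.sum_prod_type]
  rfl

/-- The total derivative is a sum over slots. A slot other than 0 is then differentiated twice and
contributes nothing by `sum_eq_zero_of_swap`; the slot 0 yields the sum of cyclic terms. -/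
theorem deRham_scalarForm {m : ℕ} (f : Fin (m + 1) → Weyl M.P) :
    deRham k (M.scalarForm m f) = ∑ i : Fin (m + 1), (-1 : ℂ) ^ (m * (i : ℕ)) •
      M.scalarForm (m + 1) (cyclicTerm (M.actWeyl M.g) i f) := by
  have h1 : deRham k (M.scalarForm m f) = ∑ α : Fin (m + 1), ∑ K : Fin (m + 1) → Fin (2 * k),
      M.kernel m (diffSlot (scalarSlot (Fin.tail K) f) α (K 0)) ⊗ₜ[ℂ] dyProd K := by
    have e : ∀ (I : Fin m → Fin (2 * k)) i, mapCoeff (pd i) (M.coeffForm I f) = _ := fun I i =>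
      M.mapCoeff_pd_kernel (scalarSlot I f) i
    unfold deRham scalarForm
    simp only [LinearMap.sum_apply, map_sum, TensorProduct.map_tmul, e, LinearMap.mulLeft_apply]
    simp only [sum_cons]
    conv_rhs => rw [Finset.sum_comm]
    refine Finset.sum_comm.trans (Finset.sum_congr rfl fun i _ => ?_)
    conv_rhs => rw [Finset.sum_comm]
    refine Finset.sum_congr rfl fun I _ => ?_
    rw [TensorProduct.sum_tmul]
    refine Finset.sum_congr rfl fun α _ => ?_
    rw [dyProd_succ, Fin.tail_cons, Fin.cons_zero]
  rw [h1, Fin.sum_univ_succ]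
  have h2 : ∀ a : Fin m, ∑ K : Fin (m + 1) → Fin (2 * k),
      M.kernel m (diffSlot (scalarSlot (Fin.tail K) f) a.succ (K 0)) ⊗ₜ[ℂ] dyProd K = 0 :=
    fun a => sum_eq_zero_of_swap (fun K => M.kernel m
      (diffSlot (scalarSlot (Fin.tail K) f) a.succ (K 0))) a fun K =>
        congrArg (M.kernel m) (diffSlot_swap f K a)
  rw [Finset.sum_congr rfl fun a _ => h2 a, Finset.sum_const_zero, add_zero]
  refine (Finset.sum_congr rfl fun K _ => congrArg (fun F => F ⊗ₜ[ℂ] dyProd K)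
    (M.sum_coeffForm_cyclicTerm f K).symm).trans ?_
  simp only [TensorProduct.sum_tmul]
  rw [Finset.sum_comm]
  refine Finset.sum_congr rfl fun i _ => ?_
  unfold scalarForm
  -- The cyclic term reads its form indices in rotated order. Reindexing by the rotation restores
  -- the order, at the price of its sign on the product of 1-forms.
  rw [Finset.smul_sum, ← (Equiv.arrowCongr (Equiv.addRight (-i))
    (Equiv.refl (Fin (2 * k)))).sum_comp]
  refine Finset.sum_congr rfl fun K _ => ?_
  have e1 : Equiv.arrowCongr (Equiv.addRight (-i)) (Equiv.refl (Fin (2 * k))) K =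
      K ∘ Equiv.addRight i := by
    funext s
    simp [Equiv.arrowCongr]
  rw [e1, dyProd_comp_perm, sign_addRight]
  have e2 : (fun s => (K ∘ Equiv.addRight i) (s - i)) = K := by
    funext s
    simp
  rw [e2, TensorProduct.tmul_smul]
  simp

end Forms

end TwistedSector

/-! ### Products of lists -/

theorem prod_ofFn_merge {A : Type*} [Monoid A] {m : ℕ} (i : Fin (m + 1)) (N : Fin (m + 2) → A) :
    (List.ofFn fun j => if j < i then N j.castSucc
      else if j = i then N j.castSucc * N j.succ else N j.succ).prod = (List.ofFn N).prod := by
  induction m with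
  | zero =>
    obtain rfl : i = 0 := Subsingleton.elim (α := Fin 1) _ _
    simp [List.ofFn_succ]
  | succ m ih =>
    refine Fin.cases ?_ (fun i => ?_) i
    · rw [List.ofFn_succ, List.ofFn_succ (f := N), List.ofFn_succ (f := fun j => N j.succ)]
      simp [Fin.succ_ne_zero, mul_assoc]
    · rw [List.ofFn_succ, List.ofFn_succ (f := N), List.prod_cons, List.prod_cons,
        ← ih i fun j => N j.succ, if_pos (Fin.succ_pos i)]
      simp only [Fin.succ_lt_succ_iff, Fin.succ_inj, Fin.castSucc_zero, Fin.succ_castSucc]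

theorem prod_map_conj {A : Type*} [Monoid A] {U V : A} (hUV : U * V = 1) (hVU : V * U = 1)
    (L : List A) : (L.map fun x => U * x * V).prod = U * L.prod * V := by
  induction L with
  | nil => simp [hUV]
  | cons x L ih =>
    rw [List.map_cons, List.prod_cons, List.prod_cons, ih]
    have : U * x * V * (U * L.prod * V) = U * x * (V * U) * L.prod * V := by
      simp only [mul_assoc]
    rw [this, hVU, mul_one]
    simp only [mul_assoc]

namespace TwistedSector

variable {k l r : ℕ} {G : Type*} [Group G] (M : TwistedSector k l r G)

/-! ### The twisted trace -/

/-- Conjugation by `h` on `gl_r(ℂ)`. -/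
def conjE (h : G) : Matrix (Fin r) (Fin r) ℂ →ₗ[ℂ] Matrix (Fin r) (Fin r) ℂ :=
  LinearMap.mulRight ℂ (M.E h⁻¹) ∘ₗ LinearMap.mulLeft ℂ (M.E h)

theorem conjE_apply (h : G) (N : Matrix (Fin r) (Fin r) ℂ) :
    M.conjE h N = M.E h * N * M.E h⁻¹ := rfl

theorem E_mul_E_inv (h : G) : M.E h * M.E h⁻¹ = 1 := by
  rw [← map_mul, mul_inv_cancel, map_one]

theorem E_inv_mul_E (h : G) : M.E h⁻¹ * M.E h = 1 := by
  rw [← map_mul, inv_mul_cancel, map_one]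

/-- The twisted trace as a multilinear map. -/
def trgMulti (m : ℕ) : MultilinearMap ℂ (fun _ : Fin (m + 1) => Matrix (Fin r) (Fin r) ℂ) ℂ :=
  (Matrix.traceLinearMap (Fin r) ℂ ℂ).compMultilinearMap
    ((MultilinearMap.mkPiAlgebraFin ℂ (m + 1) (Matrix (Fin r) (Fin r) ℂ)).compLinearMap
      (Fin.cons (LinearMap.mulRight ℂ (M.E M.g)) fun _ : Fin m => LinearMap.id))

theorem trgMulti_apply {m : ℕ} (N : Fin (m + 1) → Matrix (Fin r) (Fin r) ℂ) :
    M.trgMulti m N = M.trg N := by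
  rw [trgMulti, LinearMap.compMultilinearMap_apply, MultilinearMap.compLinearMap_apply,
    MultilinearMap.mkPiAlgebraFin_apply, List.ofFn_succ, List.prod_cons]
  rfl

theorem trg_eq_sum {m : ℕ} (N : Fin (m + 1) → Matrix (Fin r) (Fin r) ℂ) :
    M.trg N = ∑ p : Fin (m + 1) → Fin r, ∑ q : Fin (m + 1) → Fin r,
      (∏ α, N α (p α) (q α)) * M.trg fun α => Matrix.single (p α) (q α) 1 := by
  have e : N = fun α => ∑ x : Fin r × Fin r, N α x.1 x.2 • Matrix.single x.1 x.2 (1 : ℂ) := by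
    funext α
    rw [Fintype.sum_prod_type]
    conv_lhs => rw [Matrix.matrix_eq_sum_single (N α)]
    simp
  conv_lhs => rw [e]
  rw [← trgMulti_apply, MultilinearMap.map_sum,
    ← (Equiv.arrowProdEquivProdArrow (Fin (m + 1)) (fun _ => Fin r) fun _ => Fin r).symm.sum_comp,
    Fintype.sum_prod_type]
  refine Finset.sum_congr rfl fun p _ => Finset.sum_congr rfl fun q _ => ?_
  rw [MultilinearMap.map_smul_univ, trgMulti_apply, smul_eq_mul]
  rfl

/-- Inner faces only associate the product differently. In the face 0 the conjugation cancels the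
twist: `N₀ (g N₁ g⁻¹) g = N₀ g N₁`. -/
theorem trg_face {m : ℕ} (i : Fin (m + 1)) (N : Fin (m + 2) → Matrix (Fin r) (Fin r) ℂ) :
    M.trg (face (M.conjE M.g) i N) = M.trg N := by
  have e : ∀ {m : ℕ} (N : Fin (m + 1) → Matrix (Fin r) (Fin r) ℂ), M.trg N =
      (List.ofFn (Fin.cons (N 0 * M.E M.g) fun α : Fin m => N α.succ :
        Fin (m + 1) → Matrix (Fin r) (Fin r) ℂ)).prod.trace := fun N => by
    rw [List.ofFn_succ, List.prod_cons]
    rfl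
  rw [e, e, ← prod_ofFn_merge i]
  refine congrArg (fun F : Fin (m + 1) → Matrix (Fin r) (Fin r) ℂ => (List.ofFn F).prod.trace)
    (funext fun j => ?_)
  refine Fin.cases ?_ (fun j => ?_) j
  · by_cases hi : i = 0
    · subst hi
      simp only [Fin.cons_zero, face, lt_irrefl, if_false, if_true, conjE_apply, Fin.castSucc_zero,
        Fin.cons_succ, mul_assoc, E_inv_mul_E, mul_one]
    · have h0 : 0 < i := Fin.pos_of_ne_zero hi
      simp only [Fin.cons_zero, face, h0, if_true, Fin.castSucc_zero]
  · by_cases hi : i = 0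
    · subst hi
      simp [face, Fin.succ_ne_zero]
    · simp only [Fin.cons_succ, face, hi, if_false, ← Fin.succ_castSucc]

theorem trg_lastFace {m : ℕ} (N : Fin (m + 2) → Matrix (Fin r) (Fin r) ℂ) :
    M.trg (lastFace N) = M.trg N := by
  rw [trg, trg, List.ofFn_succ', List.concat_eq_append, List.prod_append, List.prod_singleton,
    lastFace_zero, ← mul_assoc, Matrix.trace_mul_comm _ (N (Fin.last m).succ)]
  have h : ∀ α : Fin m, lastFace N α.succ = N α.castSucc.succ := fun α => by
    rw [lastFace_of_ne N (Fin.succ_ne_zero α), Fin.succ_castSucc]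
  simp only [h, Fin.succ_last, mul_assoc]

/-- The conjugations telescope to one pair around the block that has passed the twist. The trailing
inverse cancels cyclically against the leading g, and cyclicity of the trace does the rest. -/
theorem trg_cyclicTerm {m : ℕ} (i : Fin (m + 1)) (N : Fin (m + 1) → Matrix (Fin r) (Fin r) ℂ) :
    M.trg (cyclicTerm (M.conjE M.g) i N) = M.trg N := by
  set L := List.ofFn fun α : Fin m => N α.succ with hL
  have hlen : L.length = m := List.length_ofFn
  -- The rotated word consists of the last `i` factors, then `N₀`, then the first `m - i` factors
  -- conjugated by g.
  have e : (List.ofFn fun s : Fin (m + 1) => cyclicTerm (M.conjE M.g) i N s.succ) =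
      L.drop (m - i) ++ N 0 :: (L.take (m - i)).map fun x => M.E M.g * x * M.E M.g⁻¹ := by
    have hi := i.2
    refine List.ext_getElem (by simp [hlen]; omega) fun n h1 h2 => ?_
    have hn : n < m + 1 := by simpa using h1
    rw [List.getElem_ofFn, List.getElem_append]
    simp only [cyclicTerm, Fin.cons_succ, List.length_drop, hlen]
    have hsub : ∀ s : Fin (m + 1), ((s - i : Fin (m + 1)) : ℕ) =
        if (i : ℕ) ≤ s then (s : ℕ) - i else m + 1 + s - i := fun s => by
      split_ifs with h
      · exact Fin.sub_val_of_le h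
      · rw [Fin.coe_sub_iff_lt.2 (not_le.1 h)]
    have hv := hsub ⟨n, hn⟩
    simp only at hv
    by_cases h : n < m - (m - i)
    · rw [dif_pos h, if_neg (by rw [Fin.lt_def]; simp only; omega), List.getElem_drop,
        List.getElem_ofFn]
      rw [if_neg (by omega)] at hv
      congr 1
      ext
      rw [hv]
      simp only [Fin.val_succ]
      omega
    · rw [dif_neg h]
      rw [if_pos (by omega)] at hv
      obtain ⟨t, ht⟩ : ∃ t, n = i + t := ⟨n - i, by omega⟩
      subst ht
      cases t with
      | zero =>
        have e0 : (i : ℕ) + 0 - (m - (m - i)) = 0 := by omega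
        rw [if_neg (by rw [Fin.lt_def]; simp)]
        simp only [e0, List.getElem_cons_zero]
        congr 1
        ext
        rw [hv]
        simp
      | succ t =>
        have e0 : (i : ℕ) + (t + 1) - (m - (m - i)) = t + 1 := by omega
        rw [if_pos (by rw [Fin.lt_def]; simp only; omega)]
        simp only [e0, List.getElem_cons_succ, List.getElem_map, List.getElem_take]
        rw [conjE_apply, List.getElem_ofFn]
        congr 3
        ext
        rw [hv]
        simp
  have e0 : cyclicTerm (M.conjE M.g) i N 0 = 1 := rfl
  rw [trg, e0, e, List.prod_append, List.prod_cons,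
    prod_map_conj (M.E_mul_E_inv M.g) (M.E_inv_mul_E M.g), one_mul, trg, ← hL]
  conv_rhs => rw [← List.take_append_drop (m - i) L, List.prod_append]
  set D := (L.drop (m - i)).prod
  set T := (L.take (m - i)).prod
  calc (M.E M.g * (D * (N 0 * (M.E M.g * T * M.E M.g⁻¹)))).trace
      = ((M.E M.g * (D * (N 0 * (M.E M.g * T)))) * M.E M.g⁻¹).trace := by simp only [mul_assoc]
    _ = (M.E M.g⁻¹ * M.E M.g * (D * (N 0 * (M.E M.g * T)))).trace := by
        rw [Matrix.trace_mul_comm, mul_assoc]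
    _ = (N 0 * (M.E M.g * T) * D).trace := by
        rw [E_inv_mul_E, one_mul, Matrix.trace_mul_comm]
    _ = (N 0 * M.E M.g * (T * D)).trace := by simp only [mul_assoc]

/-- The outer conjugation disappears by cyclicity, and the inner `h⁻¹ g h` equals g because `h`
centralizes g. -/
theorem trg_conjE {h : G} (hh : h ∈ Subgroup.centralizer {M.g}) {m : ℕ}
    (N : Fin (m + 1) → Matrix (Fin r) (Fin r) ℂ) :
    M.trg (fun α => M.conjE h (N α)) = M.trg N := by
  have hc : M.E M.g * M.E h = M.E h * M.E M.g := by
    rw [← map_mul, ← map_mul, (Subgroup.mem_centralizer_singleton_iff.1 hh)]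
  have hc' : M.E h⁻¹ * M.E M.g = M.E M.g * M.E h⁻¹ := by
    calc M.E h⁻¹ * M.E M.g = M.E h⁻¹ * (M.E M.g * M.E h) * M.E h⁻¹ := by
          rw [mul_assoc, mul_assoc, E_mul_E_inv, mul_one]
      _ = M.E h⁻¹ * M.E h * (M.E M.g * M.E h⁻¹) := by rw [hc]; simp only [mul_assoc]
      _ = M.E M.g * M.E h⁻¹ := by rw [E_inv_mul_E, one_mul]
  have e : (List.ofFn fun α : Fin m => M.conjE h (N α.succ)) =
      (List.ofFn fun α : Fin m => N α.succ).map fun x => M.E h * x * M.E h⁻¹ := by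
    rw [List.map_ofFn]
    rfl
  rw [trg, e, prod_map_conj (M.E_mul_E_inv h) (M.E_inv_mul_E h), trg, conjE_apply]
  set T := (List.ofFn fun α : Fin m => N α.succ).prod
  calc (M.E h * N 0 * M.E h⁻¹ * M.E M.g * (M.E h * T * M.E h⁻¹)).trace
      = (M.E h * (N 0 * (M.E h⁻¹ * M.E M.g) * M.E h * T) * M.E h⁻¹).trace := by
        simp only [mul_assoc]
    _ = (M.E h⁻¹ * M.E h * (N 0 * (M.E h⁻¹ * M.E M.g) * M.E h * T)).trace := by
        rw [Matrix.trace_mul_comm]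
        simp only [mul_assoc]
    _ = (N 0 * (M.E h⁻¹ * M.E M.g) * M.E h * T).trace := by rw [E_inv_mul_E, one_mul]
    _ = (N 0 * M.E M.g * (M.E h⁻¹ * M.E h) * T).trace := by
        rw [hc']
        simp only [mul_assoc]
    _ = (N 0 * M.E M.g * T).trace := by rw [E_inv_mul_E, mul_one]

/-! ### Chains of elementary tensors `N ⊗ f` -/

/-- The element `N ⊗ f` of `gl_r(𝒲) = gl_r(ℂ) ⊗ 𝒲`. -/
def elem (N : Matrix (Fin r) (Fin r) ℂ) (f : Weyl M.P) : M.gl := Matrix.of fun p q => N p q • f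

theorem elem_apply (N : Matrix (Fin r) (Fin r) ℂ) (f : Weyl M.P) (p q : Fin r) :
    M.elem N f p q = N p q • f := rfl

theorem elem_one : M.elem 1 1 = 1 := by
  ext1 p q
  rw [elem_apply, Matrix.one_apply, Matrix.one_apply]
  split_ifs
  · exact one_smul _ _
  · exact zero_smul _ _

theorem elem_mul (N N' : Matrix (Fin r) (Fin r) ℂ) (f f' : Weyl M.P) :
    M.elem N f * M.elem N' f' = M.elem (N * N') (f * f') := by
  ext1 p q
  rw [elem_apply, Matrix.mul_apply, Matrix.mul_apply, Finset.sum_smul]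
  refine Finset.sum_congr rfl fun s _ => ?_
  rw [elem_apply, elem_apply, smul_mul_assoc, mul_smul_comm, smul_smul]

theorem actGl_elem (h : G) (N : Matrix (Fin r) (Fin r) ℂ) (f : Weyl M.P) :
    M.actGl h (M.elem N f) = M.elem (M.conjE h N) (M.actWeyl h f) := by
  ext1 p q
  rw [elem_apply, conjE_apply, Matrix.mul_apply, Finset.sum_smul]
  change ∑ a, ∑ b, (M.E h p a * M.E h⁻¹ b q) • M.actWeyl h (N a b • f) = _
  rw [Finset.sum_comm]
  refine Finset.sum_congr rfl fun b _ => ?_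
  rw [Matrix.mul_apply, Finset.sum_mul, Finset.sum_smul]
  refine Finset.sum_congr rfl fun a _ => ?_
  rw [map_smul, smul_smul]
  congr 1
  ring

theorem face_elem {m : ℕ} (i : Fin (m + 1)) (N : Fin (m + 2) → Matrix (Fin r) (Fin r) ℂ)
    (f : Fin (m + 2) → Weyl M.P) :
    face (M.actGl M.g) i (fun α => M.elem (N α) (f α)) =
      fun α => M.elem (face (M.conjE M.g) i N α) (face (M.actWeyl M.g) i f α) := by
  funext j
  simp only [face]
  split_ifs <;> simp only [actGl_elem, elem_mul]

theorem lastFace_elem {m : ℕ} (N : Fin (m + 2) → Matrix (Fin r) (Fin r) ℂ)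
    (f : Fin (m + 2) → Weyl M.P) :
    lastFace (fun α => M.elem (N α) (f α)) =
      fun α => M.elem (lastFace N α) (lastFace (A := Weyl M.P) f α) := by
  funext j
  simp only [lastFace]
  split_ifs <;> simp only [elem_mul]

theorem cyclicTerm_elem {m : ℕ} (i : Fin (m + 1)) (N : Fin (m + 1) → Matrix (Fin r) (Fin r) ℂ)
    (f : Fin (m + 1) → Weyl M.P) :
    cyclicTerm (M.actGl M.g) i (fun α => M.elem (N α) (f α)) =
      fun α => M.elem (cyclicTerm (M.conjE M.g) i N α) (cyclicTerm (M.actWeyl M.g) i f α) := by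
  funext j
  refine Fin.cases ?_ (fun j => ?_) j
  · exact M.elem_one.symm
  · simp only [cyclicTerm, Fin.cons_succ]
    split_ifs <;> simp only [actGl_elem]

/-- A matrix over the Weyl algebra is a sum of matrix units times scalars, so chains are spanned by
elementary tensors. On these the matrix part and the Weyl part of every operator separate. -/
theorem chain_hom_ext {m : ℕ} {W : Type*} [AddCommMonoid W] [Module ℂ W]
    {φ ψ : Chain M.gl m →ₗ[ℂ] W}
    (h : ∀ (N : Fin (m + 1) → Matrix (Fin r) (Fin r) ℂ) (f : Fin (m + 1) → Weyl M.P),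
      φ (Chain.mk fun α => M.elem (N α) (f α)) = ψ (Chain.mk fun α => M.elem (N α) (f α))) :
    φ = ψ := by
  suffices key : φ ∘ₗ (degenerate M.gl m).mkQ = ψ ∘ₗ (degenerate M.gl m).mkQ by
    refine LinearMap.ext fun O => ?_
    obtain ⟨t, rfl⟩ := (degenerate M.gl m).mkQ_surjective O
    exact LinearMap.congr_fun key t
  refine PiTensorProduct.ext (MultilinearMap.ext fun a => ?_)
  have e : a = fun α => ∑ x : Fin r × Fin r, M.elem (Matrix.single x.1 x.2 1) (a α x.1 x.2) := by
    funext α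
    ext1 p q
    rw [Matrix.sum_apply, Finset.sum_eq_single (p, q)]
    · rw [elem_apply, Matrix.single_apply_same, one_smul]
    · intro x _ hx
      rw [elem_apply, Matrix.single_apply_of_ne, zero_smul]
      exact fun hx' => hx (Prod.ext hx'.1 hx'.2)
    · simp
  rw [e, MultilinearMap.map_sum, MultilinearMap.map_sum]
  exact Finset.sum_congr rfl fun x _ => h _ _

/-- The sum over matrix entries reassembles the multilinear expansion of the twisted trace, which
splits off as a scalar. -/
theorem corr_mk_elem {m : ℕ} (N : Fin (m + 1) → Matrix (Fin r) (Fin r) ℂ)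
    (f : Fin (m + 1) → Weyl M.P) :
    M.corr m (Chain.mk fun α => M.elem (N α) (f α)) = M.trg N • M.scalarForm m f := by
  have hs : ∀ (p q : Fin (m + 1) → Fin r) (I : Fin m → Fin (2 * k)) α,
      M.slot p q I α (M.elem (N α) (f α)) = N α (p α) (q α) • scalarSlot I f α := by
    intro p q I α
    refine Fin.cases ?_ (fun α => ?_) α
    · rfl
    · exact map_smul (mapCoeff (pd (Sum.inl (I α)))) (N α.succ (p α.succ) (q α.succ)) (f α.succ)
  have hk : ∀ (p q : Fin (m + 1) → Fin r) (I : Fin m → Fin (2 * k)),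
      ((M.kernel m).compLinearMap (M.slot p q I)) (fun α => M.elem (N α) (f α)) =
        (∏ α, N α (p α) (q α)) • M.coeffForm I f := by
    intro p q I
    rw [MultilinearMap.compLinearMap_apply]
    simp only [hs]
    exact MultilinearMap.map_smul_univ _ _ _
  rw [corr, Chain.lift_mk, trg_eq_sum]
  simp only [corrMulti, _root_.sum_apply, _root_.smul_apply, LinearMap.compMultilinearMap_apply,
    hk, Finset.sum_smul]
  refine Finset.sum_congr rfl fun p _ => Finset.sum_congr rfl fun q _ => ?_
  unfold scalarForm
  rw [Finset.smul_sum]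
  refine Finset.sum_congr rfl fun I _ => ?_
  rw [map_smul, smul_smul, mul_comm (M.trg _)]
  rfl

/-! ### The correlation map on chains -/

theorem span_mk_elem (m : ℕ) : Submodule.span ℂ (Set.range fun x :
    (Fin (m + 1) → Matrix (Fin r) (Fin r) ℂ) × (Fin (m + 1) → Weyl M.P) =>
      (Chain.mk fun α => M.elem (x.1 α) (x.2 α) : Chain M.gl m)) = ⊤ := by
  set S := Submodule.span ℂ (Set.range fun x :
    (Fin (m + 1) → Matrix (Fin r) (Fin r) ℂ) × (Fin (m + 1) → Weyl M.P) =>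
      (Chain.mk fun α => M.elem (x.1 α) (x.2 α) : Chain M.gl m)) with hS
  -- The projection modulo the span vanishes on elementary tensors, hence everywhere.
  have e : S.mkQ = 0 := M.chain_hom_ext fun N f =>
    (Submodule.Quotient.mk_eq_zero _).2 (Submodule.subset_span ⟨(N, f), rfl⟩)
  rw [← S.ker_mkQ, e, LinearMap.ker_zero]

theorem corr_mem_formsOfDegree (m : ℕ) (O : Chain M.gl m) : M.corr m O ∈ formsOfDegree k m := by
  have h : (⊤ : Submodule ℂ (Chain M.gl m)) ≤ (formsOfDegree k m).comap (M.corr m) := by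
    rw [← M.span_mk_elem m, Submodule.span_le]
    rintro _ ⟨⟨N, f⟩, rfl⟩
    change M.corr m _ ∈ formsOfDegree k m
    rw [corr_mk_elem]
    exact Submodule.smul_mem _ _ (M.scalarForm_mem m f)
  exact h Submodule.mem_top

theorem actForms_corr {h : G} (hh : h ∈ Subgroup.centralizer {M.g}) {m : ℕ} (O : Chain M.gl m) :
    M.actForms h (M.corr m O) = M.corr m (Chain.act (M.actGl h) (M.actGl_one h) m O) := by
  have e : M.actForms h ∘ₗ M.corr m = M.corr m ∘ₗ Chain.act (M.actGl h) (M.actGl_one h) m :=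
    M.chain_hom_ext fun N f => by
      have e1 : Chain.act (M.actGl h) (M.actGl_one h) m (Chain.mk fun α => M.elem (N α) (f α)) =
          Chain.mk fun α => M.elem (M.conjE h (N α)) (M.actWeyl h (f α)) := by
        simp only [← actGl_elem]
        exact Chain.lift_mk _ _ _
      rw [LinearMap.comp_apply, LinearMap.comp_apply, e1, corr_mk_elem, corr_mk_elem,
        M.trg_conjE hh, map_smul]
      exact congrArg (fun x => M.trg N • x) (M.actForms_scalarForm hh f)
  exact LinearMap.congr_fun e O

theorem hbarMul_bvLaplacian_corr : ∀ (m : ℕ) (O : Chain M.gl m),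
    hbarMul k (M.bvLaplacian (M.corr m O)) = M.corr (m - 1) (M.b m O)
  | 0, O => by
    have e : M.bvLaplacian ∘ₗ M.corr 0 = 0 := M.chain_hom_ext fun N f => by
      rw [LinearMap.comp_apply, corr_mk_elem, map_smul, LinearMap.zero_apply]
      exact (congrArg (fun x => M.trg N • x) (M.bvLaplacian_scalarForm_zero f)).trans (smul_zero _)
    have e0 : M.bvLaplacian (M.corr 0 O) = 0 := LinearMap.congr_fun e O
    rw [e0, map_zero]
    -- In degree 0 the truncated index `m - 1` is again 0; this is harmless because the Hochschild
    -- differential is 0 there.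
    exact (map_zero (M.corr 0)).symm
  | m + 1, O => by
    have e : hbarMul k ∘ₗ M.bvLaplacian ∘ₗ M.corr (m + 1) = M.corr m ∘ₗ M.b (m + 1) :=
      M.chain_hom_ext fun N f => by
        have hb : M.b (m + 1) (Chain.mk fun α => M.elem (N α) (f α)) =
            ∑ i : Fin (m + 1), (-1 : ℂ) ^ (i : ℕ) • Chain.mk (fun α =>
              M.elem (face (M.conjE M.g) i N α) (face (M.actWeyl M.g) i f α)) +
            (-1 : ℂ) ^ (m + 1) • Chain.mk (fun α =>
              M.elem (lastFace N α) (lastFace (A := Weyl M.P) f α)) := by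
          simp only [← face_elem, ← lastFace_elem]
          refine (Chain.lift_mk _ (bMulti_degenerate _ (M.actGl_one M.g) m) _).trans ?_
          simp only [bMulti, _root_.add_apply, _root_.sum_apply, _root_.smul_apply]
          rfl
        rw [LinearMap.comp_apply, LinearMap.comp_apply, LinearMap.comp_apply, hb, corr_mk_elem,
          map_add, map_sum, map_smul, map_smul, map_smul]
        simp only [map_smul, corr_mk_elem, trg_face, trg_lastFace]
        refine (congrArg (fun x => M.trg N • x) (M.hbarMul_bvLaplacian_scalarForm f)).trans ?_
        simp only [smul_add, Finset.smul_sum, smul_comm (M.trg N)]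
    exact LinearMap.congr_fun e O

theorem deRham_corr (m : ℕ) (O : Chain M.gl m) :
    deRham k (M.corr m O) = M.corr (m + 1) (M.B m O) := by
  have e : deRham k ∘ₗ M.corr m = M.corr (m + 1) ∘ₗ M.B m := M.chain_hom_ext fun N f => by
    have hB : M.B m (Chain.mk fun α => M.elem (N α) (f α)) =
        ∑ i : Fin (m + 1), (-1 : ℂ) ^ (m * (i : ℕ)) • Chain.mk (fun α =>
          M.elem (cyclicTerm (M.conjE M.g) i N α) (cyclicTerm (M.actWeyl M.g) i f α)) := by
      simp only [← cyclicTerm_elem]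
      refine (Chain.lift_mk _ (connesMulti_degenerate _ (M.actGl_one M.g) m) _).trans ?_
      simp only [connesMulti, _root_.sum_apply, _root_.smul_apply]
      rfl
    rw [LinearMap.comp_apply, LinearMap.comp_apply, hB, corr_mk_elem, map_sum, map_smul]
    simp only [map_smul, corr_mk_elem, trg_cyclicTerm]
    refine (congrArg (fun x => M.trg N • x) (M.deRham_scalarForm f)).trans ?_
    simp only [Finset.smul_sum, smul_comm (M.trg N)]
  exact LinearMap.congr_fun e O

end TwistedSector

end OrbifoldHKR
-- The main theorem
theorem mainTheorem4 {k l r : ℕ} {G : Type*} [Group G] [Finite G]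
    (M : OrbifoldHKR.TwistedSector k l r G) (m : ℕ)
    (O : OrbifoldHKR.Chain M.gl m) (hO : O ∈ M.invariantChains m) :
    (M.corr m O ∈ OrbifoldHKR.TwistedSector.formsOfDegree k m ∧
      M.corr m O ∈ M.invariantForms) ∧
    OrbifoldHKR.TwistedSector.hbarMul k (M.bvLaplacian (M.corr m O)) =
      M.corr (m - 1) (M.b m O) ∧
    OrbifoldHKR.TwistedSector.deRham k (M.corr m O) = M.corr (m + 1) (M.B m O) := by
  refine ⟨⟨M.corr_mem_formsOfDegree m O, fun h hh => ?_⟩, M.hbarMul_bvLaplacian_corr m O,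
    M.deRham_corr m O⟩
  rw [M.actForms_corr hh, hO h hh]
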